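/- Let $k$ be an algebraically closed field, let $X$ and $Y$ be irreducible smooth projective curves over $k$, and let $f:X\to Y$ be a dominant, generically smooth $k$-morphism of degree $r=[k(X):k(Y)]$; if $\operatorname{char}(k)\neq 0$, assume $\operatorname{char}(k)>r$. For a closed point $x\in X$ let $m_x\ge 1$ be the multiplicity (ramification index) of $f$ at $x$, and let $\Delta=f(\{x : m_x\ge 2\})\subset Y$ be the branch locus. The sheaf $f_*\mathcal O_X$ is a vector bundle of rank $r$ on $Y$, and it carries the following natural parabolic structure with parabolic divisor $\Delta$. For $y\in\Delta$, $x\in f^{-1}(y)$ and $0\le j\le m_x$, let $\mathbf F(x,j)$ be the image of the fiber at $y$ of $f_*\mathcal O_X\bigl(-jx-\sum_{z\in f^{-1}(y),\,z\ne x}m_z z\bigr)$ in the fiber $(f_*\mathcal O_X)_y$. The parabolic weights at $y$ are the numbers $j/m_x$ with $x\in f^{-1}(y)$ and $0\le j<m_x$; the subspace of $(f_*\mathcal O_X)_y$ of weight at least $\lambda$ is the sum of the $\mathbf F(x,j)$ with $x\in f^{-1}(y)$, $0\le j<m_x$ and $j/m_x\ge\lambda$. If $\alpha_{y,1}<\dots<\alpha_{y,n_y}$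 are the distinct weights at $y$, the filtration $(f_*\mathcal O_X)_y=V_y^1\supsetneq V_y^2\supsetneq\dots\supsetneq V_y^{n_y}\supsetneq V_y^{n_y+1}=0$ is given by the subspaces $V_y^i$ of weight at least $\alpha_{y,i}$, $1\le i\le n_y$. These data form a parabolic vector bundle $(f_*\mathcal O_X)_*$ of rank $r$. Then the parabolic degree of $(f_*\mathcal O_X)_*$ is zero: $$\text{par-deg}\bigl((f_*\mathcal O_X)_*\bigr):=\deg(f_*\mathcal O_X)+\sum_{y\in\Delta}\sum_{i=1}^{n_y}\alpha_{y,i}\,\dim_k\bigl(V_y^i/V_y^{i+1}\bigr)=0 .$$ -/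

import Mathlib

open AlgebraicGeometry CategoryTheory
open scoped TensorProduct

universe u

noncomputable section

/-- A smooth projective (irreducible) curve over a field `k`: an integral scheme that is smooth of
relative dimension one and proper over `k`.  (Proper curves over a field are projective.) -/
structure SmoothProjectiveCurve (k : Type u) [Field k] where
  /-- the underlying scheme -/
  X : Scheme.{u}
  /-- the structure morphism -/
  str : X ⟶ Spec (.of k)
  [integral : IsIntegral X]
  [smooth : SmoothOfRelativeDimension 1 str]
  [proper : IsProper str]

namespace SmoothProjectiveCurve

attribute [instance] integral smooth proper

instance {k : Type u} [Field k] (C : SmoothProjectiveCurve k) : IsLocallyNoetherian C.X :=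
  LocallyOfFiniteType.isLocallyNoetherian C.str

end SmoothProjectiveCurve

namespace CurveBundle

/-! ### Stalks, vector bundles, fibres -/

section Bundles

variable {Y : Scheme.{u}}

/-- The stalk `M_y` of a sheaf of modules `M` at a point `y`. -/
def Stalk (M : Y.Modules) (y : Y) : Type u :=
  ↑(TopCat.Presheaf.stalk M.presheaf y)

instance (M : Y.Modules) (y : Y) : AddCommGroup (Stalk M y) :=
  inferInstanceAs (AddCommGroup ↑(TopCat.Presheaf.stalk M.presheaf y))

/-- The module structure on stalks, for presheaves of modules. -/
abbrev presheafStalkModule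
    (M : PresheafOfModules.{u} (Y.presheaf ⋙ forget₂ CommRingCat RingCat)) (y : Y) :
    Module (Y.presheaf.stalk y) ↑(TopCat.Presheaf.stalk M.presheaf y) :=
  inferInstance

/-- The stalk `M_y` is a module over the local ring `𝒪_(Y,y)`. -/
instance (M : Y.Modules) (y : Y) : Module (Y.presheaf.stalk y) (Stalk M y) :=
  presheafStalkModule M.val y

/-- The germ at `y` of a section of `M` over an open neighbourhood of `y`. -/
def germ (M : Y.Modules) {V : Y.Opens} (y : Y) (hy : y ∈ V) (s : Γ(M, V)) : Stalk M y :=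
  TopCat.Presheaf.germ M.presheaf V y hy s

/-- The localisation map from the stalk at `y` to the stalk at the generic point. -/
def toGeneric [IrreducibleSpace Y] (M : Y.Modules) (y : Y) :
    Stalk M y → Stalk M (genericPoint Y) :=
  TopCat.Presheaf.stalkSpecializes M.presheaf ((genericPoint_spec Y).specializes trivial)

/-- `M` is a vector bundle of rank `r`: locally there are `r` sections which form a basis of every
stalk, i.e. which define an isomorphism `𝒪_V ^ r ≅ M|_V`. -/
def IsVectorBundle (M : Y.Modules) (r : ℕ) : Prop :=
  ∀ y : Y, ∃ (V : Y.Opens) (_ : y ∈ V) (s : Fin r → Γ(M, V)),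
    ∀ (z : Y) (hz : z ∈ V),
      LinearIndependent (Y.presheaf.stalk z) (fun i => germ M z hz (s i)) ∧
      Submodule.span (Y.presheaf.stalk z) (Set.range fun i => germ M z hz (s i)) = ⊤

/-- The residue field `κ(y)`. -/
abbrev Kappa (Y : Scheme.{u}) (y : Y) : Type u := IsLocalRing.ResidueField (Y.presheaf.stalk y)

/-- The fibre `κ(y) ⊗ M_y` of `M` at `y`. -/
abbrev Fiber (M : Y.Modules) (y : Y) : Type u := Kappa Y y ⊗[Y.presheaf.stalk y] Stalk M y

end Bundles

/-! ### The degree of a vector bundle on a curve -/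

section Degree

variable {Y : Scheme.{u}} [IsIntegral Y] [IsLocallyNoetherian Y]

/-- The order at `y` of the rational section `b₁ ∧ ⋯ ∧ bₙ` of `det M`, where `b` is a basis of the
generic stalk of `M`: if `e` is a basis of the stalk `M_y`, then
`e₁ ∧ ⋯ ∧ eₙ = det_b(e) • b₁ ∧ ⋯ ∧ bₙ`, so the order is that of `det_b(e)⁻¹`.
It does not depend on the choice of `e`. -/
def detOrder (M : Y.Modules) {n : ℕ}
    (b : Module.Basis (Fin n) Y.functionField (Stalk M (genericPoint Y))) (y : Y) : ℤ :=
  open Classical in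
  if h : Nonempty (Module.Basis (Fin n) (Y.presheaf.stalk y) (Stalk M y)) then
    - Scheme.ord (b.det fun i => toGeneric M y (h.some i)) y
  else 0

/-- The degree of a vector bundle `M` on a projective curve over an algebraically closed field: the
degree of its determinant line bundle, i.e. the number of zeros minus the number of poles of a
nonzero rational section `b₁ ∧ ⋯ ∧ bₙ` of `det M`.  (It does not depend on the choice of `b`.) -/
def degree (M : Y.Modules) : ℤ :=
  open Classical in
  if h : Nonempty (Module.Basis (Fin (Module.finrank Y.functionField (Stalk M (genericPoint Y))))
      Y.functionField (Stalk M (genericPoint Y))) then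
    ∑ᶠ y ∈ closedPoints Y, detOrder M h.some y
  else 0

end Degree

/-! ### Parabolic bundles -/

/-- The dimension of `A / B`, for subspaces `B ⊆ A` of a vector space. -/
def quotientDim {K W : Type*} [Field K] [AddCommGroup W] [Module K W] (A B : Submodule K W) : ℕ :=
  Module.finrank K (A ⧸ B.submoduleOf A)

/-- The data of a parabolic bundle: a sheaf of modules `V`, a set `D` of points, and for each
`y ∈ D` a chain of subspaces `V_y = V¹ ⊋ V² ⊋ ⋯ ⊋ Vⁿ ⊋ Vⁿ⁺¹ = 0` of the fibre with weights
`0 ≤ α₁ < ⋯ < αₙ < 1`.  Indices are shifted by one: `flag y j` is `V^(j+1)`, `weight y j` is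
`α_(j+1)`.  The conditions are in `ParabolicData.IsParabolicBundle`. (Values at points outside `D`
are irrelevant.) -/
structure ParabolicData (Y : Scheme.{u}) where
  /-- the underlying sheaf of modules -/
  V : Y.Modules
  /-- the parabolic divisor -/
  D : Set Y
  /-- the length of the filtration at `y` -/
  n : Y → ℕ
  /-- the filtration at `y` -/
  flag : (y : Y) → Fin (n y + 1) → Submodule (Kappa Y y) (Fiber V y)
  /-- the parabolic weights at `y` -/
  weight : (y : Y) → Fin (n y) → ℚ

namespace ParabolicData

variable {Y : Scheme.{u}}

/-- The given data form a parabolic vector bundle of rank `r`. -/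
structure IsParabolicBundle (P : ParabolicData Y) (r : ℕ) : Prop where
  isVectorBundle : IsVectorBundle P.V r
  finite_divisor : P.D.Finite
  closed_points : P.D ⊆ closedPoints Y
  flag_first : ∀ y ∈ P.D, P.flag y 0 = ⊤
  flag_last : ∀ y ∈ P.D, P.flag y (Fin.last (P.n y)) = ⊥
  flag_strictAnti : ∀ y ∈ P.D, StrictAnti (P.flag y)
  weight_nonneg : ∀ y ∈ P.D, ∀ j, 0 ≤ P.weight y j
  weight_lt_one : ∀ y ∈ P.D, ∀ j, P.weight y j < 1
  weight_strictMono : ∀ y ∈ P.D, StrictMono (P.weight y)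

/-- The multiplicity `dim V^j / V^(j+1)` of the `j`-th weight at `y`. -/
def multiplicity (P : ParabolicData Y) (y : Y) (j : Fin (P.n y)) : ℕ :=
  quotientDim (P.flag y j.castSucc) (P.flag y j.succ)

/-- The parabolic degree: the degree of `V` plus the sum of all weights, counted with
multiplicity. -/
def parDeg [IsIntegral Y] [IsLocallyNoetherian Y] (P : ParabolicData Y) : ℚ :=
  (degree P.V : ℚ) + ∑ᶠ y ∈ P.D, ∑ j : Fin (P.n y), P.weight y j * (P.multiplicity y j : ℚ)

end ParabolicData

/-! ### The direct image of the structure sheaf -/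

section DirectImage

variable {X Y : Scheme.{u}} (f : X ⟶ Y)

/-- The degree of a dominant morphism of integral schemes: the degree of the extension of function
fields.  (For dominant `f` the point `f (genericPoint X)` is the generic point of `Y`.) -/
def mapDegree [IrreducibleSpace X] : ℕ :=
  letI := (f.stalkMap (genericPoint X)).hom.toAlgebra
  Module.finrank (Y.presheaf.stalk (f (genericPoint X))) X.functionField

/-- The multiplicity `m_x` of `f` at `x`: the largest `m` with
`𝔪_(f x) 𝒪_(X,x) ⊆ 𝔪_x ^ m`. -/
def mult (x : X) : ℕ :=
  letI := (f.stalkMap x).hom.toAlgebra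
  Ideal.ramificationIdx' (IsLocalRing.maximalIdeal (Y.presheaf.stalk (f x)))
    (IsLocalRing.maximalIdeal (X.presheaf.stalk x))

/-- The ramification locus of `f`. -/
def ramificationLocus : Set X := {x | x ∈ closedPoints X ∧ 2 ≤ mult f x}

/-- The branch locus of `f`. -/
def branchLocus : Set Y := f '' ramificationLocus f

/-- The sheaf of modules `f_* 𝒪_X`. -/
def directImage : Y.Modules :=
  (Scheme.Modules.pushforward f).obj (SheafOfModules.unit X.ringCatSheaf)

/-- The sections over `U` of the ideal sheaf `𝒪_X(-∑ D(z) z)`, for an effective divisor `D`: the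
functions on `U` that vanish to order at least `D(z)` at every `z ∈ U`. -/
def idealSections (D : X → ℕ) (U : X.Opens) : Ideal Γ(X, U) :=
  ⨅ z : U, (IsLocalRing.maximalIdeal (X.presheaf.stalk z.1) ^ D z.1).comap
    (X.presheaf.germ U z.1 z.2).hom

/-- The image in the stalk `(f_* 𝒪_X)_y` of the stalk of the subsheaf `f_* 𝒪_X(-D)`. -/
def stalkImage (D : X → ℕ) (y : Y) :
    Submodule (Y.presheaf.stalk y) (Stalk (directImage f) y) :=
  Submodule.span _ {t | ∃ (V : Y.Opens) (hy : y ∈ V) (s : Γ(X, f ⁻¹ᵁ V)),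
    s ∈ idealSections D (f ⁻¹ᵁ V) ∧ germ (directImage f) y hy s = t}

/-- The divisor `j x + ∑ m_z z`, the sum being over the points `z ≠ x` of the fibre of `f` at
`y`. -/
def fiberDivisor (y : Y) (x : X) (j : ℕ) : X → ℕ := fun z =>
  open Classical in if z = x then j else if f z = y then mult f z else 0

/-- The subspace `𝐅(x, j)` of the fibre of `f_* 𝒪_X` at `y`: the image of the fibre at `y` of
`f_* 𝒪_X(-j x - ∑ m_z z)`. -/
def fiberSubspace (y : Y) (x : X) (j : ℕ) : Submodule (Kappa Y y) (Fiber (directImage f) y) :=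
  (stalkImage f (fiberDivisor f y x j) y).baseChange (Kappa Y y)

/-- The subspace of the fibre of `f_* 𝒪_X` at `y` of parabolic weight at least `a`: the sum over
`x ∈ f⁻¹(y)` of the subspaces `𝐅(x, j)` whose weight `j / m_x` is at least `a`
(here `0 ≤ j < m_x`). -/
def weightSubspace (y : Y) (a : ℚ) : Submodule (Kappa Y y) (Fiber (directImage f) y) :=
  ⨆ (x : X) (_ : f x = y) (j : ℕ) (_ : j < mult f x) (_ : a ≤ (j : ℚ) / mult f x),
    fiberSubspace f y x j

/-- The parabolic weights at `y`: the numbers `j / m_x` for `x ∈ f⁻¹(y)` and `0 ≤ j < m_x`. -/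
def weightSet (y : Y) : Set ℚ :=
  {a | ∃ (x : X) (j : ℕ), f x = y ∧ j < mult f x ∧ a = (j : ℚ) / mult f x}

/-- The weights at `y` as a finite set (the set is finite as the fibre of `f` is). -/
def weightFinset (y : Y) : Finset ℚ :=
  open Classical in if h : (weightSet f y).Finite then h.toFinset else ∅

/-- The natural parabolic structure on `f_* 𝒪_X`: the parabolic divisor is the branch locus, the
weights `α₁ < ⋯ < αₙ` at `y` are the numbers `j / m_x` in increasing order, and the subspace with
weight `αᵢ` is the subspace of weight at least `αᵢ`. -/
def directImageParabolic : ParabolicData Y where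
  V := directImage f
  D := branchLocus f
  n y := (weightFinset f y).card
  flag y := Fin.lastCases ⊥ fun j =>
    weightSubspace f y ((weightFinset f y).orderEmbOfFin rfl j)
  weight y j := (weightFinset f y).orderEmbOfFin rfl j

end DirectImage

end CurveBundle

end

/-! Both terms of the parabolic degree are computed from ramification. For a closed point y put A =
𝒪_(Y,y), K = k(Y), L = k(X), and let B be the integral closure of A in L. The valuative criterion
identifies the valuation rings of L dominating A with the local rings 𝒪_(X,x), f x = y
(`isPlaceFamily`), and the stalk of f_* 𝒪_X at y with B (`stalkEquiv`). As the residue field of A is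
algebraically closed, 𝔪_A B = ∏ P_x ^ m_x with trivial residue extensions.

Choose b_(x,j), 0 ≤ j < m_x, of order exactly j at x and of order at least m_z at every other point
z of the fibre. They form an A-basis of B, and 𝐅(x, j) is spanned by the classes of the b_(x,j')
with j' ≥ j. So the parabolic filtration is the weight filtration of a basis with weights j / m_x,
and the weights at y add up to ∑_x (m_x - 1) / 2 (`sum_weight_mul_multiplicity`).

The same basis computes the trace form. Since m_x ≤ r is invertible in k, the ramification is tame
and the discriminant of B over A has order ∑_x (m_x - 1) (`discr_basis_associated`). For a basis β
of L over K and a basis e of B over A, disc(e) = det_β(e)² disc(β). Summing orders over all y, and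
using that the divisor of disc(β) has degree zero, gives 2 deg f_* 𝒪_X = -∑_y ∑_x (m_x - 1)
(`two_mul_degree_directImage`), and the two contributions cancel.

That principal divisors have degree zero (`finsum_ord_eq_zero`) is reduced by the norm to the
projective line, where rational functions split into linear factors. The discriminant also yields
local freeness: r sections near y have one rational function D as discriminant, and they form a
basis at every closed z where D has order zero (`isVectorBundle_directImage`). -/

open IsLocalRing

/-! ### Adapted bases over a discrete valuation ring -/

/-- A factorization `𝔪_A B = ∏ P i ^ e i` of the extension of the maximal ideal of a local ring `A`
into powers of distinct nonzero primes of `B` with trivial residue extensions. -/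
structure IsSplitFactorization (A : Type*) {B ι : Type*} [CommRing A] [IsLocalRing A] [CommRing B]
    [Algebra A B] [Fintype ι] (P : ι → Ideal B) (e : ι → ℕ) : Prop where
  prime : ∀ i, (P i).IsPrime
  ne_bot : ∀ i, P i ≠ ⊥
  injective : Function.Injective P
  pos : ∀ i, 0 < e i
  map_eq : (maximalIdeal A).map (algebraMap A B) = ∏ i, P i ^ e i
  residue : ∀ i b, ∃ a, b - algebraMap A B a ∈ P i

/-- Elements `b i j` with order exactly `j` at `P i` and order at least `e l` at the other
primes `P l`. -/
structure IsAdaptedSystem {B ι : Type*} [CommRing B] (P : ι → Ideal B) (e : ι → ℕ)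
    (b : ι → ℕ → B) : Prop where
  mem : ∀ i j, b i j ∈ P i ^ j
  mem_other : ∀ i j l, l ≠ i → b i j ∈ P l ^ e l
  notMem : ∀ i j, b i j ∉ P i ^ (j + 1)

theorem Submodule.mem_span_sup_of_subset {R M : Type*} [Semiring R] [AddCommMonoid M] [Module R M]
    {s t : Set M} {N : Submodule R M} (hst : s ⊆ t) {x : M} (hx : x ∈ Submodule.span R s ⊔ N) :
    x ∈ Submodule.span R t ⊔ N :=
  (sup_le_sup (Submodule.span_mono hst) le_rfl : Submodule.span R s ⊔ N ≤ _) hx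

namespace IsSplitFactorization

section Dedekind

variable {A B ι : Type*} [CommRing A] [IsLocalRing A] [CommRing B] [IsDedekindDomain B]
  [Algebra A B] [Fintype ι] {P : ι → Ideal B} {e : ι → ℕ}

theorem prime' (h : IsSplitFactorization A P e) (i : ι) : Prime (P i) :=
  Ideal.prime_of_isPrime (h.ne_bot i) (h.prime i)

theorem isMaximal (h : IsSplitFactorization A P e) (i : ι) : (P i).IsMaximal :=
  (h.prime i).isMaximal (h.ne_bot i)

theorem mem_prod_pow_iff (h : IsSplitFactorization A P e) (n : ι → ℕ) (x : B) :
    x ∈ ∏ i, P i ^ n i ↔ ∀ i, x ∈ P i ^ n i := by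
  rw [← IsDedekindDomain.inf_pow_eq_prod_of_prime Finset.univ P n (fun i _ => h.prime' i)
    fun i _ j _ hij hP => hij (h.injective hP)]
  simp [Submodule.mem_finsetInf]

theorem mem_map_iff (h : IsSplitFactorization A P e) (x : B) :
    x ∈ (maximalIdeal A).map (algebraMap A B) ↔ ∀ i, x ∈ P i ^ e i := by
  rw [h.map_eq, h.mem_prod_pow_iff]

/-- Unique factorization: the P i are distinct primes, so exponents can be read off from an
inclusion of products. -/
theorem prod_pow_injective (h : IsSplitFactorization A P e) {n m : ι → ℕ}
    (hnm : ∏ i, P i ^ n i ≤ ∏ i, P i ^ m i) : m ≤ n := by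
  classical
  intro i
  have h1 : P i ^ m i ∣ ∏ l, P l ^ n l :=
    
    dvd_trans (Finset.dvd_prod_of_mem (fun i => P i ^ m i) (Finset.mem_univ i))
      (Ideal.dvd_iff_le.mpr hnm)
  rw [← Finset.mul_prod_erase _ _ (Finset.mem_univ i)] at h1
  have h2 := (h.prime' i).pow_dvd_of_dvd_mul_right (m i) (fun hd => by
    obtain ⟨l, hl, hl'⟩ := ((h.prime' i).dvd_finsetProd_iff _).mp hd
    have := (h.prime' i).dvd_of_dvd_pow hl'
    rw [Ideal.dvd_iff_le] at this
    exact Finset.ne_of_mem_erase hl (h.injective ((h.isMaximal l).eq_of_le (h.prime i).ne_top this))) h1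
  exact (pow_dvd_pow_iff (h.prime' i).ne_zero (h.prime' i).not_isUnit).mp h2

theorem exists_adaptedSystem (h : IsSplitFactorization A P e) :
    ∃ b : ι → ℕ → B, IsAdaptedSystem P e b := by
  classical
  have key : ∀ i j, ∃ x, (x ∈ P i ^ j ∧ ∀ l, l ≠ i → x ∈ P l ^ e l) ∧ x ∉ P i ^ (j + 1) := by
    intro i j
    -- Raising the exponent at `i` from j to j + 1 strictly shrinks the ideal; any element of the
    -- difference can serve as b i j.
    have hne : ¬ ∏ l, P l ^ (Function.update e i j l) ≤
        ∏ l, P l ^ (Function.update e i (j + 1) l) := fun hle => by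
      simpa using h.prod_pow_injective hle i
    obtain ⟨x, hx, hx'⟩ := Set.not_subset.mp hne
    rw [SetLike.mem_coe, h.mem_prod_pow_iff] at hx hx'
    have hx1 : ∀ l, l ≠ i → x ∈ P l ^ e l := fun l hl => by simpa [hl] using hx l
    refine ⟨x, ⟨by simpa using hx i, hx1⟩, fun hx2 => hx' fun l => ?_⟩
    obtain rfl | hl := eq_or_ne l i
    · simpa using hx2
    · simpa [hl] using hx1 l hl
  choose b hb hb' using key
  exact ⟨b, fun i j => (hb i j).1, fun i j => (hb i j).2, hb'⟩

theorem comap_eq (h : IsSplitFactorization A P e) (i : ι) :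
    (P i).comap (algebraMap A B) = maximalIdeal A := by
  refine (((maximalIdeal.isMaximal A)).eq_of_le ((h.prime i).comap _).ne_top ?_).symm
  rw [← Ideal.map_le_iff_le_comap]
  intro x hx
  exact Ideal.pow_le_self (h.pos i).ne' ((h.mem_map_iff x).mp hx i)

theorem algebraMap_mem_pow (h : IsSplitFactorization A P e) (i : ι) {a : A}
    (ha : a ∈ maximalIdeal A) : algebraMap A B a ∈ P i ^ e i :=
  (h.mem_map_iff _).mp (Ideal.mem_map_of_mem _ ha) i

variable {b : ι → ℕ → B}

/-- One step of the expansion in an adapted system. -/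
theorem exists_sub_mem (h : IsSplitFactorization A P e) (hb : IsAdaptedSystem P e b) (i : ι)
    (j : ℕ) {x : B} (hx : x ∈ P i ^ j) (hx' : ∀ l, l ≠ i → x ∈ P l ^ e l) :
    ∃ a : A, x - a • b i j ∈ P i ^ (j + 1) ∧ ∀ l, l ≠ i → x - a • b i j ∈ P l ^ e l := by
  have := h.prime i
  obtain ⟨d, z, hz, hdz⟩ := Ideal.exists_mul_add_mem_pow_succ (h.ne_bot i) (b i j) x (hb.mem i j)
    (hb.notMem i j) hx
  obtain ⟨a, ha⟩ := h.residue i d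
  refine ⟨a, ?_, fun l hl => ?_⟩
  · have : x - a • b i j = b i j * (d - algebraMap A B a) + z := by
      rw [Algebra.smul_def, ← hdz]; ring
    rw [this]
    exact add_mem (by rw [pow_succ]; exact Ideal.mul_mem_mul (hb.mem i j) ha) hz
  · rw [Algebra.smul_def]
    exact sub_mem (hx' l hl) (Ideal.mul_mem_left _ _ (hb.mem_other i j l hl))

/-- Elements of order at least `j` at `P i` and at least `e l` at the other primes are
combinations of the `b i j'` with `j' ≥ j`, modulo `𝔪 B`. -/
theorem mem_span_sup (h : IsSplitFactorization A P e) (hb : IsAdaptedSystem P e b) (i : ι)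
    (j : ℕ) (hj : j ≤ e i) {x : B} (hx : x ∈ P i ^ j) (hx' : ∀ l, l ≠ i → x ∈ P l ^ e l) :
    x ∈ Submodule.span A {y | ∃ j', j ≤ j' ∧ j' < e i ∧ b i j' = y} ⊔
      maximalIdeal A • (⊤ : Submodule A B) := by
  induction hn : e i - j generalizing j x with
  | zero =>
    obtain rfl : j = e i := by omega
    refine Submodule.mem_sup_right ?_
    rw [Ideal.smul_top_eq_map, Submodule.restrictScalars_mem, h.mem_map_iff]
    intro l
    obtain rfl | hl := eq_or_ne l i
    exacts [hx, hx' l hl]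
  | succ n ih =>
    obtain ⟨a, ha, ha'⟩ := h.exists_sub_mem hb i j hx hx'
    have h1 := ih (j + 1) (by omega) ha ha' (by omega)
    have h2 : x = a • b i j + (x - a • b i j) := by ring
    rw [h2]
    refine add_mem (Submodule.mem_sup_left (Submodule.smul_mem _ _ (Submodule.subset_span
      ⟨j, le_rfl, by omega, rfl⟩))) (?_ : _ ∈ _)
    refine Submodule.mem_span_sup_of_subset ?_ h1
    rintro y ⟨j', h1, h2, h3⟩
    exact ⟨j', by omega, h2, h3⟩

/-- Compare orders at P i, by induction on j. Terms with smaller j have coefficients in 𝔪, and all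
other terms have order greater than j at P i; so the (i, j) term has order greater than j too, which
puts its coefficient in P i ∩ A = 𝔪. -/
theorem notMem_of_sum (h : IsSplitFactorization A P e) (hb : IsAdaptedSystem P e b)
    (c : (Σ i, Fin (e i)) → A)
    (hc : ∑ p, c p • b p.1 p.2 ∈ (maximalIdeal A).map (algebraMap A B))
    (p : Σ i, Fin (e i)) : c p ∈ maximalIdeal A := by
  classical
  obtain ⟨i, j, hj⟩ := p
  induction j using Nat.strong_induction_on with
  | _ j ih =>
    have h1 : ∑ p, c p • b p.1 p.2 ∈ P i ^ (j + 1) :=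
      Ideal.pow_le_pow_right hj ((h.mem_map_iff _).mp hc i)
    rw [← Finset.add_sum_erase _ _ (Finset.mem_univ ⟨i, j, hj⟩)] at h1
    have h2 : ∑ p ∈ Finset.univ.erase ⟨i, j, hj⟩, c p • b p.1 p.2 ∈ P i ^ (j + 1) := by
      refine sum_mem fun q hq => ?_
      obtain ⟨l, m, hm⟩ := q
      rw [Algebra.smul_def]
      by_cases hl : l = i
      · subst hl
        rcases lt_trichotomy m j with hmj | rfl | hmj
        · exact Ideal.mul_mem_right _ _ (Ideal.pow_le_pow_right hj
            (h.algebraMap_mem_pow l (ih m hmj hm)))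
        · simp at hq
        · exact Ideal.mul_mem_left _ _ (Ideal.pow_le_pow_right hmj (hb.mem l m))
      · exact Ideal.mul_mem_left _ _ (Ideal.pow_le_pow_right hj
          (hb.mem_other l m i (Ne.symm hl)))
    have h3 : algebraMap A B (c ⟨i, j, hj⟩) * b i j ∈ P i ^ (j + 1) := by
      simpa [Algebra.smul_def] using (Ideal.add_mem_iff_left _ h2).mp h1
    rw [← h.comap_eq i, Ideal.mem_comap]
    by_contra hn
    refine hb.notMem i j ?_
    have h4 : P i ^ (j + 1) ∣ Ideal.span {algebraMap A B (c ⟨i, j, hj⟩)} * Ideal.span {b i j} := by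
      rw [Ideal.span_singleton_mul_span_singleton, Ideal.dvd_span_singleton]
      exact h3
    have h5 := (h.prime' i).pow_dvd_of_dvd_mul_left (j + 1)
      (by rwa [Ideal.dvd_span_singleton]) h4
    rwa [Ideal.dvd_span_singleton] at h5

end Dedekind

section Basis

variable {A B ι : Type*} [CommRing A] [IsDomain A] [IsDiscreteValuationRing A] [CommRing B]
  [IsDedekindDomain B]
  [Algebra A B] [Module.Finite A B] [FaithfulSMul A B] [Fintype ι] {P : ι → Ideal B} {e : ι → ℕ}
  {b : ι → ℕ → B}

-- By `notMem_of_sum` the coefficients of a relation are divisible by the uniformizer. Dividing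
-- gives another relation, so each coefficient lies in every power of 𝔪 and vanishes by Krull's
-- intersection theorem.
omit [Module.Finite A B] in
theorem linearIndependent (h : IsSplitFactorization A P e) (hb : IsAdaptedSystem P e b) :
    LinearIndependent A fun p : Σ i, Fin (e i) => b p.1 p.2 := by
  obtain ⟨t, ht⟩ := IsDiscreteValuationRing.exists_irreducible A
  have htm : maximalIdeal A = Ideal.span {t} := ht.maximalIdeal_eq
  rw [Fintype.linearIndependent_iff]
  have key : ∀ n : ℕ, ∀ c : (Σ i, Fin (e i)) → A, ∑ p, c p • b p.1 p.2 = 0 →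
      ∀ p, c p ∈ maximalIdeal A ^ n := by
    intro n
    induction n with
    | zero => intro c _ p; simp
    | succ n ih =>
      intro c hc
      have h1 : ∀ p, ∃ d, c p = t * d := fun p => by
        have := h.notMem_of_sum hb c (by rw [hc]; exact zero_mem _) p
        rwa [htm, Ideal.mem_span_singleton] at this
      choose d hd using h1
      have h2 : ∑ p, d p • b p.1 p.2 = 0 := by
        have h3 : algebraMap A B t * ∑ p, d p • b p.1 p.2 = 0 := by
          rw [← hc, Finset.mul_sum]
          refine Finset.sum_congr rfl fun p _ => ?_
          rw [hd, Algebra.smul_def, Algebra.smul_def, map_mul, mul_assoc]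
        refine (mul_eq_zero.mp h3).resolve_left ?_
        rw [map_eq_zero_iff _ (FaithfulSMul.algebraMap_injective A B)]
        exact ht.ne_zero
      intro p
      rw [hd, mul_comm, pow_succ]
      exact Ideal.mul_mem_mul (ih d h2 p) (by rw [htm]; exact Ideal.mem_span_singleton_self t)
  intro c hc p
  have : c p ∈ ⨅ n : ℕ, maximalIdeal A ^ n := by
    rw [Submodule.mem_iInf]
    exact fun n => key n c hc p
  rwa [Ideal.iInf_pow_eq_bot_of_isLocalRing _ (maximalIdeal.isMaximal A).ne_top] at this

-- By Nakayama it is enough to generate B modulo 𝔪 B. The ideals ∏_(l ≠ i) P l ^ e l add up to B,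
-- since a maximal ideal containing all of them lies over 𝔪 and would equal two different P i;
-- elements of each one are expanded by `mem_span_sup` with j = 0.
omit [FaithfulSMul A B] in
theorem span_eq_top (h : IsSplitFactorization A P e) (hb : IsAdaptedSystem P e b) :
    ⊤ ≤ Submodule.span A (Set.range fun p : Σ i, Fin (e i) => b p.1 p.2) := by
  classical
  refine Submodule.le_of_le_smul_of_le_jacobson_bot Module.Finite.fg_top
    (maximalIdeal_le_jacobson _) ?_
  have hJ : (⨆ i, ∏ l, P l ^ (Function.update e i 0 l)) = (⊤ : Ideal B) := by
    by_contra hne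
    obtain ⟨Q, hQ, hle⟩ := Ideal.exists_le_maximal _ hne
    have h1 : (maximalIdeal A).map (algebraMap A B) ≤ Q := by
      rw [Ideal.map_le_iff_le_comap]
      have : (Q.comap (algebraMap A B)).IsMaximal := Ideal.isMaximal_comap_of_isIntegral_of_isMaximal Q
      rw [eq_maximalIdeal this]
    rw [h.map_eq, hQ.isPrime.prod_le] at h1
    obtain ⟨i, -, hi⟩ := h1
    have hi' : P i = Q := (h.isMaximal i).eq_of_le hQ.ne_top (hQ.isPrime.le_of_pow_le hi)
    have h2 := (le_iSup (fun i => ∏ l, P l ^ (Function.update e i 0 l)) i).trans hle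
    rw [hQ.isPrime.prod_le] at h2
    obtain ⟨l, -, hl⟩ := h2
    obtain rfl | hli := eq_or_ne l i
    · simp only [Function.update_self, pow_zero, Ideal.one_eq_top, top_le_iff] at hl
      exact hQ.ne_top hl
    · rw [Function.update_of_ne hli] at hl
      have := (h.isMaximal l).eq_of_le hQ.ne_top (hQ.isPrime.le_of_pow_le hl)
      exact hli (h.injective (this.trans hi'.symm))
  rintro x -
  have hx : x ∈ ⨆ i, ∏ l, P l ^ (Function.update e i 0 l) := hJ ▸ trivial
  induction hx using Submodule.iSup_induction' with
  | zero => exact zero_mem _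
  | add x y _ _ hx hy => exact add_mem hx hy
  | mem i x hx =>
    rw [h.mem_prod_pow_iff] at hx
    have := h.mem_span_sup hb i 0 (Nat.zero_le _) (x := x) (by simp)
      (fun l hl => by simpa [hl] using hx l)
    refine Submodule.mem_span_sup_of_subset ?_ this
    rintro _ ⟨j, -, hj, rfl⟩
    exact ⟨⟨i, j, hj⟩, rfl⟩

/-- The basis of `B` over `A` given by an adapted system. -/
noncomputable def basis (h : IsSplitFactorization A P e) (hb : IsAdaptedSystem P e b) :
    Module.Basis (Σ i, Fin (e i)) A B :=
  Module.Basis.mk (h.linearIndependent hb) (h.span_eq_top hb)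

@[simp]
theorem basis_apply (h : IsSplitFactorization A P e) (hb : IsAdaptedSystem P e b)
    (p : Σ i, Fin (e i)) : h.basis hb p = b p.1 p.2 := by
  simp [basis]

theorem finrank_eq (h : IsSplitFactorization A P e) : Module.finrank A B = ∑ i, e i := by
  obtain ⟨b, hb⟩ := h.exists_adaptedSystem
  rw [Module.finrank_eq_card_basis (h.basis hb)]
  simp

/-- The algebraic form of 𝐅(x, j): modulo 𝔪, the order conditions along the fibre cut out a
coordinate subspace of the adapted basis. -/
theorem mem_iff_mem_span_sup (h : IsSplitFactorization A P e) (hb : IsAdaptedSystem P e b) (i : ι)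
    (j : ℕ) (hj : j ≤ e i) (x : B) :
    (x ∈ P i ^ j ∧ ∀ l, l ≠ i → x ∈ P l ^ e l) ↔
      x ∈ Submodule.span A (h.basis hb '' {p | p.1 = i ∧ j ≤ p.2}) ⊔
        maximalIdeal A • (⊤ : Submodule A B) := by
  classical
  constructor
  · rintro ⟨hx, hx'⟩
    refine Submodule.mem_span_sup_of_subset ?_ (h.mem_span_sup hb i j hj hx hx')
    rintro _ ⟨j', h1, h2, rfl⟩
    exact ⟨⟨i, j', h2⟩, ⟨rfl, h1⟩, by simp⟩
  · have key : Submodule.span A (h.basis hb '' {p | p.1 = i ∧ j ≤ p.2}) ⊔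
        maximalIdeal A • (⊤ : Submodule A B) ≤
        (∏ l, P l ^ (Function.update e i j l)).restrictScalars A := by
      refine sup_le (Submodule.span_le.mpr ?_) ?_
      · rintro _ ⟨⟨l, m⟩, ⟨rfl, hm⟩, rfl⟩
        rw [SetLike.mem_coe, Submodule.restrictScalars_mem, h.mem_prod_pow_iff]
        intro i
        obtain rfl | hi := eq_or_ne i l
        · simpa using Ideal.pow_le_pow_right hm (hb.mem i m)
        · simpa [hi] using hb.mem_other l m i hi
      · rw [Ideal.smul_top_eq_map]
        intro x hx
        rw [Submodule.restrictScalars_mem, h.mem_map_iff] at hx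
        rw [Submodule.restrictScalars_mem, h.mem_prod_pow_iff]
        intro l
        obtain rfl | hl := eq_or_ne l i
        · simpa using Ideal.pow_le_pow_right hj (hx l)
        · simpa [hl] using hx l
    intro hx
    have := key hx
    rw [Submodule.restrictScalars_mem, h.mem_prod_pow_iff] at this
    exact ⟨by simpa using this i, fun l hl => by simpa [hl] using this l⟩

theorem repr_mem_of_mem (h : IsSplitFactorization A P e) (hb : IsAdaptedSystem P e b)
    (i : ι) (j : ℕ) (hj : j ≤ e i) {x : B} (hx : x ∈ P i ^ j) (hx' : ∀ l, l ≠ i → x ∈ P l ^ e l)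
    (p : Σ i, Fin (e i)) (hp : p.1 = i → (p.2 : ℕ) < j) :
    (h.basis hb).repr x p ∈ maximalIdeal A := by
  have h1 := (h.mem_iff_mem_span_sup hb i j hj x).mp ⟨hx, hx'⟩
  have h2 : Submodule.span A (h.basis hb '' {p | p.1 = i ∧ j ≤ p.2}) ⊔
      maximalIdeal A • (⊤ : Submodule A B) ≤
      Submodule.comap ((h.basis hb).coord p) (maximalIdeal A) := by
    refine sup_le (Submodule.span_le.mpr ?_) ?_
    · rintro _ ⟨q, ⟨hq, hq'⟩, rfl⟩
      have : q ≠ p := by rintro rfl; exact absurd (hp hq) (not_lt.mpr hq')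
      rw [SetLike.mem_coe, Submodule.mem_comap, Module.Basis.coord_apply, Module.Basis.repr_self,
        Finsupp.single_eq_of_ne this.symm]
      exact zero_mem _
    · rw [Submodule.smul_le]
      intro a ha y _
      simpa using Ideal.mul_mem_right _ _ ha
  exact h2 h1

/-- Multiplication by x - a i raises the order of b i j at P i, so modulo 𝔪 the diagonal entry of x
at (i, j) is a i, and each a i occurs e i times. -/
theorem trace_sub_mem (h : IsSplitFactorization A P e) (x : B) (a : ι → A)
    (ha : ∀ i, x - algebraMap A B (a i) ∈ P i) :
    Algebra.trace A B x - ∑ i, e i • a i ∈ maximalIdeal A := by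
  classical
  obtain ⟨b, hb⟩ := h.exists_adaptedSystem
  have hsum : ∑ i, e i • a i = ∑ p : Σ i, Fin (e i), a p.1 := by
    rw [Fintype.sum_sigma]; simp
  rw [Algebra.trace_eq_matrix_trace (h.basis hb), Matrix.trace, hsum, ← Finset.sum_sub_distrib]
  refine sum_mem fun p _ => ?_
  rw [Matrix.diag_apply, Algebra.leftMulMatrix_eq_repr_mul]
  have h1 := h.repr_mem_of_mem hb p.1 (p.2 + 1) p.2.2
    (x := (x - algebraMap A B (a p.1)) * h.basis hb p)
    (by rw [pow_succ', basis_apply]; exact Ideal.mul_mem_mul (ha _) (hb.mem _ _))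
    (fun l hl => by rw [basis_apply]; exact Ideal.mul_mem_left _ _ (hb.mem_other _ _ _ hl))
    p (fun _ => Nat.lt_succ_self _)
  rwa [sub_mul, ← Algebra.smul_def, map_sub, map_smul, Finsupp.sub_apply, Finsupp.smul_apply,
    Module.Basis.repr_self, Finsupp.single_eq_same, smul_eq_mul, mul_one] at h1

theorem trace_mem (h : IsSplitFactorization A P e) {x : B} (hx : ∀ i, x ∈ P i) :
    Algebra.trace A B x ∈ maximalIdeal A := by
  simpa using h.trace_sub_mem x 0 (by simpa using hx)

/-- Tameness enters here: modulo 𝔪 the trace is e i times the residue of x at P i. -/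
theorem isUnit_trace (h : IsSplitFactorization A P e) {x : B} (i : ι)
    (hi : IsUnit (e i : A)) (hx : x ∉ P i) (hx' : ∀ l, l ≠ i → x ∈ P l) :
    IsUnit (Algebra.trace A B x) := by
  classical
  obtain ⟨a, ha⟩ := h.residue i x
  have h1 := h.trace_sub_mem x (Pi.single i a) (fun l => by
    obtain rfl | hl := eq_or_ne l i
    · simpa using ha
    · simpa [hl] using hx' l hl)
  have h2 : ∑ l, e l • (Pi.single i a : ι → A) l = e i * a := by
    rw [Finset.sum_eq_single i] <;> simp +contextual
  have ha' : IsUnit a := by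
    rw [← notMem_maximalIdeal, ← h.comap_eq i, Ideal.mem_comap]
    intro hm
    exact hx (by simpa using add_mem ha hm)
  rw [h2] at h1
  rw [← notMem_maximalIdeal]
  intro hm
  have := sub_mem hm h1
  rw [sub_sub_cancel] at this
  exact (notMem_maximalIdeal.mpr (hi.mul ha')) this

end Basis

end IsSplitFactorization

/-! ### The tame discriminant and norms -/

namespace IsSplitFactorization

variable {A B ι : Type*} [CommRing A] [IsDomain A] [IsDiscreteValuationRing A] [CommRing B]
  [IsDedekindDomain B]
  [Algebra A B] [Module.Finite A B] [FaithfulSMul A B] [Fintype ι] {P : ι → Ideal B} {e : ι → ℕ}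
  {b : ι → ℕ → B}

omit [Module.Finite A B] [FaithfulSMul A B] in
theorem exists_eq_mul (h : IsSplitFactorization A P e) {t : A} (ht : Irreducible t) (n : ι → ℕ)
    {x : B} (hx : ∀ i, x ∈ P i ^ (e i + n i)) :
    ∃ y, x = algebraMap A B t * y ∧ ∀ i, y ∈ P i ^ n i := by
  have h1 : x ∈ (maximalIdeal A).map (algebraMap A B) * ∏ i, P i ^ n i := by
    rw [h.map_eq, ← Finset.prod_mul_distrib]
    simp_rw [← pow_add]
    rwa [h.mem_prod_pow_iff]
  rw [ht.maximalIdeal_eq, Ideal.map_span, Set.image_singleton,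
    Ideal.mem_span_singleton_mul] at h1
  obtain ⟨y, hy, rfl⟩ := h1
  exact ⟨y, rfl, (h.mem_prod_pow_iff n y).mp hy⟩

/-- Pair b i j with b i (e i - j) for j > 0: the product has order exactly e i at P i, so its trace
is t times a unit; for j = 0 the trace of (b i 0)² is already a unit. After permuting the columns
accordingly and extracting a factor t from the e i - 1 columns with j > 0, the matrix becomes
triangular modulo 𝔪 with units on the diagonal. -/
theorem discr_basis_associated [DecidableEq ι] (h : IsSplitFactorization A P e)
    (hb : IsAdaptedSystem P e b)
    (he : ∀ i, IsUnit (e i : A)) {t : A} (ht : Irreducible t) :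
    Associated (Algebra.discr A (h.basis hb)) (t ^ ∑ i, (e i - 1)) := by
  have hmem1 : ∀ i j l, l ≠ i → b i j ∈ P l := fun i j l hl =>
    Ideal.pow_le_self (h.pos l).ne' (hb.mem_other i j l hl)
  have (i : ι) : NeZero (e i) := ⟨(h.pos i).ne'⟩
  -- Negation in `Fin (e i)` sends j to e i - j for j > 0 and fixes 0.
  let σ : Equiv.Perm (Σ i, Fin (e i)) := Equiv.sigmaCongrRight fun i => Equiv.neg (Fin (e i))
  have hσ0 : ∀ q : Σ i, Fin (e i), (q.2 : ℕ) = 0 → σ q = q := by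
    rintro ⟨i, j⟩ hq
    have : j = 0 := Fin.ext hq
    simp [σ, this]
  have hσ1 : ∀ q : Σ i, Fin (e i), ((σ q).2 : ℕ) = (e q.1 - q.2) % e q.1 := by
    rintro ⟨i, j⟩
    exact Fin.val_neg' j
  have hσ : ∀ q : Σ i, Fin (e i), 0 < (q.2 : ℕ) → ((σ q).2 : ℕ) + q.2 = e q.1 := by
    rintro ⟨i, j⟩ hq
    rw [hσ1, Nat.mod_eq_of_lt (Nat.sub_lt (h.pos _) hq)]
    have := j.2
    simp only
    omega
  let d : (Σ i, Fin (e i)) → A := fun q => if (q.2 : ℕ) = 0 then 1 else t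
  have key : ∀ p q : Σ i, Fin (e i), ∃ z, Algebra.trace A B (b p.1 p.2 * b q.1 (σ q).2) = d q * z ∧
      (p = q → IsUnit z) ∧ ((q.2 : ℕ) ≤ p.2 → p ≠ q → z ∈ maximalIdeal A) := by
    intro p q
    by_cases hq : (q.2 : ℕ) = 0
    · refine ⟨_, by simp only [d, if_pos hq, one_mul]; rfl, ?_, ?_⟩
      · rintro rfl
        rw [hσ0 _ hq, hq]
        refine h.isUnit_trace p.1 (he _) (fun hm => ?_) fun l hl =>
          Ideal.mul_mem_left _ _ (hmem1 _ _ _ hl)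
        have := hb.notMem p.1 0
        rw [zero_add, pow_one] at this
        exact ((h.prime p.1).mem_or_mem hm).elim this this
      · intro _ hpq
        rw [hσ0 _ hq, hq]
        refine h.trace_mem fun l => ?_
        obtain ⟨i, j⟩ := p
        obtain ⟨i', j'⟩ := q
        obtain rfl | hl := eq_or_ne l i
        · obtain rfl | hl' := eq_or_ne l i'
          · refine Ideal.mul_mem_right _ _ (Ideal.pow_le_self (n := (j : ℕ)) ?_ (hb.mem l j))
            rintro hj
            exact hpq (by simp only at hq; rw [Sigma.mk.injEq]; exact ⟨rfl, heq_of_eq (Fin.ext (hj.trans hq.symm))⟩)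
          · exact Ideal.mul_mem_left _ _ (hmem1 _ _ _ hl')
        · exact Ideal.mul_mem_right _ _ (hmem1 _ _ _ hl)
    · have hq' := hσ q (Nat.pos_of_ne_zero hq)
      have hd : d q = t := if_neg hq
      have hdvd : (q.2 : ℕ) ≤ p.2 → ∃ y, b p.1 p.2 * b q.1 (σ q).2 = algebraMap A B t * y ∧
          (∀ l, (l = q.1 → p = q → False) → y ∈ P l) := by
        intro hpq
        -- The product has order at least e l + 1 at every P l, except at l = q.1 when p = q, where
        -- only e l is guaranteed.
        obtain ⟨y, hy, hy'⟩ := h.exists_eq_mul ht (fun l => if l = q.1 ∧ p = q then 0 else 1)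
          (x := b p.1 p.2 * b q.1 (σ q).2) (fun l => by
            by_cases hl : l = q.1
            · subst hl
              by_cases hp : q.1 = p.1
              · have h0 : ∀ i, i = p.1 → b p.1 p.2 ∈ P i ^ (p.2 : ℕ) := by
                  rintro _ rfl
                  exact hb.mem _ _
                have h1 := Ideal.mul_mem_mul (h0 _ hp) (hb.mem q.1 (σ q).2)
                rw [← pow_add] at h1
                refine Ideal.pow_le_pow_right ?_ h1
                split_ifs with h2
                · omega
                · have : (q.2 : ℕ) ≠ p.2 := fun h3 => h2 ⟨rfl, by
                    obtain ⟨i, j⟩ := p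
                    obtain ⟨i', j'⟩ := q
                    simp only at hp h3
                    subst hp
                    rw [Fin.ext h3]⟩
                  omega
              · have h1 := Ideal.mul_mem_mul (hb.mem_other p.1 p.2 q.1 hp) (hb.mem q.1 (σ q).2)
                rw [← pow_add] at h1
                refine Ideal.pow_le_pow_right ?_ h1
                have := (σ q).2.2
                split_ifs <;> omega
            · rw [if_neg (fun h => hl h.1)]
              have h2 := hb.mem_other q.1 (σ q).2 l hl
              by_cases hp : l = p.1
              · subst hp
                have h1 := Ideal.mul_mem_mul (hb.mem p.1 p.2) h2
                rw [← pow_add] at h1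
                exact Ideal.pow_le_pow_right (by omega) h1
              · have h1 := Ideal.mul_mem_mul (hb.mem_other p.1 p.2 l hp) h2
                rw [← pow_add] at h1
                exact Ideal.pow_le_pow_right (by have := h.pos l; omega) h1)
        refine ⟨y, hy, fun l hl => ?_⟩
        have := hy' l
        rwa [if_neg (fun h => hl h.1 h.2), pow_one] at this
      have hall : Algebra.trace A B (b p.1 p.2 * b q.1 (σ q).2) ∈ maximalIdeal A := by
        refine h.trace_mem fun l => ?_
        by_cases hl : l = q.1
        · subst hl
          refine Ideal.mul_mem_left _ _ (Ideal.pow_le_self ?_ (hb.mem q.1 (σ q).2))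
          have := q.2.2
          omega
        · exact Ideal.mul_mem_left _ _ (hmem1 _ _ _ hl)
      rw [ht.maximalIdeal_eq, Ideal.mem_span_singleton] at hall
      obtain ⟨z, hz⟩ := hall
      refine ⟨z, by rw [hd, hz], ?_, ?_⟩
      · rintro rfl
        obtain ⟨y, hy, hy'⟩ := hdvd le_rfl
        rw [hy, ← Algebra.smul_def, map_smul, smul_eq_mul] at hz
        rw [← mul_left_cancel₀ ht.ne_zero hz]
        refine h.isUnit_trace p.1 (he _) (fun hm => ?_) fun l hl => hy' l fun h _ => hl h
        have h1 : b p.1 p.2 * b p.1 (σ p).2 ∈ P p.1 ^ (e p.1 + 1) := by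
          rw [hy, pow_succ]
          exact Ideal.mul_mem_mul (h.algebraMap_mem_pow _ (by
            rw [ht.maximalIdeal_eq]; exact Ideal.mem_span_singleton_self t)) hm
        rw [← Ideal.dvd_span_singleton, ← Ideal.span_singleton_mul_span_singleton,
          show e p.1 + 1 = ((p.2 : ℕ) + (σ p).2) + 1 by omega] at h1
        rcases succ_dvd_or_succ_dvd_of_succ_sum_dvd_mul (h.prime' p.1)
          (Ideal.dvd_span_singleton.mpr (hb.mem p.1 p.2))
          (Ideal.dvd_span_singleton.mpr (hb.mem p.1 (σ p).2)) h1 with h2 | h2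
        · exact hb.notMem _ _ (Ideal.dvd_span_singleton.mp h2)
        · exact hb.notMem _ _ (Ideal.dvd_span_singleton.mp h2)
      · intro hpq hne
        obtain ⟨y, hy, hy'⟩ := hdvd hpq
        rw [hy, ← Algebra.smul_def, map_smul, smul_eq_mul] at hz
        rw [← mul_left_cancel₀ ht.ne_zero hz]
        exact h.trace_mem fun l => hy' l fun _ h => hne h
  choose N hN hNu hNm using key
  have hdet : IsUnit (Matrix.of N).det := by
    rw [← notMem_maximalIdeal, ← IsLocalRing.residue_eq_zero_iff, RingHom.map_det]
    -- `hNm` covers all q.2 ≤ p.2 with p ≠ q: in the residue field the entries below the blocks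
    -- vanish, and each block of constant j is diagonal.
    have htri : ((IsLocalRing.residue A).mapMatrix (Matrix.of N)).BlockTriangular fun p => (p.2 : ℕ) := by
      intro p q hpq
      rw [RingHom.mapMatrix_apply, Matrix.map_apply, IsLocalRing.residue_eq_zero_iff]
      exact hNm p q hpq.le (by rintro rfl; exact lt_irrefl _ hpq)
    rw [htri.det]
    refine Finset.prod_ne_zero_iff.mpr fun a _ => ?_
    have hdiag : ((IsLocalRing.residue A).mapMatrix (Matrix.of N)).toSquareBlock (fun p => (p.2 : ℕ)) a =
        Matrix.diagonal fun p => IsLocalRing.residue A (N p.1 p.1) := by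
      ext p q
      rw [Matrix.toSquareBlock_def, Matrix.of_apply, RingHom.mapMatrix_apply, Matrix.map_apply]
      obtain rfl | hpq := eq_or_ne p q
      · rw [Matrix.diagonal_apply_eq]; rfl
      · rw [Matrix.diagonal_apply_ne _ hpq, IsLocalRing.residue_eq_zero_iff]
        exact hNm p.1 q.1 (by rw [p.2, q.2]) (fun h => hpq (Subtype.ext h))
    rw [hdiag, Matrix.det_diagonal, Finset.prod_ne_zero_iff]
    intro p _
    rw [Ne, IsLocalRing.residue_eq_zero_iff, notMem_maximalIdeal]
    exact hNu _ _ rfl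
  have h1 : (Algebra.traceMatrix A (h.basis hb)).submatrix id σ =
      Matrix.of fun p q => d q * Matrix.of N p q := by
    ext p q
    rw [Matrix.submatrix_apply, Algebra.traceMatrix_apply, Algebra.traceForm_apply, basis_apply,
      basis_apply]
    exact hN p q
  have h2 := congrArg Matrix.det h1
  rw [Matrix.det_permute', Matrix.det_mul_row] at h2
  have h3 : ∏ q, d q = t ^ ∑ i, (e i - 1) := by
    rw [Fintype.prod_sigma, ← Finset.prod_pow_eq_pow_sum]
    refine Finset.prod_congr rfl fun i _ => ?_
    rw [← Finset.mul_prod_erase _ _ (Finset.mem_univ 0)]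
    have : ∀ j ∈ Finset.univ.erase (0 : Fin (e i)), d ⟨i, j⟩ = t := by
      intro j hj
      refine if_neg fun hj' => Finset.ne_of_mem_erase hj (Fin.ext hj')
    rw [Finset.prod_congr rfl this]
    simp [d]
  rw [h3] at h2
  rw [Algebra.discr_def]
  have h4 : IsUnit ((Equiv.Perm.sign σ : ℤ) : A) :=
    (Units.isUnit _).map (Int.castRingHom A)
  have h5 : Associated ((Equiv.Perm.sign σ : ℤ) * (Algebra.traceMatrix A (h.basis hb)).det)
      (Algebra.traceMatrix A (h.basis hb)).det := associated_unit_mul_left _ _ h4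
  refine h5.symm.trans ?_
  rw [h2]
  exact associated_mul_unit_left _ _ hdet

/-- A change of basis multiplies the discriminant by the square of a unit. -/
theorem discr_associated (h : IsSplitFactorization A P e)
    (he : ∀ i, IsUnit (e i : A)) {t : A} (ht : Irreducible t) {κ : Type*} [Fintype κ]
    [DecidableEq κ] (c : Module.Basis κ A B) :
    Associated (Algebra.discr A c) (t ^ ∑ i, (e i - 1)) := by
  classical
  obtain ⟨b, hb⟩ := h.exists_adaptedSystem
  refine Associated.trans ?_ (h.discr_basis_associated hb he ht)
  let c' := c.reindex (c.indexEquiv (h.basis hb))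
  have h1 : Algebra.discr A c = Algebra.discr A c' := by
    rw [Module.Basis.coe_reindex, Algebra.discr_reindex]
  rw [h1, ← Module.Basis.toMatrix_map_vecMul (h.basis hb) c', Algebra.discr_of_matrix_vecMul]
  refine associated_unit_mul_left _ _ (IsUnit.pow 2 ?_)
  rw [← Module.Basis.det_apply]
  exact (h.basis hb).isUnit_det c'

/-- The norm of P i is 𝔪 ^ s i with s i ≥ 1. The norm of 𝔪 B is 𝔪 ^ ∑ e i by `finrank_eq` and 𝔪 ^ ∑
s i e i by the factorization, so every s i is 1. -/
theorem relNorm_eq (h : IsSplitFactorization A P e) (i : ι) :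
    Ideal.relNorm A (P i) = maximalIdeal A := by
  have : Module.IsTorsionFree A B := inferInstance
  have hlo : ∀ i, (P i).LiesOver (maximalIdeal A) := fun i => ⟨(h.comap_eq i).symm⟩
  have hm : Prime (maximalIdeal A) := Ideal.prime_of_isPrime
    (IsDiscreteValuationRing.not_a_field A) inferInstance
  choose s hs using fun i => Ideal.exists_relNorm_eq_pow_of_isPrime (P i) (maximalIdeal A)
  have hs1 : ∀ i, 1 ≤ s i := fun i => by
    have h1 := Ideal.relNorm_le_comap (R := A) (P i)
    rw [hs, h.comap_eq] at h1
    by_contra h0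
    have h0 : s i = 0 := by omega
    rw [h0, pow_zero, Ideal.one_eq_top, top_le_iff] at h1
    exact (maximalIdeal.isMaximal A).ne_top h1
  have h2 := Ideal.relNorm_algebraMap (R := A) B (maximalIdeal A)
  rw [h.map_eq, map_prod, h.finrank_eq] at h2
  simp_rw [map_pow, hs, ← pow_mul] at h2
  rw [Finset.prod_pow_eq_pow_sum] at h2
  have h3 : ∑ i, s i * e i = ∑ i, e i := le_antisymm
    ((pow_dvd_pow_iff hm.ne_zero hm.not_isUnit).mp h2.dvd)
    ((pow_dvd_pow_iff hm.ne_zero hm.not_isUnit).mp h2.symm.dvd)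
  have h4 := (Finset.sum_eq_sum_iff_of_le (fun i _ => Nat.le_mul_of_pos_left (e i) (hs1 i))).mp
    h3.symm i (Finset.mem_univ i)
  have h5 : s i = 1 := by
    have := h.pos i
    nlinarith
  rw [hs, h5, pow_one]

theorem norm_associated (h : IsSplitFactorization A P e) {t : A} (ht : Irreducible t) (x : B)
    (n : ι → ℕ) (hx : Ideal.span {x} = ∏ i, P i ^ n i) :
    Associated (Algebra.norm A x) (t ^ ∑ i, n i) := by
  obtain ⟨b, hb⟩ := h.exists_adaptedSystem
  have : Module.Free A B := Module.Free.of_basis (h.basis hb)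
  have h1 := congrArg (Ideal.relNorm A) hx
  rw [Ideal.relNorm_singleton, Algebra.intNorm_eq_norm, map_prod] at h1
  simp_rw [map_pow, h.relNorm_eq] at h1
  rwa [Finset.prod_pow_eq_pow_sum, ht.maximalIdeal_eq, Ideal.span_singleton_pow,
    Ideal.span_singleton_eq_span_singleton] at h1

end IsSplitFactorization

/-! ### Integer-valued orders -/

/-- The normalized order function on the fraction field of a discrete valuation ring, with the
junk value `0` at `0`. -/
noncomputable def ordZ (O : Type*) {L : Type*} [CommRing O] [IsDomain O]
    [IsDiscreteValuationRing O] [Field L] [Algebra O L] [IsFractionRing O L] (x : L) : ℤ :=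
  Multiplicative.toAdd ((Ring.ordFrac O x).unzeroD 1)

section OrdZ

variable {O L : Type*} [CommRing O] [IsDomain O] [IsDiscreteValuationRing O] [Field L]
  [Algebra O L] [IsFractionRing O L]

theorem ordZ_eq_iff {x : L} (hx : x ≠ 0) {n : ℤ} :
    ordZ O x = n ↔ Ring.ordFrac O x = Multiplicative.ofAdd n := by
  rw [ordZ, WithZero.unzeroD_eq_unzero ((map_ne_zero _).mpr hx)]
  exact WithZero.toAdd_unzero_eq_iff _ _

theorem ordFrac_eq_ordZ {x : L} (hx : x ≠ 0) :
    Ring.ordFrac O x = Multiplicative.ofAdd (ordZ O x) :=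
  (ordZ_eq_iff hx).mp rfl

theorem ordZ_mul {x y : L} (hx : x ≠ 0) (hy : y ≠ 0) :
    ordZ O (x * y) = ordZ O x + ordZ O y := by
  rw [ordZ_eq_iff (mul_ne_zero hx hy), map_mul, ordFrac_eq_ordZ hx, ordFrac_eq_ordZ hy]
  rfl

@[simp]
theorem ordZ_one : ordZ O (1 : L) = 0 := by
  rw [ordZ_eq_iff one_ne_zero, map_one]; rfl

theorem ordZ_inv {x : L} (hx : x ≠ 0) : ordZ O x⁻¹ = - ordZ O x := by
  have := ordZ_mul (O := O) hx (inv_ne_zero hx)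
  rw [mul_inv_cancel₀ hx, ordZ_one] at this
  omega

theorem ordZ_pow {x : L} (hx : x ≠ 0) (n : ℕ) : ordZ O (x ^ n) = n * ordZ O x := by
  induction n with
  | zero => simp
  | succ n ih =>
    rw [pow_succ, ordZ_mul (pow_ne_zero n hx) hx, ih]
    push_cast
    ring

theorem ordZ_unit {u : O} (hu : IsUnit u) : ordZ O (algebraMap O L u) = 0 := by
  rw [ordZ_eq_iff ((hu.map _).ne_zero), Ring.ordFrac_of_isUnit hu]; rfl

theorem ordZ_irreducible {t : O} (ht : Irreducible t) : ordZ O (algebraMap O L t) = 1 := by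
  rw [ordZ_eq_iff (by simpa using ht.ne_zero), Ring.ordFrac_irreducible ht]; rfl

theorem ordZ_associated {x : O} {t : O} (ht : Irreducible t) {n : ℕ} (h : Associated x (t ^ n)) :
    ordZ O (algebraMap O L x) = n := by
  obtain ⟨u, hu⟩ := h.symm
  have ht' : algebraMap O L t ≠ 0 := by simpa using ht.ne_zero
  rw [← hu, map_mul, map_pow, ordZ_mul (pow_ne_zero n ht') (u.isUnit.map _).ne_zero,
    ordZ_unit u.isUnit, ordZ_pow ht', ordZ_irreducible ht]
  simp

theorem natCast_le_ordZ_iff {x : L} (hx : x ≠ 0) {n : ℕ} :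
    (n : ℤ) ≤ ordZ O x ↔ ∃ o ∈ maximalIdeal O ^ n, algebraMap O L o = x := by
  obtain ⟨t, ht⟩ := IsDiscreteValuationRing.exists_irreducible O
  have hpow : ∀ n, maximalIdeal O ^ n = Ideal.span {t ^ n} := fun n => by
    rw [ht.maximalIdeal_eq, Ideal.span_singleton_pow]
  have key : ∀ {x : L} (hx : x ≠ 0), 0 ≤ ordZ O x → ∃ o, algebraMap O L o = x := by
    intro x hx h0
    obtain ⟨a, b, hb, rfl⟩ := IsFractionRing.div_surjective (A := O) x
    have hb0 : b ≠ 0 := nonZeroDivisors.ne_zero hb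
    have ha0 : a ≠ 0 := by rintro rfl; simp at hx
    obtain ⟨i, hi⟩ := IsDiscreteValuationRing.associated_pow_irreducible ha0 ht
    obtain ⟨j, hj⟩ := IsDiscreteValuationRing.associated_pow_irreducible hb0 ht
    have hbL : algebraMap O L b ≠ 0 := by simpa using hb0
    have haL : algebraMap O L a ≠ 0 := by simpa using ha0
    rw [div_eq_mul_inv, ordZ_mul haL (inv_ne_zero hbL), ordZ_inv hbL, ordZ_associated ht hi,
      ordZ_associated ht hj] at h0
    have hdvd : b ∣ a := hj.dvd.trans ((pow_dvd_pow t (by omega)).trans hi.symm.dvd)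
    obtain ⟨c, rfl⟩ := hdvd
    exact ⟨c, by rw [map_mul, mul_div_cancel_left₀ _ hbL]⟩
  have htL : algebraMap O L t ≠ 0 := by simpa using ht.ne_zero
  constructor
  · intro h
    have hne := mul_ne_zero hx (inv_ne_zero (pow_ne_zero n htL))
    obtain ⟨o, ho⟩ := key hne (by
      rw [ordZ_mul hx (inv_ne_zero (pow_ne_zero n htL)), ordZ_inv (pow_ne_zero n htL),
        ordZ_pow htL, ordZ_irreducible ht]
      omega)
    refine ⟨t ^ n * o, ?_, ?_⟩
    · rw [hpow]
      exact Ideal.mul_mem_right _ _ (Ideal.mem_span_singleton_self _)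
    · rw [map_mul, ho, map_pow]
      field_simp
  · rintro ⟨o, ho, rfl⟩
    rw [hpow, Ideal.mem_span_singleton] at ho
    have ho0 : o ≠ 0 := by rintro rfl; simp at hx
    obtain ⟨i, hi⟩ := IsDiscreteValuationRing.associated_pow_irreducible ho0 ht
    rw [ordZ_associated ht hi]
    have := (pow_dvd_pow_iff ht.ne_zero ht.not_isUnit).mp (ho.trans hi.dvd)
    exact_mod_cast this

theorem ordZ_nonneg_iff {x : L} (hx : x ≠ 0) :
    0 ≤ ordZ O x ↔ ∃ o, algebraMap O L o = x := by
  simpa using natCast_le_ordZ_iff (O := O) hx (n := 0)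

theorem ordZ_eq_zero_iff {x : L} (hx : x ≠ 0) :
    ordZ O x = 0 ↔ ∃ o, IsUnit o ∧ algebraMap O L o = x := by
  refine ⟨fun h => ?_, fun ⟨o, ho, h⟩ => h ▸ ordZ_unit ho⟩
  obtain ⟨o, rfl⟩ := (ordZ_nonneg_iff (O := O) hx).mp h.ge
  refine ⟨o, ?_, rfl⟩
  by_contra hu
  have := (natCast_le_ordZ_iff (O := O) hx (n := 1)).mpr
    ⟨o, by rwa [pow_one, mem_maximalIdeal], rfl⟩
  omega

theorem mem_maximalIdeal_pow_iff_ordZ {o : O} (ho : o ≠ 0) {n : ℕ} :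
    o ∈ maximalIdeal O ^ n ↔ (n : ℤ) ≤ ordZ O (algebraMap O L o) := by
  rw [natCast_le_ordZ_iff (by simpa using ho)]
  refine ⟨fun h => ⟨o, h, rfl⟩, ?_⟩
  rintro ⟨o', h, h'⟩
  rwa [← IsFractionRing.injective O L h']

end OrdZ

/-! ### Places above a discrete valuation ring -/

/-- The largest `n` such that the image of `𝔪_A` in `L` is contained in that of `𝔪_O ^ n`. -/
noncomputable def ramIdx (A O L : Type*) [CommRing A] [IsLocalRing A] [CommRing O] [IsLocalRing O]
    [CommRing L] [Algebra A L] [Algebra O L] : ℕ :=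
  sSup {n | ∀ a ∈ maximalIdeal A, ∃ o ∈ maximalIdeal O ^ n, algebraMap O L o = algebraMap A L a}

/-- `O` is, up to isomorphism, the family of all valuation rings of `L` dominating `A`. -/
structure IsPlaceFamily (A L : Type*) [CommRing A] [IsLocalRing A] [Field L] [Algebra A L]
    {ι : Type*} (O : ι → Type*) [∀ i, CommRing (O i)] [∀ i, IsLocalRing (O i)]
    [∀ i, Algebra (O i) L] : Prop where
  dominates : ∀ i, ∃ g : A →+* O i, IsLocalHom g ∧ ∀ a, algebraMap (O i) L (g a) = algebraMap A L a
  exhaustive : ∀ R : ValuationSubring L, (∀ a, algebraMap A L a ∈ R) →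
    (∀ a ∈ maximalIdeal A, a ≠ 0 → (algebraMap A L a)⁻¹ ∉ R) →
    ∃ i, ∀ x, x ∈ R ↔ x ∈ (algebraMap (O i) L).range
  injective : ∀ i j, (algebraMap (O i) L).range = (algebraMap (O j) L).range → i = j

/-- B / P is integral over the algebraically closed field A / 𝔪, hence equal to it. -/
theorem exists_sub_mem_of_isAlgClosed {A B : Type*} [CommRing A] [IsLocalRing A]
    [IsAlgClosed (ResidueField A)] [CommRing B] [Algebra A B] [Algebra.IsIntegral A B]
    (P : Ideal B) [P.IsPrime] (hP : P.comap (algebraMap A B) = maximalIdeal A) (b : B) :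
    ∃ a, b - algebraMap A B a ∈ P := by
  let φ : ResidueField A →+* B ⧸ P := Ideal.quotientMap P (algebraMap A B) hP.ge
  have hφ : ∀ a, φ (residue A a) = Ideal.Quotient.mk P (algebraMap A B a) := fun a => rfl
  have h1 : φ.IsIntegral := by
    refine RingHom.IsIntegral.tower_top (residue A) φ ?_
    change ((Ideal.Quotient.mk P).comp (algebraMap A B)).IsIntegral
    exact RingHom.IsIntegral.trans _ _ (algebraMap_isIntegral_iff.mpr inferInstance)
      (RingHom.IsIntegral.of_finite (RingHom.Finite.of_surjective _ Ideal.Quotient.mk_surjective))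
  obtain ⟨r, hr⟩ := (IsAlgClosed.ringHom_bijective_of_isIntegral φ h1).2 (Ideal.Quotient.mk _ b)
  obtain ⟨a, rfl⟩ := IsLocalRing.residue_surjective r
  exact ⟨a, by rw [← Ideal.Quotient.eq, ← hr, hφ]⟩

namespace IsPlaceFamily

open IsDedekindDomain

variable {A K L : Type*} [CommRing A] [IsDomain A] [IsDiscreteValuationRing A] [Field K]
  [Algebra A K] [IsFractionRing A K] [Field L] [Algebra K L] [Algebra A L] [IsScalarTower A K L]
  {ι : Type*} {O : ι → Type*} [∀ i, CommRing (O i)] [∀ i, IsDomain (O i)]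
  [∀ i, IsDiscreteValuationRing (O i)] [∀ i, Algebra (O i) L] [∀ i, IsFractionRing (O i) L]

omit [IsDomain A] [IsDiscreteValuationRing A] in
theorem exists_of_isIntegral [IsLocalRing A] (h : IsPlaceFamily A L O) (i : ι) {x : L}
    (hx : IsIntegral A x) :
    ∃ o, algebraMap (O i) L o = x := by
  obtain ⟨g, _, hg⟩ := h.dominates i
  let := g.toAlgebra
  have : IsScalarTower A (O i) L := .of_algebraMap_eq fun a => (hg a).symm
  exact IsIntegrallyClosed.isIntegral_iff.mp (hx.tower_top (A := O i))

/-- The embedding of the integral closure of `A` in a place. -/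
noncomputable def placeMap (h : IsPlaceFamily A L O) (i : ι) : integralClosure A L →+* O i where
  toFun b := (h.exists_of_isIntegral i b.2).choose
  map_one' := by
    apply IsFractionRing.injective (O i) L
    rw [(h.exists_of_isIntegral i (1 : integralClosure A L).2).choose_spec]; simp
  map_zero' := by
    apply IsFractionRing.injective (O i) L
    rw [(h.exists_of_isIntegral i (0 : integralClosure A L).2).choose_spec]; simp
  map_mul' x y := by
    apply IsFractionRing.injective (O i) L
    rw [map_mul, (h.exists_of_isIntegral i (x * y).2).choose_spec,
      (h.exists_of_isIntegral i x.2).choose_spec, (h.exists_of_isIntegral i y.2).choose_spec]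
    simp
  map_add' x y := by
    apply IsFractionRing.injective (O i) L
    rw [map_add, (h.exists_of_isIntegral i (x + y).2).choose_spec,
      (h.exists_of_isIntegral i x.2).choose_spec, (h.exists_of_isIntegral i y.2).choose_spec]
    simp

theorem algebraMap_placeMap (h : IsPlaceFamily A L O) (i : ι) (b : integralClosure A L) :
    algebraMap (O i) L (h.placeMap i b) = b :=
  (h.exists_of_isIntegral i b.2).choose_spec

theorem placeMap_injective (h : IsPlaceFamily A L O) (i : ι) :
    Function.Injective (h.placeMap i) := fun x y hxy => by
  have := congrArg (algebraMap (O i) L) hxy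
  rw [algebraMap_placeMap, algebraMap_placeMap] at this
  exact Subtype.ext this

/-- The centre of a place on the integral closure of `A`. -/
noncomputable def center (h : IsPlaceFamily A L O) (i : ι) : Ideal (integralClosure A L) :=
  (maximalIdeal (O i)).comap (h.placeMap i)

theorem mem_center (h : IsPlaceFamily A L O) {i : ι} {b : integralClosure A L} :
    b ∈ h.center i ↔ h.placeMap i b ∈ maximalIdeal (O i) := Iff.rfl

instance center_isPrime (h : IsPlaceFamily A L O) (i : ι) : (h.center i).IsPrime :=
  Ideal.comap_isPrime _ _

theorem placeMap_algebraMap_mem (h : IsPlaceFamily A L O) (i : ι) (a : A) :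
    h.placeMap i (algebraMap A _ a) ∈ maximalIdeal (O i) ↔ a ∈ maximalIdeal A := by
  obtain ⟨g, hloc, hg⟩ := h.dominates i
  have : h.placeMap i (algebraMap A _ a) = g a := by
    apply IsFractionRing.injective (O i) L
    rw [algebraMap_placeMap, hg]; rfl
  rw [this, mem_maximalIdeal, mem_maximalIdeal, mem_nonunits_iff, mem_nonunits_iff,
    isUnit_map_iff]

omit [IsDomain A] [IsDiscreteValuationRing A] in
include K in
theorem faithfulSMul_integralClosure : FaithfulSMul A (integralClosure A L) := by
  rw [faithfulSMul_iff_algebraMap_injective]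
  intro x y hxy
  have h1 : algebraMap A L x = algebraMap A L y := congrArg Subtype.val hxy
  rw [IsScalarTower.algebraMap_apply A K L, IsScalarTower.algebraMap_apply A K L] at h1
  exact IsFractionRing.injective A K ((algebraMap K L).injective h1)

include K in
theorem center_ne_bot (h : IsPlaceFamily A L O) (i : ι) : h.center i ≠ ⊥ := by
  obtain ⟨t, ht⟩ := IsDiscreteValuationRing.exists_irreducible A
  intro h0
  have h1 : algebraMap A (integralClosure A L) t ∈ h.center i := by
    rw [mem_center, placeMap_algebraMap_mem, ht.maximalIdeal_eq]
    exact Ideal.mem_span_singleton_self t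
  rw [h0, Ideal.mem_bot] at h1
  have := faithfulSMul_integralClosure (A := A) (K := K) (L := L)
  exact ht.ne_zero ((FaithfulSMul.algebraMap_eq_zero_iff A _).mp h1)

section Dedekind

variable [IsDedekindDomain (integralClosure A L)] [IsFractionRing (integralClosure A L) L]

-- O i is the localization of the integral closure at the centre. An element o of O i satisfies o d
-- = n or o n = d with d outside the centre, and in the second case n is outside the centre as well.
include K in
theorem exists_mul_eq (h : IsPlaceFamily A L O) (i : ι) (o : O i) :
    ∃ a s : integralClosure A L, s ∉ h.center i ∧ o * h.placeMap i s = h.placeMap i a := by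
  let v : HeightOneSpectrum (integralClosure A L) :=
    ⟨h.center i, inferInstance, h.center_ne_bot (K := K) i⟩
  obtain ⟨n, ⟨d, hd⟩, hnd⟩ := v.exists_primeCompl_mul_eq_or_mul_eq (algebraMap (O i) L o)
  have e : ∀ b, algebraMap (integralClosure A L) L b = algebraMap (O i) L (h.placeMap i b) :=
    fun b => (h.algebraMap_placeMap i b).symm
  simp only [e, ← map_mul] at hnd
  rcases hnd with hnd | hnd
  · exact ⟨n, d, hd, IsFractionRing.injective _ L hnd⟩
  · refine ⟨d, n, fun hn => hd ?_, IsFractionRing.injective _ L hnd⟩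
    rw [SetLike.mem_coe, mem_center, ← IsFractionRing.injective _ L hnd]
    exact Ideal.mul_mem_left _ _ hn

-- Denominators can be cleared by elements outside the centre, which do not affect membership in
-- powers of that prime.
include K in
theorem mem_center_pow_iff (h : IsPlaceFamily A L O) (i : ι) (n : ℕ) (b : integralClosure A L) :
    b ∈ h.center i ^ n ↔ h.placeMap i b ∈ maximalIdeal (O i) ^ n := by
  constructor
  · intro hb
    have h1 : h.center i ^ n ≤ (maximalIdeal (O i) ^ n).comap (h.placeMap i) :=
      Ideal.le_comap_pow _ n
    exact h1 hb
  · intro hb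
    obtain ⟨t, ht⟩ := IsDiscreteValuationRing.exists_irreducible (O i)
    rw [ht.maximalIdeal_eq, Ideal.span_singleton_pow, Ideal.mem_span_singleton] at hb
    obtain ⟨c, hc⟩ := hb
    obtain ⟨a, s, hs, has⟩ := h.exists_mul_eq (K := K) i t
    obtain ⟨a', s', hs', has'⟩ := h.exists_mul_eq (K := K) i c
    have ha : a ∈ h.center i := by
      rw [mem_center, ← has]
      refine Ideal.mul_mem_right _ _ ?_
      rw [ht.maximalIdeal_eq]
      exact Ideal.mem_span_singleton_self t
    have h1 : b * (s ^ n * s') = a ^ n * a' := by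
      apply h.placeMap_injective i
      simp only [map_mul, map_pow, hc, ← has, ← has']
      ring
    have h2 : b * (s ^ n * s') ∈ h.center i ^ n := by
      rw [h1]
      exact Ideal.mul_mem_right _ _ (Ideal.pow_mem_pow ha n)
    have h3 : s ^ n * s' ∉ h.center i := fun hm =>
      ((h.center_isPrime i).mem_or_mem hm).elim
        (fun hm => hs ((h.center_isPrime i).mem_of_pow_mem n hm)) hs'
    rw [← Ideal.dvd_span_singleton, ← Ideal.span_singleton_mul_span_singleton] at h2
    rw [← Ideal.dvd_span_singleton]
    exact (Ideal.prime_of_isPrime (h.center_ne_bot (K := K) i)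
      (h.center_isPrime i)).pow_dvd_of_dvd_mul_right n
        (fun hd => h3 (Ideal.dvd_span_singleton.mp hd)) h2

-- By `exists_mul_eq` a place is recovered from its centre as the localization there.
include K in
theorem center_injective (h : IsPlaceFamily A L O) : Function.Injective h.center := by
  have key : ∀ i j, h.center i = h.center j →
      (algebraMap (O i) L).range ≤ (algebraMap (O j) L).range := by
    rintro i j hij _ ⟨o, rfl⟩
    obtain ⟨a, s, hs, has⟩ := h.exists_mul_eq (K := K) i o
    rw [hij, mem_center, mem_maximalIdeal, mem_nonunits_iff, not_not] at hs
    obtain ⟨u, hu⟩ := hs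
    refine ⟨h.placeMap j a * ↑u⁻¹, ?_⟩
    have hs0 : (s : L) ≠ 0 := by
      rw [← h.algebraMap_placeMap j, ← hu]
      exact (u.isUnit.map _).ne_zero
    apply mul_right_cancel₀ hs0
    have h1 : algebraMap (O i) L o * s = a := by
      rw [← h.algebraMap_placeMap i, ← map_mul, has, algebraMap_placeMap]
    rw [h1]
    nth_rw 1 [← h.algebraMap_placeMap j s]
    rw [← map_mul, ← hu, mul_assoc, Units.inv_mul, mul_one, algebraMap_placeMap]
  intro i j hij
  exact h.injective i j (le_antisymm (key i j hij) (key j i hij.symm))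

-- The ring of the Q-adic valuation dominates A, so it is one of the places, and its nonunits cut
-- out Q.
include K in
theorem exists_center_eq (h : IsPlaceFamily A L O) (Q : Ideal (integralClosure A L))
    (hQ : Q.IsPrime) (hQ0 : Q ≠ ⊥) : ∃ i, h.center i = Q := by
  let v : HeightOneSpectrum (integralClosure A L) := ⟨Q, hQ, hQ0⟩
  have hmem : ∀ x : L, x ∈ (v.valuation L).valuationSubring ↔ v.valuation L x ≤ 1 := fun x => Iff.rfl
  have : Q.IsMaximal := hQ.isMaximal hQ0
  have : Algebra.IsIntegral A (integralClosure A L) := inferInstance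
  have h1 : Q.comap (algebraMap A (integralClosure A L)) = maximalIdeal A :=
    eq_maximalIdeal (Ideal.isMaximal_comap_of_isIntegral_of_isMaximal Q)
  obtain ⟨i, hi⟩ := h.exhaustive (v.valuation L).valuationSubring
    (fun a => v.valuation_le_one (algebraMap A (integralClosure A L) a))
    (fun a ha ha0 hR => by
      rw [← h1] at ha
      have h3 := (v.valuation_lt_one_iff_mem (K := L) (algebraMap A (integralClosure A L) a)).mpr ha
      have ha0' : algebraMap A (integralClosure A L) a ≠ 0 := by
        have := faithfulSMul_integralClosure (A := A) (K := K) (L := L)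
        rwa [Ne, FaithfulSMul.algebraMap_eq_zero_iff]
      rw [hmem, map_inv₀, inv_le_one₀ (by
        rw [Valuation.pos_iff]
        exact fun h => ha0' (Subtype.ext h))] at hR
      exact absurd h3 (not_lt.mpr hR))
  refine ⟨i, ?_⟩
  ext b
  obtain rfl | hb := eq_or_ne b 0
  · simp
  have hbL : (b : L) ≠ 0 := by simpa using hb
  have h2 : b ∈ Q ↔ v.valuation L (b : L) < 1 := (v.valuation_lt_one_iff_mem (K := L) b).symm
  rw [h2, ← not_le, ← inv_le_one₀ (by rwa [Valuation.pos_iff]), ← map_inv₀, ← hmem, hi,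
    ← not_iff_not, not_not, mem_center, mem_maximalIdeal, mem_nonunits_iff, not_not]
  constructor
  · rintro ⟨u, hu⟩
    refine ⟨↑u⁻¹, ?_⟩
    rw [← h.algebraMap_placeMap i, ← hu]
    exact eq_inv_of_mul_eq_one_left (by rw [← map_mul, Units.inv_mul, map_one])
  · rintro ⟨o, ho⟩
    refine IsUnit.of_mul_eq_one o (IsFractionRing.injective (O i) L ?_)
    rw [map_mul, ho, algebraMap_placeMap, mul_inv_cancel₀ hbL, map_one]

include K in
theorem finite (h : IsPlaceFamily A L O) : Finite ι := by
  have := faithfulSMul_integralClosure (A := A) (K := K) (L := L)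
  have h1 : ((maximalIdeal A).primesOver (integralClosure A L)).Finite :=
    IsDedekindDomain.primesOver_finite _ _
  refine Set.finite_univ_iff.mp (Set.Finite.of_finite_image (h1.subset ?_)
    (h.center_injective (K := K)).injOn)
  rintro _ ⟨i, -, rfl⟩
  refine ⟨inferInstance, ⟨?_⟩⟩
  ext a
  exact (h.placeMap_algebraMap_mem i a).symm

include K in
theorem exists_eq_prod [Fintype ι] (h : IsPlaceFamily A L O) (I : Ideal (integralClosure A L))
    (hI : I ≠ ⊥) : ∃ n : ι → ℕ, I = ∏ i, h.center i ^ n i := by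
  classical
  induction I using UniqueFactorizationMonoid.induction_on_prime with
  | h₁ => exact absurd rfl hI
  | h₂ I hu => exact ⟨0, by simp [Ideal.isUnit_iff.mp hu, ← Ideal.one_eq_top]⟩
  | h₃ I p hI0 hp ih =>
    obtain ⟨n, hn⟩ := ih hI0
    obtain ⟨i, rfl⟩ := h.exists_center_eq (K := K) p (Ideal.isPrime_of_prime hp) hp.ne_zero
    refine ⟨n + Pi.single i 1, ?_⟩
    simp_rw [Pi.add_apply, pow_add]
    rw [Finset.prod_mul_distrib, ← hn, mul_comm, Finset.prod_eq_single i]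
    · simp
    · intro j _ hj
      simp [hj]
    · simp

include K in
theorem le_center_pow_iff [Fintype ι] (h : IsPlaceFamily A L O) (n : ι → ℕ) (i : ι) (m : ℕ) :
    ∏ l, h.center l ^ n l ≤ h.center i ^ m ↔ m ≤ n i := by
  classical
  have hp : ∀ i, Prime (h.center i) := fun i =>
    Ideal.prime_of_isPrime (h.center_ne_bot (K := K) i) (h.center_isPrime i)
  rw [← Ideal.dvd_iff_le, ← Finset.mul_prod_erase _ _ (Finset.mem_univ i)]
  refine ⟨fun h1 => ?_, fun h1 => (pow_dvd_pow _ h1).mul_right _⟩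
  have h2 : ¬ h.center i ∣ ∏ l ∈ Finset.univ.erase i, h.center l ^ n l := by
    rw [(hp i).dvd_finsetProd_iff]
    rintro ⟨l, hl, hd⟩
    have h3 := Ideal.dvd_iff_le.mp ((hp i).dvd_of_dvd_pow hd)
    have : (h.center l).IsMaximal := (h.center_isPrime l).isMaximal (h.center_ne_bot (K := K) l)
    exact Finset.ne_of_mem_erase hl
      (h.center_injective (K := K) (this.eq_of_le (h.center_isPrime i).ne_top h3))
  exact (pow_dvd_pow_iff (hp i).ne_zero (hp i).not_isUnit).mp
    ((hp i).pow_dvd_of_dvd_mul_right m h2 h1)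

-- Factor 𝔪 B into centres: the exponent at i is the largest m with 𝔪 B contained in the m-th power
-- of the centre, and by `mem_center_pow_iff` this is `ramIdx`.
include K in
theorem isSplitFactorization [Fintype ι] [IsAlgClosed (ResidueField A)]
    (h : IsPlaceFamily A L O) :
    IsSplitFactorization A h.center fun i => ramIdx A (O i) L := by
  have hinj := faithfulSMul_integralClosure (A := A) (K := K) (L := L)
  obtain ⟨n, hn⟩ := h.exists_eq_prod (K := K)
    ((maximalIdeal A).map (algebraMap A (integralClosure A L))) (by
      rw [Ne, Ideal.map_eq_bot_iff_of_injective (FaithfulSMul.algebraMap_injective A _)]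
      exact IsDiscreteValuationRing.not_a_field A)
  have key : ∀ i m, (∀ a ∈ maximalIdeal A, ∃ o ∈ maximalIdeal (O i) ^ m,
      algebraMap (O i) L o = algebraMap A L a) ↔ m ≤ n i := by
    intro i m
    rw [← h.le_center_pow_iff (K := K), ← hn, Ideal.map_le_iff_le_comap]
    refine forall₂_congr fun a ha => ?_
    rw [Ideal.mem_comap, h.mem_center_pow_iff (K := K)]
    have h1 : algebraMap (O i) L (h.placeMap i (algebraMap A _ a)) = algebraMap A L a :=
      h.algebraMap_placeMap i _
    rw [← h1]
    exact ⟨fun ⟨o, ho, ho'⟩ => IsFractionRing.injective _ L ho' ▸ ho, fun ho => ⟨_, ho, rfl⟩⟩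
  have hram : ∀ i, ramIdx A (O i) L = n i := fun i => by
    rw [ramIdx]
    simp_rw [key]
    exact (isLUB_Iic (a := n i)).csSup_eq ⟨n i, Set.mem_Iic.mpr le_rfl⟩
  refine ⟨h.center_isPrime, h.center_ne_bot (K := K), h.center_injective (K := K), fun i => ?_, ?_,
    fun i b => ?_⟩
  · rw [hram, Nat.pos_iff_ne_zero, ← Nat.one_le_iff_ne_zero, ← key]
    intro a ha
    exact ⟨_, by rw [pow_one]; exact (h.placeMap_algebraMap_mem i a).mpr ha,
      h.algebraMap_placeMap i _⟩
  · simp_rw [hram]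
    exact hn
  · have : (h.center i).IsMaximal := (h.center_isPrime i).isMaximal (h.center_ne_bot (K := K) i)
    exact exists_sub_mem_of_isAlgClosed _ (by
      ext a
      exact h.placeMap_algebraMap_mem i a) b

include K in
/-- Membership in the integral closure is tested on places. -/
theorem mem_integralClosure_iff (h : IsPlaceFamily A L O) (x : L) :
    x ∈ integralClosure A L ↔ ∀ i, ∃ o, algebraMap (O i) L o = x := by
  refine ⟨fun hx i => h.exists_of_isIntegral i hx, fun hx => ?_⟩
  -- A Dedekind domain is the intersection of its valuation rings, and every height one prime is a
  -- centre.
  obtain ⟨b, hb⟩ := HeightOneSpectrum.mem_integers_of_valuation_le_one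
    (R := integralClosure A L) L x fun v => by
    obtain ⟨i, hi⟩ := h.exists_center_eq (K := K) v.asIdeal v.isPrime v.ne_bot
    obtain ⟨o, rfl⟩ := hx i
    obtain ⟨a, s, hs, has⟩ := h.exists_mul_eq (K := K) i o
    have h1 := congrArg (algebraMap (O i) L) has
    rw [map_mul, algebraMap_placeMap, algebraMap_placeMap] at h1
    have h2 : v.valuation L (s : L) = 1 := v.valuation_eq_one_iff_notMem.mpr (hi ▸ hs)
    have h3 := congrArg (v.valuation L) h1
    rw [map_mul, h2, mul_one] at h3
    rw [h3]
    exact v.valuation_le_one a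
  exact hb ▸ b.2

include K in
theorem natCast_le_ordZ_iff_mem_center_pow (h : IsPlaceFamily A L O) (i : ι) (n : ℕ)
    {b : integralClosure A L} (hb : b ≠ 0) : (n : ℤ) ≤ ordZ (O i) (b : L) ↔ b ∈ h.center i ^ n := by
  rw [h.mem_center_pow_iff (K := K), mem_maximalIdeal_pow_iff_ordZ (L := L), algebraMap_placeMap]
  rwa [Ne, map_eq_zero_iff _ (h.placeMap_injective i)]

include K in
theorem span_singleton_eq_prod [Fintype ι] (h : IsPlaceFamily A L O) {b : integralClosure A L}
    (hb : b ≠ 0) : ∃ n : ι → ℕ, Ideal.span {b} = ∏ i, h.center i ^ n i ∧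
      ∀ i, ordZ (O i) (b : L) = n i := by
  obtain ⟨n, hn⟩ := h.exists_eq_prod (K := K) (Ideal.span {b}) (by simpa using hb)
  refine ⟨n, hn, fun i => ?_⟩
  have h0 : (0 : ℤ) ≤ ordZ (O i) (b : L) := by
    rw [show (0 : ℤ) = (0 : ℕ) from rfl, h.natCast_le_ordZ_iff_mem_center_pow (K := K) i 0 hb]
    simp
  have h1 : ∀ m : ℕ, (m : ℤ) ≤ ordZ (O i) (b : L) ↔ m ≤ n i := fun m => by
    rw [h.natCast_le_ordZ_iff_mem_center_pow (K := K) i m hb, ← h.le_center_pow_iff (K := K), ← hn,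
      Ideal.span_singleton_le_iff_mem]
  refine le_antisymm ?_ ((h1 _).mpr le_rfl)
  have := (h1 (ordZ (O i) (b : L)).toNat).mp (by omega)
  omega

end Dedekind

section Separable

variable [FiniteDimensional K L] [Algebra.IsSeparable K L] [IsAlgClosed (ResidueField A)]

/-- For integral elements this is `norm_associated` applied to the factorization of the principal
ideal; both sides are additive, so it extends to fractions. -/
theorem sum_ordZ_eq_ordZ_norm [Fintype ι] (h : IsPlaceFamily A L O) {x : L} (hx : x ≠ 0) :
    ∑ i, ordZ (O i) x = ordZ A (Algebra.norm K x) := by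
  have : IsDedekindDomain (integralClosure A L) := integralClosure.isDedekindDomain A K L
  have : IsFractionRing (integralClosure A L) L :=
    integralClosure.isFractionRing_of_finite_extension K L
  have : Module.Finite A (integralClosure A L) := IsIntegralClosure.finite A K L _
  have := faithfulSMul_integralClosure (A := A) (K := K) (L := L)
  have : IsLocalization (Algebra.algebraMapSubmonoid (integralClosure A L) (nonZeroDivisors A)) L :=
    IsIntegralClosure.isLocalization A K L _
  have hs := h.isSplitFactorization (K := K)
  have hfree : Module.Free A (integralClosure A L) := by
    obtain ⟨b, hb⟩ := hs.exists_adaptedSystem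
    exact Module.Free.of_basis (hs.basis hb)
  obtain ⟨t, ht⟩ := IsDiscreteValuationRing.exists_irreducible A
  have key : ∀ b : integralClosure A L, b ≠ 0 →
      ∑ i, ordZ (O i) (b : L) = ordZ A (Algebra.norm K (b : L)) := by
    intro b hb
    obtain ⟨n, hn, hn'⟩ := h.span_singleton_eq_prod (K := K) hb
    have h1 := ordZ_associated (L := K) ht (hs.norm_associated ht b n hn)
    have h2 := Algebra.norm_localization (S := integralClosure A L) A (nonZeroDivisors A) (Rₘ := K)
      (Sₘ := L) b
    rw [← h2] at h1
    simp_rw [hn']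
    exact_mod_cast h1.symm
  obtain ⟨a, b, hb, rfl⟩ := IsFractionRing.div_surjective (A := integralClosure A L) x
  have hb0 : b ≠ 0 := nonZeroDivisors.ne_zero hb
  have ha0 : a ≠ 0 := by rintro rfl; simp at hx
  have hbL : (b : L) ≠ 0 := by simpa using hb0
  have haL : (a : L) ≠ 0 := by simpa using ha0
  change ∑ i, ordZ (O i) ((a : L) / b) = ordZ A (Algebra.norm K ((a : L) / b))
  have hN : ∀ {y : L}, y ≠ 0 → Algebra.norm K y ≠ 0 := fun hy => by
    rwa [Ne, Algebra.norm_eq_zero_iff]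
  simp_rw [div_eq_mul_inv, map_mul, Algebra.norm_inv]
  rw [ordZ_mul (hN haL) (inv_ne_zero (hN hbL)), ordZ_inv (hN hbL), ← key a ha0, ← key b hb0]
  simp_rw [ordZ_mul haL (inv_ne_zero hbL), ordZ_inv hbL]
  rw [Finset.sum_add_distrib, Finset.sum_neg_distrib]

theorem ordZ_discr [Fintype ι] (h : IsPlaceFamily A L O)
    (he : ∀ i, IsUnit (ramIdx A (O i) L : A)) {κ : Type*} [Fintype κ] [DecidableEq κ]
    (c : Module.Basis κ A (integralClosure A L)) :
    ordZ A (Algebra.discr K fun p => (c p : L)) = ∑ i, ((ramIdx A (O i) L - 1 : ℕ) : ℤ) := by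
  have : IsDedekindDomain (integralClosure A L) := integralClosure.isDedekindDomain A K L
  have : IsFractionRing (integralClosure A L) L :=
    integralClosure.isFractionRing_of_finite_extension K L
  have : Module.Finite A (integralClosure A L) := IsIntegralClosure.finite A K L _
  have := faithfulSMul_integralClosure (A := A) (K := K) (L := L)
  have : IsLocalization (Algebra.algebraMapSubmonoid (integralClosure A L) (nonZeroDivisors A)) L :=
    IsIntegralClosure.isLocalization A K L _
  have hs := h.isSplitFactorization (K := K)
  obtain ⟨t, ht⟩ := IsDiscreteValuationRing.exists_irreducible A
  have h1 := ordZ_associated (L := K) ht (hs.discr_associated he ht c)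
  rw [← Algebra.discr_localizationLocalization A (nonZeroDivisors A) L c] at h1
  rw [← Nat.cast_sum, ← h1]
  congr 2
  ext p
  simp

theorem finrank_eq_sum [Fintype ι] (h : IsPlaceFamily A L O) :
    Module.finrank K L = ∑ i, ramIdx A (O i) L := by
  have : IsDedekindDomain (integralClosure A L) := integralClosure.isDedekindDomain A K L
  have : IsFractionRing (integralClosure A L) L :=
    integralClosure.isFractionRing_of_finite_extension K L
  have : Module.Finite A (integralClosure A L) := IsIntegralClosure.finite A K L _
  have := faithfulSMul_integralClosure (A := A) (K := K) (L := L)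
  have : IsLocalization (Algebra.algebraMapSubmonoid (integralClosure A L) (nonZeroDivisors A)) L :=
    IsIntegralClosure.isLocalization A K L _
  have hs := h.isSplitFactorization (K := K)
  obtain ⟨b, hb⟩ := hs.exists_adaptedSystem
  rw [Module.finrank_eq_card_basis
    ((hs.basis hb).localizationLocalization K (nonZeroDivisors A) L)]
  simp

end Separable

end IsPlaceFamily

/-! ### Étale algebras over a polynomial ring -/

namespace Algebra.Etale

open Polynomial

section PrincipalIdealRing

variable (R : Type*) {S : Type*} [CommRing R] [IsDomain R] [IsPrincipalIdealRing R] [CommRing S]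
  [IsDomain S] [Algebra R S] [Algebra.Etale R S]

-- Étale maps are unramified, so the maximal ideal of the local ring is generated by the prime
-- below, which is principal. A Noetherian local domain that is not a field and has principal
-- maximal ideal is a discrete valuation ring.
include R in
theorem isDiscreteValuationRing_localization (q : Ideal S) [q.IsPrime] (hq : q ≠ ⊥)
    (T : Type*) [CommRing T] [Algebra S T] [IsLocalization.AtPrime T q] [IsDomain T] :
    IsDiscreteValuationRing T := by
  have : IsNoetherianRing S := Algebra.FiniteType.isNoetherianRing R S
  have : IsNoetherianRing (Localization.AtPrime q) :=
    IsLocalization.isNoetherianRing q.primeCompl _ inferInstance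
  let := Localization.AtPrime.algebraOfLiesOver (q.under R) q
  have hmap := ((isUnramifiedAt_iff_map_eq R (q.under R) q).mp (by
    have : FormallyUnramified S (Localization.AtPrime q) :=
      FormallyUnramified.of_isLocalization q.primeCompl
    exact FormallyUnramified.comp R S _)).2
  have h1 : (maximalIdeal (Localization.AtPrime q)).IsPrincipal := by
    rw [← hmap]
    infer_instance
  have h2 : IsDiscreteValuationRing (Localization.AtPrime q) := ((IsDiscreteValuationRing.TFAE (Localization.AtPrime q)
      (IsLocalization.AtPrime.not_isField S hq (Localization.AtPrime q))).out 4 0).mp h1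
  exact IsDiscreteValuationRing.RingEquivClass.isDiscreteValuationRing
    (IsLocalization.algEquiv q.primeCompl (Localization.AtPrime q) T)

-- In the discrete valuation ring at a maximal ideal m containing q, the only nonzero prime is the
-- maximal one, so q = m.
include R in
theorem isMaximal_of_ne_bot (q : Ideal S) [q.IsPrime] (hq : q ≠ ⊥) : q.IsMaximal := by
  obtain ⟨m, hm, hqm⟩ := Ideal.exists_le_maximal q (Ideal.IsPrime.ne_top ‹_›)
  have hm0 : m ≠ ⊥ := fun h => hq (le_bot_iff.mp (h ▸ hqm))
  have : IsDiscreteValuationRing (Localization.AtPrime m) :=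
    isDiscreteValuationRing_localization R m hm0 _
  have hd : Disjoint (m.primeCompl : Set S) q :=
    Set.disjoint_left.mpr fun x hx hxq => hx (hqm hxq)
  have hp := IsLocalization.isPrime_of_isPrime_disjoint m.primeCompl (Localization.AtPrime m) q
    inferInstance hd
  have hc := IsLocalization.under_map_of_isPrime_disjoint m.primeCompl (Localization.AtPrime m)
    (I := q) inferInstance hd
  have hne : q.map (algebraMap S (Localization.AtPrime m)) ≠ ⊥ := by
    rwa [Ne, Ideal.map_eq_bot_iff_of_injective
      (IsLocalization.injective _ m.primeCompl_le_nonZeroDivisors)]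
  have hmax := eq_maximalIdeal (hp.isMaximal hne)
  rw [← hc, hmax, IsLocalization.AtPrime.under_maximalIdeal (Localization.AtPrime m) m]
  exact hm

end PrincipalIdealRing

variable {k S : Type*} [Field k] [CommRing S] [IsDomain S] [Algebra k[X] S]
  [Algebra.Etale k[X] S]

-- A field of finite type over k is finite over k (Nullstellensatz), so X would be algebraic over k
-- although k[X] embeds in S.
variable (k S) in
include k in
theorem not_isField : ¬ IsField S := by
  intro hS
  let := hS.toField
  algebraize [(algebraMap k[X] S).comp C]
  have : IsScalarTower k k[X] S := .of_algebraMap_eq fun _ => rfl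
  have : Algebra.FiniteType k S := Algebra.FiniteType.trans (S := k[X]) inferInstance inferInstance
  have : Module.Finite k S := finite_of_finite_type_of_isJacobsonRing k S
  have h1 : IsIntegral k (algebraMap k[X] S X) := Algebra.IsIntegral.isIntegral _
  obtain ⟨p, hp, hp'⟩ := h1
  have h2 : algebraMap k[X] S (eval₂ (algebraMap k k[X]) X p) = 0 := by
    rw [hom_eval₂, ← hp']; rfl
  have h3 : eval₂ (algebraMap k k[X]) X p = p := eval₂_C_X
  rw [FaithfulSMul.algebraMap_eq_zero_iff, h3] at h2
  exact hp.ne_zero h2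

/-- An unramified extension of fields that is essentially of finite type is finite and separable. -/
theorem finite_isSeparable (R S F L : Type*) [CommRing R] [CommRing S] [IsDomain R] [IsDomain S]
    [Algebra R S] [Algebra.Etale R S] [Field F] [Field L] [Algebra R F] [IsFractionRing R F]
    [Algebra S L] [IsFractionRing S L] [Algebra F L] [Algebra R L] [IsScalarTower R F L]
    [IsScalarTower R S L] : FiniteDimensional F L ∧ Algebra.IsSeparable F L := by
  have : FormallyUnramified S L := FormallyUnramified.of_isLocalization (nonZeroDivisors S)
  have : FormallyUnramified R L := FormallyUnramified.comp R S L
  have : FormallyUnramified F L := FormallyUnramified.of_restrictScalars R F L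
  have : EssFiniteType S L := EssFiniteType.of_isLocalization L (nonZeroDivisors S)
  have : EssFiniteType R L := EssFiniteType.comp R S L
  have : EssFiniteType F L := EssFiniteType.of_comp R F L
  exact ⟨FormallyUnramified.finite_of_free F L, FormallyUnramified.isSeparable F L⟩

end Algebra.Etale

theorem RingHom.IsStandardSmoothOfRelativeDimension.exists_etale_polynomial {k S : Type*}
    [CommRing k] [CommRing S] {f : k →+* S} (hf : f.IsStandardSmoothOfRelativeDimension 1) :
    ∃ g : Polynomial k →+* S, g.comp Polynomial.C = f ∧ g.Etale := by
  obtain ⟨g, hg, hg'⟩ := hf.exists_etale_mvPolynomial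
  let e := (MvPolynomial.uniqueAlgEquiv k (Fin 1)).symm
  have h : (g.comp e.toRingEquiv.toRingHom).Etale := by
    have he : e.toRingEquiv.toRingHom.Etale := RingHom.Etale.of_bijective e.bijective
    algebraize [g, e.toRingEquiv.toRingHom, g.comp e.toRingEquiv.toRingHom]
    exact RingHom.etale_algebraMap.mpr
      (Algebra.Etale.comp (Polynomial k) (MvPolynomial (Fin 1) k) S)
  refine ⟨_, ?_, h⟩
  rw [← hg]
  ext a
  simp [e, MvPolynomial.uniqueAlgEquiv]

/-! ### Local structure of smooth curves -/

namespace SmoothProjectiveCurve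

variable {k : Type u} [Field k] (C : SmoothProjectiveCurve k)

/-- The structure map of the `k`-algebra of sections over an open set. -/
noncomputable def baseHom (U : C.X.Opens) : k →+* Γ(C.X, U) :=
  ((Scheme.ΓSpecIso (.of k)).inv ≫ C.str.appLE ⊤ U (by simp)).hom

/-- The structure map of the `k`-algebra `K(C)`. -/
noncomputable def constHom : k →+* C.X.functionField :=
  (C.X.presheaf.germ ⊤ (genericPoint C.X) trivial).hom.comp (C.baseHom ⊤)

theorem map_baseHom {U V : C.X.Opens} (h : U ≤ V) (a : k) :
    C.X.presheaf.map (homOfLE h).op (C.baseHom V a) = C.baseHom U a := by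
  have h1 := Scheme.Hom.appLE_map C.str (U := ⊤) (V := V) (by simp) (homOfLE h).op
  exact congr(((Scheme.ΓSpecIso (.of k)).inv ≫ $h1).hom a)

theorem germ_baseHom {U V : C.X.Opens} (x : C.X) (hU : x ∈ U) (hV : x ∈ V) (a : k) :
    C.X.presheaf.germ U x hU (C.baseHom U a) = C.X.presheaf.germ V x hV (C.baseHom V a) := by
  have key : ∀ (U : C.X.Opens) (hU : x ∈ U), C.X.presheaf.germ U x hU (C.baseHom U a) =
      C.X.presheaf.germ ⊤ x trivial (C.baseHom ⊤ a) := by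
    intro U hU
    rw [← C.X.presheaf.germ_res_apply (homOfLE (le_top : U ≤ ⊤)) x hU, map_baseHom]
  rw [key U, key V]

/-- A smooth curve is locally étale over the affine line; as Spec k is one point, the affine open
set below is everything. -/
theorem exists_chart (x : C.X) : ∃ (U : C.X.Opens) (_ : IsAffineOpen U) (_ : x ∈ U)
    (g : Polynomial k →+* Γ(C.X, U)), g.comp Polynomial.C = C.baseHom U ∧ g.Etale := by
  obtain ⟨V, hV, U, hU, hx, e, h⟩ :=
    SmoothOfRelativeDimension.exists_isStandardSmoothOfRelativeDimension (n := 1) (f := C.str) x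
  have hV' : V = ⊤ := by
    rw [eq_top_iff]
    rintro y -
    rw [Subsingleton.elim y (C.str x)]
    exact e hx
  subst hV'
  refine ⟨U, hU, hx, RingHom.IsStandardSmoothOfRelativeDimension.exists_etale_polynomial ?_⟩
  rw [baseHom, CommRingCat.hom_comp]
  exact RingHom.isStandardSmoothOfRelativeDimension_respectsIso.2 _
    (Scheme.ΓSpecIso (.of k)).symm.commRingCatIsoToRingEquiv h

instance : JacobsonSpace C.X := LocallyOfFiniteType.jacobsonSpace C.str

theorem primeIdealOf_eq_bot_iff {X : Scheme.{u}} [IsIntegral X] {U : X.Opens} (hU : IsAffineOpen U)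
    (x : U) : (hU.primeIdealOf x).asIdeal = ⊥ ↔ (x : X) = genericPoint X := by
  have : Nonempty U := ⟨x⟩
  have h1 : (hU.primeIdealOf ⟨genericPoint X,
      ((genericPoint_spec X).mem_open_set_iff U.isOpen).mpr ⟨x, trivial, x.2⟩⟩).asIdeal = ⊥ := by
    rw [hU.primeIdealOf_genericPoint, genericPoint_eq_bot_of_affine]
    rfl
  constructor
  · intro h
    have h2 : hU.primeIdealOf x = _ := PrimeSpectrum.ext (h.trans h1.symm)
    have h3 := congrArg hU.fromSpec h2
    rwa [hU.fromSpec_primeIdealOf, hU.fromSpec_primeIdealOf] at h3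
  · rintro h
    rw [← h1]
    congr 2
    exact Subtype.ext h

/-- In a Jacobson space a locally closed point is closed. -/
theorem isClosed_singleton_of_isMaximal {X : Scheme.{u}} [JacobsonSpace X] {U : X.Opens}
    (hU : IsAffineOpen U) (x : U) (hx : (hU.primeIdealOf x).asIdeal.IsMaximal) :
    IsClosed {(x : X)} := by
  apply isClosed_singleton_of_isLocallyClosed_singleton
  have h1 : IsClosed {hU.primeIdealOf x} := (PrimeSpectrum.isClosed_singleton_iff_isMaximal _).mpr hx
  have h2 := h1.isLocallyClosed.image hU.fromSpec.isOpenEmbedding.isInducing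
    hU.fromSpec.isOpenEmbedding.isOpen_range.isLocallyClosed
  have h3 : hU.fromSpec '' {hU.primeIdealOf x} = {(x : X)} :=
    Set.image_singleton.trans (congrArg _ (hU.fromSpec_primeIdealOf x))
  rwa [← h3]

theorem isDiscreteValuationRing_stalk_of_ne {x : C.X} (hx : x ≠ genericPoint C.X) :
    IsDiscreteValuationRing (C.X.presheaf.stalk x) := by
  obtain ⟨U, hU, hxU, g, -, hg⟩ := C.exists_chart x
  algebraize [g]
  have : Nonempty U := ⟨⟨x, hxU⟩⟩
  let := TopCat.Presheaf.algebra_section_stalk C.X.presheaf (⟨x, hxU⟩ : U)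
  have := hU.isLocalization_stalk ⟨x, hxU⟩
  exact Algebra.Etale.isDiscreteValuationRing_localization (Polynomial k)
    (hU.primeIdealOf ⟨x, hxU⟩).asIdeal
    (fun h => hx ((primeIdealOf_eq_bot_iff hU ⟨x, hxU⟩).mp h)) _

theorem isClosed_singleton_of_ne {x : C.X} (hx : x ≠ genericPoint C.X) : IsClosed {x} := by
  obtain ⟨U, hU, hxU, g, -, hg⟩ := C.exists_chart x
  algebraize [g]
  have : Nonempty U := ⟨⟨x, hxU⟩⟩
  exact isClosed_singleton_of_isMaximal hU ⟨x, hxU⟩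
    (Algebra.Etale.isMaximal_of_ne_bot (Polynomial k) _ fun h =>
      hx ((primeIdealOf_eq_bot_iff hU ⟨x, hxU⟩).mp h))

/-- Otherwise the curve is a single point and a chart is the spectrum of a field, against
`Algebra.Etale.not_isField`. -/
theorem not_isClosed_genericPoint : ¬ IsClosed {genericPoint C.X} := by
  intro h
  have hall : ∀ x : C.X, x = genericPoint C.X := by
    intro x
    have h1 := (genericPoint_spec C.X).specializes (Set.mem_univ x)
    exact h1.mem_closed h rfl
  obtain ⟨U, hU, hxU, g, -, hg⟩ := C.exists_chart (genericPoint C.X)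
  algebraize [g]
  have : Nonempty U := ⟨⟨_, hxU⟩⟩
  refine Algebra.Etale.not_isField k Γ(C.X, U) ?_
  by_contra hF
  obtain ⟨p, hp0, hp⟩ := Ring.not_isField_iff_exists_prime.mp hF
  have h1 := (hall (hU.fromSpec ⟨p, hp⟩)).trans (hall (hU.fromSpec ⟨⊥, Ideal.isPrime_bot⟩)).symm
  exact hp0 (congrArg PrimeSpectrum.asIdeal (hU.fromSpec.isOpenEmbedding.injective h1))

theorem mem_closedPoints_iff {x : C.X} : x ∈ closedPoints C.X ↔ x ≠ genericPoint C.X :=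
  ⟨fun h hx => C.not_isClosed_genericPoint (hx ▸ h), C.isClosed_singleton_of_ne⟩

theorem coheight_eq_one {x : C.X} (hx : x ≠ genericPoint C.X) : Order.coheight x = 1 := by
  have := C.isDiscreteValuationRing_stalk_of_ne hx
  have h := ringKrullDim_stalk_eq_coheight x
  rw [IsPrincipalIdealRing.ringKrullDim_eq_one _ (IsDiscreteValuationRing.not_isField _)] at h
  exact_mod_cast h.symm

theorem ord_eq_ordZ {x : C.X} (hx : x ≠ genericPoint C.X)
    [IsDiscreteValuationRing (C.X.presheaf.stalk x)] (g : C.X.functionField) :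
    Scheme.ord g x = ordZ (C.X.presheaf.stalk x) g := by
  rw [Scheme.ord_eq_ordHom_of_coheight_eq_one (C.coheight_eq_one hx)]
  rfl

/-- The function field of a curve is finite and separable over a rational function field. -/
theorem exists_ratFunc : ∃ _ : Algebra (RatFunc k) C.X.functionField,
    (∀ a, algebraMap (RatFunc k) C.X.functionField (RatFunc.C a) = C.constHom a) ∧
    FiniteDimensional (RatFunc k) C.X.functionField ∧
      Algebra.IsSeparable (RatFunc k) C.X.functionField := by
  obtain ⟨U, hU, hxU, g, hgC, hg⟩ := C.exists_chart (genericPoint C.X)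
  have : Nonempty U := ⟨⟨_, hxU⟩⟩
  have := functionField_isFractionRing_of_isAffineOpen C.X U hU
  algebraize [g, (algebraMap Γ(C.X, U) C.X.functionField).comp g]
  have : FaithfulSMul (Polynomial k) C.X.functionField := .trans _ Γ(C.X, U) _
  have hinj : Function.Injective (Algebra.ofId (Polynomial k) C.X.functionField) :=
    FaithfulSMul.algebraMap_injective (Polynomial k) C.X.functionField
  let φ : RatFunc k →ₐ[Polynomial k] C.X.functionField := IsFractionRing.liftAlgHom hinj
  let := φ.toRingHom.toAlgebra
  refine ⟨this, fun a => ?_, ?_⟩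
  · have h1 := φ.commutes (Polynomial.C a)
    refine h1.trans ?_
    change C.X.presheaf.germ U _ hxU ((g.comp Polynomial.C) a) = _
    rw [hgC]
    exact C.germ_baseHom _ _ _ _
  · have : IsScalarTower (Polynomial k) (RatFunc k) C.X.functionField :=
      .of_algebraMap_eq fun p => (φ.commutes p).symm
    exact Algebra.Etale.finite_isSeparable (Polynomial k) Γ(C.X, U) _ _

end SmoothProjectiveCurve

/-! ### Centres of valuation rings on a proper curve -/

namespace SmoothProjectiveCurve

variable {k : Type u} [Field k] (C : SmoothProjectiveCurve k)

instance isAlgClosed_residueField [IsAlgClosed k] (x : closedPoints C.X) :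
    IsAlgClosed (ResidueField (C.X.presheaf.stalk x.1)) :=
  IsAlgClosed.of_ringEquiv k (C.X.residueField x.1)
    (residueFieldIsoBase C.str x.1 x.2).symm.commRingCatIsoToRingEquiv

/-- The structure map of the `k`-algebra `𝒪_(C, x)`. -/
noncomputable def stalkHom (x : C.X) : k →+* C.X.presheaf.stalk x :=
  (C.X.presheaf.germ ⊤ x trivial).hom.comp (C.baseHom ⊤)

theorem baseHom_top :
    CommRingCat.ofHom (C.baseHom ⊤) = (Scheme.ΓSpecIso (.of k)).inv ≫ C.str.appTop := by
  rw [Scheme.Hom.appTop, Scheme.Hom.app_eq_appLE]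
  rfl

theorem str_eq : C.str = C.X.toSpecΓ ≫ Spec.map (CommRingCat.ofHom (C.baseHom ⊤)) := by
  have h1 := Scheme.toSpecΓ_naturality C.str
  rw [baseHom_top, Spec.map_comp, ← reassoc_of% h1, ← SpecMap_ΓSpecIso_hom, ← Spec.map_comp]
  simp

theorem fromSpecStalk_str (x : C.X) :
    C.X.fromSpecStalk x ≫ C.str = Spec.map (CommRingCat.ofHom (C.stalkHom x)) := by
  conv_lhs => rw [C.str_eq]
  rw [← Category.assoc, Scheme.fromSpecStalk_toSpecΓ, ← Spec.map_comp]
  rfl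

theorem algebraMap_stalkHom (x : C.X) (a : k) :
    algebraMap (C.X.presheaf.stalk x) C.X.functionField (C.stalkHom x a) = C.constHom a := by
  have : Nonempty (⊤ : C.X.Opens) := ⟨⟨x, trivial⟩⟩
  exact Scheme.algebraMap_germ_eq_germToFunctionField (X := C.X) (U := ⊤) trivial (C.baseHom ⊤ a)

/-- Existence in the valuative criterion for the proper map `C.str`: the generic point extends to
Spec R, and the centre is the image of the closed point. -/
theorem exists_center (R : ValuationSubring C.X.functionField) (hR : ∀ a, C.constHom a ∈ R) :
    ∃ (x : C.X) (g : C.X.presheaf.stalk x →+* R), IsLocalHom g ∧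
      ∀ o, (g o : C.X.functionField) = algebraMap (C.X.presheaf.stalk x) C.X.functionField o := by
  let S : ValuativeCommSq C.str :=
    { R := R
      K := C.X.functionField
      i₁ := C.X.fromSpecStalk (genericPoint C.X)
      i₂ := Spec.map (CommRingCat.ofHom (C.constHom.codRestrict R hR))
      commSq := ⟨by
        rw [fromSpecStalk_str, ← Spec.map_comp]
        rfl⟩ }
  have hex : ValuativeCriterion.Existence C.str := by
    have : UniversallyClosed C.str := inferInstance
    rw [UniversallyClosed.eq_valuativeCriterion] at this
    exact this.1
  obtain ⟨⟨l, hl, -⟩⟩ := (hex S).exists_lift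
  let g := Scheme.stalkClosedPointTo (R := CommRingCat.of R) l
  refine ⟨l (closedPoint R), g.hom, inferInstance, fun o => ?_⟩
  have h1 := Scheme.Spec_stalkClosedPointTo_fromSpecStalk (R := CommRingCat.of R) l
  have h2 := Scheme.SpecMap_stalkSpecializes_fromSpecStalk
    ((genericPoint_spec C.X).specializes (Set.mem_univ (l (closedPoint R))))
  have h3 : Spec.map (CommRingCat.ofHom (algebraMap R C.X.functionField)) ≫ l =
    C.X.fromSpecStalk (genericPoint C.X) := hl
  rw [← h1, ← h2, ← Category.assoc, ← Spec.map_comp, cancel_mono] at h3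
  have h4 := Spec.map_injective h3
  exact congr($(h4).hom o)

/-- A local domain dominates at most one local ring of a curve. -/
theorem eq_of_isLocalHom {A M : Type u} [CommRing A] [IsDomain A] [IsLocalRing A] [Field M]
    [Algebra A M] [FaithfulSMul A M] (j : C.X.functionField →+* M) {x y : C.X}
    (e : C.X.presheaf.stalk x →+* A) (e' : C.X.presheaf.stalk y →+* A) [IsLocalHom e]
    [IsLocalHom e']
    (he : ∀ o, algebraMap A M (e o) = j (algebraMap _ _ o))
    (he' : ∀ o, algebraMap A M (e' o) = j (algebraMap _ _ o)) : x = y := by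
  have hinj := FaithfulSMul.algebraMap_injective A M
  let f := Spec.map (CommRingCat.ofHom e) ≫ C.X.fromSpecStalk x
  let g := Spec.map (CommRingCat.ofHom e') ≫ C.X.fromSpecStalk y
  let ι := Spec.map (CommRingCat.ofHom (algebraMap A M))
  have hι : IsDominant ι := ⟨by
    rw [DenseRange]
    exact (PrimeSpectrum.denseRange_comap_iff_ker_le_nilRadical (algebraMap A M)).mpr (by
      rw [(RingHom.injective_iff_ker_eq_bot _).mp hinj]
      exact bot_le)⟩
  have h1 : f ≫ C.str = g ≫ C.str := by
    simp only [f, g, Category.assoc, fromSpecStalk_str, ← Spec.map_comp, ← CommRingCat.ofHom_comp]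
    congr 2
    ext a
    apply hinj
    simp [he, he', algebraMap_stalkHom]
  have h2 : ∀ {x : C.X} (e : C.X.presheaf.stalk x →+* A)
      (he : ∀ o, algebraMap A M (e o) = j (algebraMap _ _ o)),
      ι ≫ Spec.map (CommRingCat.ofHom e) ≫ C.X.fromSpecStalk x =
        Spec.map (CommRingCat.ofHom j) ≫ C.X.fromSpecStalk (genericPoint C.X) := by
    intro x e he
    rw [← Scheme.SpecMap_stalkSpecializes_fromSpecStalk
      ((genericPoint_spec C.X).specializes (Set.mem_univ x)), ← Category.assoc, ← Category.assoc,
      ← Spec.map_comp, ← Spec.map_comp]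
    congr 2
    ext o
    exact he o
  -- The two morphisms agree on the dense image of Spec M, and the curve is separated over k.
  have h3 : f = g := ext_of_isDominant_of_isSeparated C.str h1 ι
    ((h2 e he).trans (h2 e' he').symm)
  have h4 : ∀ {x : C.X} (e : C.X.presheaf.stalk x →+* A) [IsLocalHom e],
      (Spec.map (CommRingCat.ofHom e) ≫ C.X.fromSpecStalk x) (closedPoint A) = x := by
    intro x e _
    have : Spec.map (CommRingCat.ofHom e) (closedPoint A) = closedPoint _ :=
      IsLocalRing.comap_closedPoint e
    exact (congrArg (C.X.fromSpecStalk x) this).trans Scheme.fromSpecStalk_closedPoint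
  rw [← h4 e, ← h4 e']
  exact congr($h3 (closedPoint A))

/-- Equal images in the function field give an isomorphism of the local rings, so one local ring
dominates both. -/
theorem eq_of_range_eq {x y : C.X}
    (h : (algebraMap (C.X.presheaf.stalk x) C.X.functionField).range =
      (algebraMap (C.X.presheaf.stalk y) C.X.functionField).range) : x = y := by
  have hinj : ∀ x, Function.Injective (algebraMap (C.X.presheaf.stalk x) C.X.functionField) :=
    fun x => IsFractionRing.injective _ _
  have hmem : ∀ o, algebraMap (C.X.presheaf.stalk x) C.X.functionField o ∈
    (algebraMap (C.X.presheaf.stalk y) C.X.functionField).range := fun o => h ▸ ⟨o, rfl⟩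
  let e : C.X.presheaf.stalk x ≃+* C.X.presheaf.stalk y :=
    (RingEquiv.ofLeftInverse (Function.leftInverse_invFun (hinj x))).trans
      ((RingEquiv.subringCongr h).trans
        (RingEquiv.ofLeftInverse (Function.leftInverse_invFun (hinj y))).symm)
  have he : ∀ o, algebraMap (C.X.presheaf.stalk y) C.X.functionField (e o) =
      algebraMap (C.X.presheaf.stalk x) C.X.functionField o := fun o => by
    have := (RingEquiv.ofLeftInverse (Function.leftInverse_invFun (hinj y))).apply_symm_apply
      (RingEquiv.subringCongr h
        (RingEquiv.ofLeftInverse (Function.leftInverse_invFun (hinj x)) o))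
    exact congrArg Subtype.val this
  have : IsLocalHom e.toRingHom := ⟨fun a ha => (isLocalHom_equiv e).map_nonunit a ha⟩
  exact C.eq_of_isLocalHom (A := C.X.presheaf.stalk y) (M := C.X.functionField) (.id _) e.toRingHom
    (.id _) he fun o => rfl

end SmoothProjectiveCurve

/-! ### Finiteness, separability and domination for fields -/

/-- A finitely generated extension of fields of transcendence degree one over `k` is finite. -/
theorem finiteDimensional_of_ratFunc {k K L : Type u} [Field k] [Field K] [Field L]
    [Algebra (RatFunc k) K] [Algebra (RatFunc k) L] [Algebra K L] [FiniteDimensional (RatFunc k) K]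
    [FiniteDimensional (RatFunc k) L]
    (h : ∀ a : k, algebraMap K L (algebraMap (RatFunc k) K (RatFunc.C a)) =
      algebraMap (RatFunc k) L (RatFunc.C a)) : FiniteDimensional K L := by
  have hF : Algebra.trdeg k (RatFunc k) = 1 := by
    have : Algebra.IsAlgebraic (Polynomial k) (RatFunc k) :=
      IsLocalization.isAlgebraic (RatFunc k) (nonZeroDivisors (Polynomial k))
    rw [← trdeg_add_eq k (Polynomial k) (A := RatFunc k), Polynomial.trdeg_of_isDomain,
      trdeg_eq_zero, add_zero]
  have hft : Algebra.EssFiniteType k (RatFunc k) := by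
    have : Algebra.EssFiniteType (Polynomial k) (RatFunc k) :=
      .of_isLocalization _ (nonZeroDivisors (Polynomial k))
    exact .comp k (Polynomial k) (RatFunc k)
  let := ((algebraMap (RatFunc k) K).comp (algebraMap k (RatFunc k))).toAlgebra
  let := ((algebraMap (RatFunc k) L).comp (algebraMap k (RatFunc k))).toAlgebra
  have : IsScalarTower k (RatFunc k) K := .of_algebraMap_eq fun _ => rfl
  have : IsScalarTower k (RatFunc k) L := .of_algebraMap_eq fun _ => rfl
  have : IsScalarTower k K L := .of_algebraMap_eq fun a => (h a).symm
  have hK : Algebra.trdeg k K = 1 := by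
    rw [← trdeg_add_eq k (RatFunc k) (A := K), hF, trdeg_eq_zero, add_zero]
  have hL : Algebra.trdeg k L = 1 := by
    rw [← trdeg_add_eq k (RatFunc k) (A := L), hF, trdeg_eq_zero, add_zero]
  -- Both fields have transcendence degree one over k, so that of L over K is zero.
  have h1 := trdeg_add_eq k K (A := L)
  rw [hK, hL] at h1
  have h2 : Algebra.trdeg K L = 0 :=
    Cardinal.eq_of_add_eq_add_left (h1.trans (add_zero 1).symm) Cardinal.one_lt_aleph0
  have : Algebra.IsAlgebraic K L := trdeg_eq_zero_iff.mp h2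
  have : Algebra.EssFiniteType k L := .comp k (RatFunc k) L
  have : Algebra.EssFiniteType K L := .of_comp k K L
  exact Algebra.finite_of_essFiniteType_of_isAlgebraic

/-- An inseparable minimal polynomial is a polynomial in X ^ p, so its degree would be at least p,
but it is at most [L : K]. -/
theorem isSeparable_of_finrank_lt_ringChar {K L : Type*} [Field K] [Field L] [Algebra K L]
    [FiniteDimensional K L] (h : ringChar K ≠ 0 → Module.finrank K L < ringChar K) :
    Algebra.IsSeparable K L := by
  refine ⟨fun x => ?_⟩
  have hx : IsIntegral K x := Algebra.IsIntegral.isIntegral x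
  have hirr := minpoly.irreducible hx
  by_cases hp : ringChar K = 0
  · have : CharZero K := (CharP.ringChar_zero_iff_CharZero K).mp hp
    exact hirr.separable
  · have : CharP K (ringChar K) := inferInstance
    rcases Polynomial.separable_or (ringChar K) hirr with h1 | ⟨h1, g, hg, hg'⟩
    · exact h1
    · exfalso
      have h2 := congrArg Polynomial.natDegree hg'
      rw [Polynomial.natDegree_expand] at h2
      have h3 := minpoly.natDegree_le (A := K) x
      have h4 := hg.natDegree_pos
      have := h hp
      nlinarith

/-- Valuation rings are maximal for domination. -/
theorem mem_valuationSubring_iff_of_isLocalHom {O L : Type*} [CommRing O] [IsDomain O]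
    [ValuationRing O] [Field L] [Algebra O L] [IsFractionRing O L] {R : ValuationSubring L}
    (g : O →+* R) [IsLocalHom g] (hg : ∀ o, (g o : L) = algebraMap O L o) (r : L) :
    r ∈ R ↔ r ∈ (algebraMap O L).range := by
  refine ⟨fun hr => ?_, ?_⟩
  · rcases ValuationRing.isInteger_or_isInteger O r with h | ⟨o, ho⟩
    · exact h
    · obtain rfl | hr0 := eq_or_ne r 0
      · exact zero_mem _
      have ho' : IsUnit o := by
        refine (isUnit_map_iff g o).mp (.of_mul_eq_one ⟨r, hr⟩ (Subtype.ext ?_))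
        change (g o : L) * r = 1
        rw [hg, ho, inv_mul_cancel₀ hr0]
      obtain ⟨u, rfl⟩ := ho'
      refine ⟨(u⁻¹ : _ˣ), ?_⟩
      rw [← inv_inv r, ← ho]
      exact eq_inv_of_mul_eq_one_left (by rw [← map_mul, Units.inv_mul, map_one])
  · rintro ⟨o, rfl⟩
    rw [← hg]
    exact (g o).2

/-! ### The extension of function fields -/

section FunField

variable {X Y : Scheme.{u}} [IsIntegral X] [IsIntegral Y] (f : X ⟶ Y)

/-- The function field of `X`, as an extension of the function field and of the local rings of `Y`,
for a dominant morphism `f : X ⟶ Y`. -/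
def FunField {X Y : Scheme.{u}} [IsIntegral X] (_f : X ⟶ Y) : Type u := X.functionField

noncomputable instance : Field (FunField f) := inferInstanceAs (Field X.functionField)

noncomputable instance (x : X) : Algebra (X.presheaf.stalk x) (FunField f) :=
  inferInstanceAs (Algebra (X.presheaf.stalk x) X.functionField)

instance (x : X) : IsFractionRing (X.presheaf.stalk x) (FunField f) :=
  inferInstanceAs (IsFractionRing (X.presheaf.stalk x) X.functionField)

variable [IsDominant f]

theorem map_genericPoint : f (genericPoint X) = genericPoint Y := by
  refine ((genericPoint_spec X).image f.continuous).eq ?_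
  rw [Set.image_univ, f.denseRange.closure_range]
  exact genericPoint_spec Y

theorem map_genericPoint_specializes (y : Y) : f (genericPoint X) ⤳ y := by
  rw [map_genericPoint]
  exact (genericPoint_spec Y).specializes (Set.mem_univ y)

noncomputable instance FunField.algebraBase (y : Y) : Algebra (Y.presheaf.stalk y) (FunField f) :=
  (Y.presheaf.stalkSpecializes (map_genericPoint_specializes f y) ≫
    f.stalkMap (genericPoint X)).hom.toAlgebra

theorem FunField.algebraMap_base (y : Y) (o : Y.presheaf.stalk y) :
    algebraMap (Y.presheaf.stalk y) (FunField f) o = f.stalkMap (genericPoint X)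
      (Y.presheaf.stalkSpecializes (map_genericPoint_specializes f y) o) := rfl

instance (y : Y) : IsScalarTower (Y.presheaf.stalk y) Y.functionField (FunField f) := by
  refine .of_algebraMap_eq fun o => ?_
  rw [FunField.algebraMap_base, FunField.algebraMap_base]
  congr 1
  change _ = (Y.presheaf.stalkSpecializes ((genericPoint_spec Y).specializes trivial) ≫
    Y.presheaf.stalkSpecializes (map_genericPoint_specializes f (genericPoint Y))) o
  rw [TopCat.Presheaf.stalkSpecializes_comp]

theorem finrank_funField : Module.finrank Y.functionField (FunField f) = CurveBundle.mapDegree f := by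
  let := (f.stalkMap (genericPoint X)).hom.toAlgebra
  let e : Y.functionField ≃+* Y.presheaf.stalk (f (genericPoint X)) :=
    (Y.presheaf.stalkCongr (.of_eq (map_genericPoint f).symm)).commRingCatIsoToRingEquiv
  exact Algebra.finrank_eq_of_equiv_equiv e (RingEquiv.refl X.functionField) (by ext; rfl)

variable {f}

omit [IsIntegral X] [IsIntegral Y] [IsDominant f] in
/-- The local homomorphism `𝒪_(Y, y) → 𝒪_(X, x)`, for `f x = y`. -/
noncomputable def localMap {x : X} {y : Y} (h : f x = y) :
    Y.presheaf.stalk y →+* X.presheaf.stalk x :=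
  (Y.presheaf.stalkSpecializes (specializes_of_eq h) ≫ f.stalkMap x).hom

omit [IsIntegral X] [IsIntegral Y] [IsDominant f] in
theorem localMap_rfl (x : X) : localMap (f := f) (x := x) rfl = (f.stalkMap x).hom := by
  rw [localMap, TopCat.Presheaf.stalkSpecializes_refl, Category.id_comp]

instance {x : X} {y : Y} (h : f x = y) : IsLocalHom (localMap h) := by
  subst h
  rw [localMap_rfl]
  infer_instance

theorem algebraMap_localMap {x : X} {y : Y} (h : f x = y) (o : Y.presheaf.stalk y) :
    algebraMap (X.presheaf.stalk x) (FunField f) (localMap h o) =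
      algebraMap (Y.presheaf.stalk y) (FunField f) o := by
  subst h
  rw [localMap_rfl]
  exact (Scheme.Hom.stalkSpecializes_stalkMap_apply f _ _
    ((genericPoint_spec X).specializes trivial) o).symm

/-- `mult` tests membership inside 𝒪_(X,x), `ramIdx` inside the function field; the embedding of the
one in the other makes the tests agree. -/
theorem mult_eq_ramIdx {x : X} {y : Y} (h : f x = y) :
    CurveBundle.mult f x = ramIdx (Y.presheaf.stalk y) (X.presheaf.stalk x) (FunField f) := by
  subst h
  let := (f.stalkMap x).hom.toAlgebra
  rw [CurveBundle.mult, ramIdx, Ideal.ramificationIdx']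
  congr 1
  ext n
  rw [Set.mem_ofPred_eq, Set.mem_ofPred_eq, Ideal.map_le_iff_le_comap]
  refine forall₂_congr fun a ha => ?_
  rw [Ideal.mem_comap, ← algebraMap_localMap rfl, localMap_rfl]
  exact ⟨fun h => ⟨_, h, rfl⟩, fun ⟨o, ho, ho'⟩ =>
    IsFractionRing.injective (X.presheaf.stalk x) (FunField f) ho' ▸ ho⟩

end FunField

/-! ### The fibre of f as a family of places -/

namespace SmoothProjectiveCurve

variable {k : Type u} [Field k] {X Y : SmoothProjectiveCurve k} {f : X.X ⟶ Y.X} [IsDominant f]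

theorem algebraMap_constHom (hf : f ≫ Y.str = X.str) (a : k) :
    algebraMap Y.X.functionField (FunField f) (Y.constHom a) = X.constHom a := by
  have h1 : f.appTop (Y.baseHom ⊤ a) = X.baseHom ⊤ a := by
    have h2 := X.baseHom_top
    rw [← hf, Scheme.Hom.comp_appTop, ← Category.assoc, ← baseHom_top] at h2
    exact congr($(h2).hom a).symm
  have h3 : Y.X.presheaf.stalkSpecializes (map_genericPoint_specializes f (genericPoint Y.X))
      (Y.constHom a) = Y.X.presheaf.germ ⊤ (f (genericPoint X.X)) trivial (Y.baseHom ⊤ a) :=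
    TopCat.Presheaf.germ_stalkSpecializes_apply _ _ _ _
  rw [FunField.algebraMap_base, h3]
  refine (Scheme.Hom.germ_stalkMap_apply f ⊤ (genericPoint X.X) trivial (Y.baseHom ⊤ a)).trans ?_
  exact congrArg (X.X.presheaf.germ ⊤ (genericPoint X.X) trivial) h1

theorem eq_genericPoint_of_map {x : X.X} (hx : x = genericPoint X.X) : f x = genericPoint Y.X :=
  hx ▸ map_genericPoint f

omit [IsDominant f] in
theorem exists_center_funField (R : ValuationSubring (FunField f))
    (hR : ∀ a, (X.constHom a : FunField f) ∈ R) :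
    ∃ (x : X.X) (g : X.X.presheaf.stalk x →+* R), IsLocalHom g ∧
      ∀ o, (g o : FunField f) = algebraMap (X.X.presheaf.stalk x) (FunField f) o :=
  X.exists_center R hR

/-- A valuation ring R dominating 𝒪_(Y,y) contains the constants, so it has a centre x on X. It then
dominates both 𝒪_(Y,f x) and 𝒪_(Y,y), whence f x = y, and R is 𝒪_(X,x) because the latter is already
a valuation ring. -/
theorem isPlaceFamily (hf : f ≫ Y.str = X.str) {y : Y.X} (hy : y ≠ genericPoint Y.X) :
    IsPlaceFamily (Y.X.presheaf.stalk y) (FunField f)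
      fun x : {x : X.X // f x = y} => X.X.presheaf.stalk x.1 where
  dominates x := ⟨localMap x.2, inferInstance, algebraMap_localMap x.2⟩
  injective x x' h := Subtype.ext (X.eq_of_range_eq h)
  exhaustive R hR hR' := by
    have hk : ∀ a, (X.constHom a : FunField f) ∈ R := fun a => by
      rw [← algebraMap_constHom hf, ← Y.algebraMap_stalkHom y]
      have := hR (Y.stalkHom y a)
      rwa [IsScalarTower.algebraMap_apply _ Y.X.functionField] at this
    obtain ⟨x, g, hg, hgx⟩ := X.exists_center_funField R hk
    have hxy : f x = y := by
      let e : Y.X.presheaf.stalk y →+* R := (algebraMap _ (FunField f)).codRestrict R hR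
      have he : IsLocalHom e := ⟨fun a ha => by
        by_contra hna
        have ha0 : a ≠ 0 := by
          rintro rfl
          rw [map_zero] at ha
          exact not_isUnit_zero ha
        refine hR' a hna ha0 ?_
        obtain ⟨u, hu⟩ := ha
        have : (algebraMap _ (FunField f) a)⁻¹ = ((u⁻¹ : Rˣ) : R) := by
          have h1 : algebraMap _ (FunField f) a = ((u : R) : FunField f) :=
            congrArg Subtype.val hu.symm
          rw [h1]
          refine inv_eq_of_mul_eq_one_right ?_
          exact congrArg Subtype.val u.mul_inv
        rw [this]
        exact SetLike.coe_mem _⟩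
      have : IsLocalHom (g.comp (f.stalkMap x).hom) := RingHom.isLocalHom_comp _ _
      refine Y.eq_of_isLocalHom (A := R) (M := FunField f)
        (algebraMap Y.X.functionField (FunField f)) (g.comp (f.stalkMap x).hom) e ?_ ?_
      · intro o
        rw [← IsScalarTower.algebraMap_apply, ← algebraMap_localMap rfl, localMap_rfl]
        exact hgx _
      · intro o
        rw [← IsScalarTower.algebraMap_apply]
        rfl
    have hx : x ≠ genericPoint X.X := fun h => hy (hxy ▸ eq_genericPoint_of_map h)
    have := X.isDiscreteValuationRing_stalk_of_ne hx
    exact ⟨⟨x, hxy⟩, mem_valuationSubring_iff_of_isLocalHom g hgx⟩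

end SmoothProjectiveCurve

/-! ### Regular functions and the stalks of the direct image -/

section Gluing

variable {X : Scheme.{u}} [IsIntegral X]

theorem algebraMap_germ {U : X.Opens} {x : X} (hx : x ∈ U) (s : Γ(X, U)) :
    algebraMap (X.presheaf.stalk x) X.functionField (X.presheaf.germ U x hx s) =
      X.presheaf.germ U (genericPoint X)
        (((genericPoint_spec X).specializes trivial).mem_open U.isOpen hx) s :=
  congr($(TopCat.Presheaf.germ_stalkSpecializes X.presheaf hx
    ((genericPoint_spec X).specializes trivial)).hom s)

/-- A rational function that is regular at every point of an open set is regular on it. -/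
theorem exists_section_germ_eq (U : X.Opens) (hU : genericPoint X ∈ U) (g : X.functionField)
    (hg : ∀ x ∈ U, ∃ o : X.presheaf.stalk x, algebraMap _ X.functionField o = g) :
    ∃ s : Γ(X, U), X.presheaf.germ U (genericPoint X) hU s = g := by
  have h1 : ∀ x : U, ∃ (W : X.Opens) (_ : x.1 ∈ W) (_ : W ≤ U) (s : Γ(X, W)),
      ∀ h, X.presheaf.germ W (genericPoint X) h s = g := by
    rintro ⟨x, hx⟩
    obtain ⟨o, rfl⟩ := hg x hx
    obtain ⟨W, hxW, s, rfl⟩ := X.presheaf.exists_germ_eq o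
    refine ⟨W ⊓ U, ⟨hxW, hx⟩, inf_le_right, X.presheaf.map (homOfLE inf_le_left).op s, fun h => ?_⟩
    rw [TopCat.Presheaf.germ_res_apply]
    exact (algebraMap_germ hxW s).symm
  choose W hxW hWU s hs using h1
  have hη : ∀ {V : X.Opens} (x : V), genericPoint X ∈ V := fun {V} x =>
    ((genericPoint_spec X).specializes trivial).mem_open V.isOpen x.2
  -- Local representatives agree on overlaps because a section over an integral scheme is determined
  -- by its germ at the generic point.
  obtain ⟨t, ht, -⟩ := X.sheaf.existsUnique_gluing' W U (fun x => homOfLE (hWU x))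
    (fun x hx => TopologicalSpace.Opens.mem_iSup.mpr ⟨⟨x, hx⟩, hxW _⟩) s (fun i j => by
      have hi : genericPoint X ∈ W i := hη ⟨_, hxW i⟩
      have hj : genericPoint X ∈ W j := hη ⟨_, hxW j⟩
      refine germ_injective_of_isIntegral X (genericPoint X) (U := W i ⊓ W j) ⟨hi, hj⟩ ?_
      refine (TopCat.Presheaf.germ_res_apply _ _ _ _ _).trans ?_
      refine Eq.trans ?_ (TopCat.Presheaf.germ_res_apply _ _ _ _ _).symm
      exact (hs i hi).trans (hs j hj).symm)
  refine ⟨t, ?_⟩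
  have hi : genericPoint X ∈ W ⟨_, hU⟩ := hxW ⟨_, hU⟩
  rw [← hs ⟨_, hU⟩ hi, ← ht ⟨_, hU⟩]
  exact (TopCat.Presheaf.germ_res_apply _ _ _ _ _).symm

end Gluing

namespace CurveBundle

section Germ

variable {Y : Scheme.{u}} (M : Y.Modules)

theorem exists_germ_eq {y : Y} (t : Stalk M y) :
    ∃ (V : Y.Opens) (hy : y ∈ V) (s : Γ(M, V)), germ M y hy s = t :=
  TopCat.Presheaf.exists_germ_eq M.presheaf t

theorem germ_smul {V : Y.Opens} {y : Y} (hy : y ∈ V) (a : Γ(Y, V)) (s : Γ(M, V)) :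
    germ M y hy (a • s) = Y.presheaf.germ V y hy a • germ M y hy s :=
  PresheafOfModules.germ_smul M.val y V hy a s

theorem germ_res {V W : Y.Opens} (i : W ⟶ V) {y : Y} (hy : y ∈ W) (s : Γ(M, V)) :
    germ M y hy (M.presheaf.map i.op s) = germ M y (i.le hy) s :=
  TopCat.Presheaf.germ_res_apply M.presheaf i y hy s

theorem toGeneric_germ [IrreducibleSpace Y] {V : Y.Opens} {y : Y} (hy : y ∈ V) (s : Γ(M, V)) :
    toGeneric M y (germ M y hy s) = germ M (genericPoint Y)
      (((genericPoint_spec Y).specializes trivial).mem_open V.isOpen hy) s :=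
  TopCat.Presheaf.germ_stalkSpecializes_apply _ _ _ _

end Germ

section DirectImage

variable {X Y : Scheme.{u}} [IsIntegral X] [IsIntegral Y] (f : X ⟶ Y) [IsDominant f]

theorem genericPoint_mem_preimage {V : Y.Opens} {y : Y} (hy : y ∈ V) : genericPoint X ∈ f ⁻¹ᵁ V :=
  (map_genericPoint_specializes f y).mem_open V.isOpen hy

/-- The cocone defining the embedding of the stalk of `f_* 𝒪_X` into the function field. -/
noncomputable def stalkCocone (y : Y) : Limits.Cocone
    ((TopologicalSpace.OpenNhds.inclusion y).op ⋙ (directImage f).presheaf) where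
  pt := AddCommGrpCat.of (FunField f)
  ι :=
    { app := fun V => AddCommGrpCat.ofHom (X.presheaf.germ (f ⁻¹ᵁ V.unop.1) (genericPoint X)
        (genericPoint_mem_preimage f V.unop.2)).hom.toAddMonoidHom
      naturality := fun V W i => by
        ext s
        exact TopCat.Presheaf.germ_res_apply X.presheaf _ _ _ _ }

/-- The rational function on `X` given by an element of the stalk of `f_* 𝒪_X`. -/
noncomputable def stalkToFieldHom (y : Y) : Stalk (directImage f) y →+ FunField f :=
  AddCommGrpCat.Hom.hom (Limits.colimit.desc _ (stalkCocone f y))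

theorem stalkToFieldHom_germ {V : Y.Opens} {y : Y} (hy : y ∈ V) (s : Γ(X, f ⁻¹ᵁ V)) :
    stalkToFieldHom f y (germ (directImage f) y hy s) =
      X.presheaf.germ (f ⁻¹ᵁ V) (genericPoint X) (genericPoint_mem_preimage f hy) s :=
  congr($(Limits.colimit.ι_desc (stalkCocone f y) (Opposite.op ⟨V, hy⟩)).hom s)

/-- The embedding of the stalk of `f_* 𝒪_X` into the function field of `X`. -/
noncomputable def stalkToField (y : Y) : Stalk (directImage f) y →ₗ[Y.presheaf.stalk y] FunField f :=
  { stalkToFieldHom f y with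
    map_smul' := fun o t => by
      obtain ⟨V, hyV, a, rfl⟩ := Y.presheaf.exists_germ_eq o
      obtain ⟨W, hyW, s, rfl⟩ := exists_germ_eq _ t
      have hy : y ∈ V ⊓ W := ⟨hyV, hyW⟩
      rw [← germ_res _ (homOfLE inf_le_right : V ⊓ W ⟶ W) hy,
        ← TopCat.Presheaf.germ_res_apply Y.presheaf (homOfLE inf_le_left : V ⊓ W ⟶ V) y hy]
      generalize Y.presheaf.map (homOfLE inf_le_left : V ⊓ W ⟶ V).op a = a
      generalize (directImage f).presheaf.map (homOfLE inf_le_right : V ⊓ W ⟶ W).op s = s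
      rw [← germ_smul, RingHom.id_apply, Algebra.smul_def, FunField.algebraMap_base]
      refine (stalkToFieldHom_germ f hy _).trans ?_
      refine (map_mul (X.presheaf.germ _ _ (genericPoint_mem_preimage f hy)).hom (f.app _ a) s).trans ?_
      refine congr_arg₂ (· * ·) ?_ (stalkToFieldHom_germ f hy s).symm
      refine (Scheme.Hom.germ_stalkMap_apply f _ _ (genericPoint_mem_preimage f hy) a).symm.trans ?_
      exact congrArg (f.stalkMap (genericPoint X))
        (TopCat.Presheaf.germ_stalkSpecializes_apply _ _ _ _).symm }

theorem stalkToField_germ {V : Y.Opens} {y : Y} (hy : y ∈ V) (s : Γ(X, f ⁻¹ᵁ V)) :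
    stalkToField f y (germ (directImage f) y hy s) =
      X.presheaf.germ (f ⁻¹ᵁ V) (genericPoint X) (genericPoint_mem_preimage f hy) s :=
  stalkToFieldHom_germ f hy s

theorem stalkToField_germ_eq {V : Y.Opens} {y : Y} (hy : y ∈ V) (s : Γ(X, f ⁻¹ᵁ V)) {x : X}
    (hx : x ∈ f ⁻¹ᵁ V) : stalkToField f y (germ (directImage f) y hy s) =
      algebraMap (X.presheaf.stalk x) (FunField f) (X.presheaf.germ (f ⁻¹ᵁ V) x hx s) :=
  (stalkToField_germ f hy s).trans (algebraMap_germ hx s).symm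

theorem stalkToField_toGeneric {y : Y} (t : Stalk (directImage f) y) :
    stalkToField f (genericPoint Y) (toGeneric _ y t) = stalkToField f y t := by
  obtain ⟨V, hy, s, rfl⟩ := exists_germ_eq _ t
  rw [toGeneric_germ]
  exact (stalkToField_germ f _ s).trans (stalkToField_germ f _ s).symm

theorem stalkToField_injective (y : Y) : Function.Injective (stalkToField f y) := by
  rw [injective_iff_map_eq_zero]
  intro t ht
  obtain ⟨V, hy, s, rfl⟩ := exists_germ_eq _ t
  have hs : s = (0 : Γ(X, f ⁻¹ᵁ V)) := germ_injective_of_isIntegral X _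
    (genericPoint_mem_preimage f hy) (((stalkToField_germ f hy s).symm.trans ht).trans
      (map_zero (X.presheaf.germ _ _ (genericPoint_mem_preimage f hy)).hom).symm)
  rw [hs]
  exact map_zero (TopCat.Presheaf.germ (directImage f).presheaf V y hy).hom

-- The tube lemma for closed maps: remove from Y the image of the complement of U.
omit [IsIntegral X] [IsIntegral Y] [IsDominant f] in
theorem exists_preimage_le {f : X ⟶ Y} (hf : IsClosedMap f) {U : X.Opens} {y : Y}
    (h : ∀ x, f x = y → x ∈ U) : ∃ V : Y.Opens, y ∈ V ∧ f ⁻¹ᵁ V ≤ U := by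
  refine ⟨⟨(f '' (U : Set X)ᶜ)ᶜ, (hf _ U.isOpen.isClosed_compl).isOpen_compl⟩, ?_, fun x hx => ?_⟩
  · rintro ⟨x, hx, rfl⟩
    exact hx (h x rfl)
  · by_contra hxU
    exact hx ⟨x, hxU, rfl⟩

/-- The locus where g is regular is open and contains the fibre, so it contains f⁻¹ V for a
neighbourhood V of y, and g is a section there. -/
theorem mem_range_stalkToField_iff (hf : IsClosedMap f) {y : Y} {g : FunField f} :
    g ∈ LinearMap.range (stalkToField f y) ↔
      ∀ x, f x = y → ∃ o : X.presheaf.stalk x, algebraMap _ (FunField f) o = g := by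
  constructor
  · rintro ⟨t, rfl⟩ x hx
    obtain ⟨V, hy, s, rfl⟩ := exists_germ_eq _ t
    have hxV : x ∈ f ⁻¹ᵁ V := by
      rw [← hx] at hy
      exact hy
    exact ⟨_, (stalkToField_germ_eq f hy s hxV).symm⟩
  · intro h
    let U : X.Opens := ⟨{x | ∃ o : X.presheaf.stalk x, algebraMap _ (FunField f) o = g}, by
      rw [isOpen_iff_mem_nhds]
      rintro x ⟨o, ho⟩
      obtain ⟨W, hxW, s, rfl⟩ := X.presheaf.exists_germ_eq o
      refine Filter.mem_of_superset (W.isOpen.mem_nhds hxW) fun z hz => ?_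
      exact ⟨X.presheaf.germ W z hz s, (algebraMap_germ hz s).trans
        ((algebraMap_germ hxW s).symm.trans ho)⟩⟩
    obtain ⟨V, hy, hV⟩ := exists_preimage_le hf (U := U) h
    obtain ⟨s, hs⟩ := exists_section_germ_eq (f ⁻¹ᵁ V) (genericPoint_mem_preimage f hy) g
      fun x hx => hV hx
    exact ⟨germ (directImage f) y hy s, (stalkToField_germ f hy s).trans hs⟩

/-- As D vanishes off the fibre, the order conditions at other points are void, so any section
representing t may be used. -/
theorem mem_stalkImage_iff {y : Y} (D : X → ℕ) (hD : ∀ x, f x ≠ y → D x = 0)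
    (t : Stalk (directImage f) y) : t ∈ stalkImage f D y ↔ ∀ x, f x = y →
      ∃ o ∈ maximalIdeal (X.presheaf.stalk x) ^ D x, algebraMap _ (FunField f) o =
        stalkToField f y t := by
  constructor
  · intro ht x hx
    refine Submodule.span_induction (p := fun t _ => ∃ o ∈ maximalIdeal (X.presheaf.stalk x) ^ D x,
      algebraMap _ (FunField f) o = stalkToField f y t) ?_ ?_ ?_ ?_ ht
    · rintro t ⟨V, hy, s, hs, rfl⟩
      have hxV : x ∈ f ⁻¹ᵁ V := by
        rw [← hx] at hy
        exact hy
      exact ⟨_, Ideal.mem_comap.mp ((Submodule.mem_iInf _).mp hs ⟨x, hxV⟩),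
        (stalkToField_germ_eq f hy s hxV).symm⟩
    · exact ⟨0, zero_mem _, by rw [map_zero, map_zero]⟩
    · rintro a b - - ⟨o, ho, ho'⟩ ⟨p, hp, hp'⟩
      exact ⟨o + p, add_mem ho hp, by rw [map_add, map_add, ho', hp']⟩
    · rintro a b - ⟨o, ho, ho'⟩
      refine ⟨localMap hx a * o, Ideal.mul_mem_left _ _ ho, ?_⟩
      rw [map_mul, map_smul, Algebra.smul_def, algebraMap_localMap, ho']
  · intro h
    obtain ⟨V, hy, s, rfl⟩ := exists_germ_eq _ t
    refine Submodule.subset_span ⟨V, hy, s, ?_, rfl⟩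
    refine (Submodule.mem_iInf _).mpr fun ⟨x, hx⟩ => ?_
    by_cases hxy : f x = y
    · obtain ⟨o, ho, ho'⟩ := h x hxy
      have h1 := IsFractionRing.injective (X.presheaf.stalk x) (FunField f)
        (ho'.trans (stalkToField_germ_eq f hy s hx))
      rw [h1] at ho
      exact ho
    · rw [hD x hxy, pow_zero, Ideal.one_eq_top]
      exact Submodule.mem_top

end DirectImage

end CurveBundle

/-! ### Finiteness and separability of k(X) over k(Y) -/

namespace SmoothProjectiveCurve

variable {k : Type u} [Field k] {X Y : SmoothProjectiveCurve k} {f : X.X ⟶ Y.X} [IsDominant f]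

theorem ringChar_stalk (y : Y.X) : ringChar (Y.X.presheaf.stalk y) = ringChar k :=
  have := charP_of_injective_ringHom (Y.stalkHom y).injective (ringChar k)
  ringChar.eq (Y.X.presheaf.stalk y) (ringChar k)

theorem finiteDimensional_funField (hf : f ≫ Y.str = X.str) :
    FiniteDimensional Y.X.functionField (FunField f) := by
  obtain ⟨i, hi, hi', -⟩ := Y.exists_ratFunc
  obtain ⟨j, hj, hj', -⟩ := X.exists_ratFunc
  let : Algebra (RatFunc k) (FunField f) := j
  have : FiniteDimensional (RatFunc k) (FunField f) := hj'
  refine finiteDimensional_of_ratFunc (k := k) fun a => ?_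
  rw [hi, algebraMap_constHom hf]
  exact (hj a).symm

theorem isSeparable_funField (hf : f ≫ Y.str = X.str)
    (hchar : ringChar k ≠ 0 → CurveBundle.mapDegree f < ringChar k) :
    Algebra.IsSeparable Y.X.functionField (FunField f) := by
  have := finiteDimensional_funField hf
  refine isSeparable_of_finrank_lt_ringChar ?_
  have h : ringChar Y.X.functionField = ringChar k := ringChar_stalk _
  rwa [finrank_funField, h]

omit [IsDominant f] in
theorem isClosedMap (hf : f ≫ Y.str = X.str) : IsClosedMap f := by
  have : IsProper (f ≫ Y.str) := hf ▸ X.proper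
  have := IsProper.of_comp f Y.str
  exact f.isClosedMap

end SmoothProjectiveCurve

/-! ### Filtrations defined by a weighted basis -/

section WeightFlag

variable {K W ι : Type*} [Field K] [AddCommGroup W] [Module K W] (b : Module.Basis ι K W)
  (w : ι → ℚ) (S : Finset ℚ)

/-- The decreasing chain of the subspaces spanned by the basis vectors of weight at least `a`, for
`a` in a finite set `S` of weights, followed by zero. -/
noncomputable def weightFlag : Fin (S.card + 1) → Submodule K W :=
  Fin.lastCases ⊥ fun j => Submodule.span K (b '' {p | S.orderEmbOfFin rfl j ≤ w p})

theorem weightFlag_castSucc (j : Fin S.card) : weightFlag b w S j.castSucc =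
    Submodule.span K (b '' {p | S.orderEmbOfFin rfl j ≤ w p}) :=
  Fin.lastCases_castSucc ..

theorem weightFlag_last : weightFlag b w S (Fin.last _) = ⊥ :=
  Fin.lastCases_last ..

variable {w S} (hS : ∀ a, a ∈ S ↔ ∃ p, w p = a)

include hS

theorem exists_orderEmbOfFin_eq (p : ι) : ∃ j, S.orderEmbOfFin rfl j = w p := by
  have : w p ∈ Set.range (S.orderEmbOfFin rfl) := by
    rw [Finset.range_orderEmbOfFin]
    exact (hS _).mpr ⟨p, rfl⟩
  exact this

/-- Weights of basis vectors lie in S, so "at least the next weight" means "greater than the present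
one"; after the last weight nothing is left, in accordance with the final ⊥. -/
theorem weightFlag_succ (j : Fin S.card) : weightFlag b w S j.succ =
    Submodule.span K (b '' {p | S.orderEmbOfFin rfl j < w p}) := by
  rcases Fin.eq_castSucc_or_eq_last j.succ with ⟨l, hl⟩ | hl
  · rw [hl, weightFlag_castSucc]
    congr 2
    ext p
    obtain ⟨q, hq⟩ := exists_orderEmbOfFin_eq hS p
    have := congrArg Fin.val hl
    rw [Set.mem_ofPred_eq, Set.mem_ofPred_eq, ← hq, OrderEmbedding.le_iff_le,
      OrderEmbedding.lt_iff_lt, Fin.le_def, Fin.lt_def]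
    simp only [Fin.val_succ, Fin.val_castSucc] at this
    omega
  · rw [hl, weightFlag_last, eq_comm, Submodule.span_eq_bot]
    rintro _ ⟨p, hp, rfl⟩
    obtain ⟨q, hq⟩ := exists_orderEmbOfFin_eq hS p
    have := congrArg Fin.val hl
    rw [Set.mem_ofPred_eq, ← hq, OrderEmbedding.lt_iff_lt, Fin.lt_def] at hp
    simp only [Fin.val_succ, Fin.val_last] at this
    omega

theorem weightFlag_zero (h : S.Nonempty) : weightFlag b w S 0 = ⊤ := by
  have hpos : 0 < S.card := h.card_pos
  have h0 : (0 : Fin (S.card + 1)) = (⟨0, hpos⟩ : Fin S.card).castSucc := rfl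
  rw [h0, weightFlag_castSucc, eq_top_iff, ← b.span_eq, ← Set.image_univ]
  refine Submodule.span_mono (Set.image_mono fun p _ => ?_)
  obtain ⟨q, hq⟩ := exists_orderEmbOfFin_eq hS p
  rw [Set.mem_ofPred_eq, ← hq, OrderEmbedding.le_iff_le]
  exact Nat.zero_le _

theorem weightFlag_strictAnti : StrictAnti (weightFlag b w S) := by
  rw [Fin.strictAnti_iff_succ_lt]
  intro j
  rw [weightFlag_succ b hS, weightFlag_castSucc]
  obtain ⟨p, hp⟩ := (hS _).mp (S.orderEmbOfFin_mem rfl j)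
  have hsub : {p | S.orderEmbOfFin rfl j < w p} ⊆ {p | S.orderEmbOfFin rfl j ≤ w p} :=
    Set.ofPred_subset_ofPred.mpr fun p => le_of_lt
  refine (Submodule.span_mono (Set.image_mono hsub)).lt_of_ne fun h => ?_
  have h1 : b p ∈ Submodule.span K (b '' {p | S.orderEmbOfFin rfl j ≤ w p}) :=
    Submodule.subset_span ⟨p, hp.ge, rfl⟩
  rw [← h, b.mem_span_image, b.repr_self, Finsupp.support_single p one_ne_zero] at h1
  exact absurd hp (ne_of_gt (h1 (Finset.mem_singleton_self p)))

omit hS in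
theorem finrank_span_image_basis [Finite ι] (s : Set ι) :
    Module.finrank K (Submodule.span K (b '' s)) = s.ncard := by
  have : Fintype s := Fintype.ofFinite _
  rw [Set.image_eq_range,
    finrank_span_eq_card (b := fun x : s => b x) (b.linearIndependent.comp _ Subtype.val_injective),
    ← Nat.card_eq_fintype_card, Nat.card_coe_set_eq]

open Classical in
theorem quotientDim_weightFlag [Fintype ι] (j : Fin S.card) :
    CurveBundle.quotientDim (weightFlag b w S j.castSucc) (weightFlag b w S j.succ) =
      (Finset.univ.filter fun p => w p = S.orderEmbOfFin rfl j).card := by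
  have : Module.Finite K W := .of_basis b
  have hle := (weightFlag_strictAnti b hS).antitone (Fin.castSucc_le_succ j)
  have h1 := Submodule.finrank_quotient_add_finrank
    ((weightFlag b w S j.succ).submoduleOf (weightFlag b w S j.castSucc))
  rw [(Submodule.submoduleOfEquivOfLe hle).finrank_eq] at h1
  have h3 : Module.finrank K (weightFlag b w S j.castSucc) =
      {p | S.orderEmbOfFin rfl j ≤ w p}.ncard := by
    rw [weightFlag_castSucc, finrank_span_image_basis b]
  have h4 : Module.finrank K (weightFlag b w S j.succ) =
      {p | S.orderEmbOfFin rfl j < w p}.ncard := by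
    rw [weightFlag_succ b hS, finrank_span_image_basis b]
  rw [h3, h4] at h1
  have h2 : {p | S.orderEmbOfFin rfl j ≤ w p} = {p | S.orderEmbOfFin rfl j < w p} ∪
      (Finset.univ.filter fun p => w p = S.orderEmbOfFin rfl j : Finset ι) := by
    ext p
    simp [le_iff_lt_or_eq, eq_comm]
  rw [h2, Set.ncard_union_eq, Set.ncard_coe_finset, add_comm] at h1
  · exact Nat.add_left_cancel h1
  · rw [Set.disjoint_left]
    intro p hp hp'
    simp only [Finset.coe_filter, Finset.mem_univ, true_and, Set.mem_ofPred_eq] at hp hp'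
    exact hp.ne' hp'

/-- The dimension of each graded piece counts the basis vectors of that weight, so the sum only
regroups the weights of the basis. -/
theorem sum_weight_mul_quotientDim [Fintype ι] : ∑ j : Fin S.card, S.orderEmbOfFin rfl j *
    (CurveBundle.quotientDim (weightFlag b w S j.castSucc) (weightFlag b w S j.succ) : ℚ) =
      ∑ p, w p := by
  classical
  simp_rw [quotientDim_weightFlag b hS]
  have h1 : S = Finset.univ.map (S.orderEmbOfFin rfl).toEmbedding := by
    rw [Finset.map_orderEmbOfFin_univ]
  have h2 : ∑ p, w p = ∑ a ∈ S, ∑ p ∈ Finset.univ.filter (fun p => w p = a), w p :=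
    (Finset.sum_fiberwise_of_maps_to (fun p _ => (hS _).mpr ⟨p, rfl⟩) w).symm
  rw [h2]
  trans ∑ a ∈ S, a * ((Finset.univ.filter fun p => w p = a).card : ℚ)
  · conv_rhs => rw [h1, Finset.sum_map]
    rfl
  · refine Finset.sum_congr rfl fun a _ => ?_
    rw [Finset.sum_congr rfl fun p hp => (Finset.mem_filter.mp hp).2, Finset.sum_const,
      nsmul_eq_mul, mul_comm]

end WeightFlag

/-- The submodule 𝔪 M dies over the residue field. -/
theorem baseChange_span_sup_smul_top {A M : Type*} [CommRing A] [IsLocalRing A] [AddCommGroup M]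
    [Module A M] (s : Set M) :
    (Submodule.span A s ⊔ maximalIdeal A • (⊤ : Submodule A M)).baseChange (ResidueField A) =
      Submodule.span (ResidueField A) ((fun m => (1 : ResidueField A) ⊗ₜ[A] m) '' s) := by
  rw [Submodule.baseChange_eq_span]
  refine le_antisymm (Submodule.span_le.mpr ?_) (Submodule.span_mono ?_)
  · rintro _ ⟨m, hm, rfl⟩
    obtain ⟨a, ha, c, hc, rfl⟩ := Submodule.mem_sup.mp hm
    rw [map_add]
    refine add_mem ?_ ?_
    · clear hm
      induction ha using Submodule.span_induction with
      | mem m hm => exact Submodule.subset_span ⟨m, hm, rfl⟩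
      | zero => rw [map_zero]; exact zero_mem _
      | add x y _ _ hx hy =>
        rw [map_add]
        exact add_mem hx hy
      | smul r x _ hx =>
        rw [map_smul]
        exact Submodule.smul_of_tower_mem _ r hx
    · have h0 : TensorProduct.mk A (ResidueField A) M 1 c = 0 := by
        refine Submodule.smul_induction_on hc (fun r hr m _ => ?_) fun x y hx hy => ?_
        · rw [map_smul, TensorProduct.mk_apply, TensorProduct.smul_tmul', Algebra.smul_def, mul_one,
            ResidueField.algebraMap_eq, (residue_eq_zero_iff r).mpr hr, TensorProduct.zero_tmul]
        · rw [map_add, hx, hy, add_zero]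
      rw [h0]
      exact zero_mem _
  · rintro _ ⟨m, hm, rfl⟩
    exact ⟨m, Submodule.mem_sup_left (Submodule.subset_span hm), rfl⟩

theorem sum_fin_div (m : ℕ) : ∑ j : Fin m, (j : ℚ) / m = ((m - 1 : ℕ) : ℚ) / 2 := by
  rw [← Finset.sum_div, ← Nat.cast_sum, Fin.sum_univ_eq_sum_range fun j => j]
  obtain rfl | hm := m.eq_zero_or_pos
  · simp
  · have h2 : ((∑ i ∈ Finset.range m, i : ℕ) : ℚ) * 2 = m * ((m - 1 : ℕ) : ℚ) := by
      exact_mod_cast Finset.sum_range_id_mul_two m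
    have : (m : ℚ) ≠ 0 := by positivity
    field_simp
    linarith

/-! ### The parabolic structure in terms of the adapted basis -/

namespace SmoothProjectiveCurve

open CurveBundle

variable {k : Type u} [Field k] {X Y : SmoothProjectiveCurve k} {f : X.X ⟶ Y.X}

instance (y : closedPoints Y.X) : IsDiscreteValuationRing (Y.X.presheaf.stalk y.1) :=
  Y.isDiscreteValuationRing_stalk_of_ne (Y.mem_closedPoints_iff.mp y.2)

variable [IsDominant f]

theorem ne_genericPoint_of_map {y : Y.X} (hy : y ≠ genericPoint Y.X) (x : {x : X.X // f x = y}) :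
    x.1 ≠ genericPoint X.X :=
  fun h => hy (x.2.symm.trans (eq_genericPoint_of_map h))

instance (y : closedPoints Y.X) (x : {x : X.X // f x = y.1}) :
    IsDiscreteValuationRing (X.X.presheaf.stalk x.1) :=
  X.isDiscreteValuationRing_stalk_of_ne
    (ne_genericPoint_of_map (Y.mem_closedPoints_iff.mp y.2) x)

theorem isPlaceFamily_closedPoint (hf : f ≫ Y.str = X.str) (y : closedPoints Y.X) :
    IsPlaceFamily (Y.X.presheaf.stalk y.1) (FunField f)
      fun x : {x : X.X // f x = y.1} => X.X.presheaf.stalk x.1 :=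
  isPlaceFamily hf (Y.mem_closedPoints_iff.mp y.2)

variable [FiniteDimensional Y.X.functionField (FunField f)]
  [Algebra.IsSeparable Y.X.functionField (FunField f)]

instance (y : closedPoints Y.X) :
    IsDedekindDomain (integralClosure (Y.X.presheaf.stalk y.1) (FunField f)) :=
  integralClosure.isDedekindDomain _ Y.X.functionField _

omit [Algebra.IsSeparable Y.X.functionField (FunField f)] in
instance (y : closedPoints Y.X) :
    IsFractionRing (integralClosure (Y.X.presheaf.stalk y.1) (FunField f)) (FunField f) :=
  integralClosure.isFractionRing_of_finite_extension Y.X.functionField _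

instance (y : closedPoints Y.X) :
    Module.Finite (Y.X.presheaf.stalk y.1)
      (integralClosure (Y.X.presheaf.stalk y.1) (FunField f)) :=
  IsIntegralClosure.finite _ Y.X.functionField (FunField f) _

omit [FiniteDimensional Y.X.functionField (FunField f)]
  [Algebra.IsSeparable Y.X.functionField (FunField f)] in
instance (y : closedPoints Y.X) :
    FaithfulSMul (Y.X.presheaf.stalk y.1)
      (integralClosure (Y.X.presheaf.stalk y.1) (FunField f)) :=
  IsPlaceFamily.faithfulSMul_integralClosure (K := Y.X.functionField)

theorem finite_fiber (hf : f ≫ Y.str = X.str) (y : closedPoints Y.X) :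
    Finite {x : X.X // f x = y.1} :=
  (isPlaceFamily_closedPoint hf y).finite (K := Y.X.functionField)

/-- Both sides consist of the rational functions regular at every point of the fibre. -/
theorem range_stalkToField (hf : f ≫ Y.str = X.str) (y : closedPoints Y.X) :
    LinearMap.range (stalkToField f y.1) =
      Subalgebra.toSubmodule (integralClosure (Y.X.presheaf.stalk y.1) (FunField f)) := by
  ext g
  rw [mem_range_stalkToField_iff f (isClosedMap hf), Subalgebra.mem_toSubmodule,
    (isPlaceFamily_closedPoint hf y).mem_integralClosure_iff (K := Y.X.functionField)]
  exact ⟨fun h x => h x.1 x.2, fun h x hx => h ⟨x, hx⟩⟩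

/-- The stalk of `f_* 𝒪_X` at `y` is the integral closure of `𝒪_(Y, y)` in the function field. -/
noncomputable def stalkEquiv (hf : f ≫ Y.str = X.str) (y : closedPoints Y.X) :
    Stalk (directImage f) y.1 ≃ₗ[Y.X.presheaf.stalk y.1]
      integralClosure (Y.X.presheaf.stalk y.1) (FunField f) :=
  LinearEquiv.ofInjective _ (stalkToField_injective f y.1) ≪≫ₗ
    LinearEquiv.ofEq _ _ (range_stalkToField hf y)

theorem coe_stalkEquiv (hf : f ≫ Y.str = X.str) (y : closedPoints Y.X)
    (t : Stalk (directImage f) y.1) : (stalkEquiv hf y t : FunField f) = stalkToField f y.1 t :=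
  rfl

theorem mem_stalkImage_iff_center (hf : f ≫ Y.str = X.str) (y : closedPoints Y.X)
    (x : {x : X.X // f x = y.1}) (j : ℕ) (t : Stalk (directImage f) y.1) :
    t ∈ stalkImage f (fiberDivisor f y.1 x.1 j) y.1 ↔
      stalkEquiv hf y t ∈ (isPlaceFamily_closedPoint hf y).center x ^ j ∧ ∀ z, z ≠ x →
        stalkEquiv hf y t ∈ (isPlaceFamily_closedPoint hf y).center z ^ mult f z.1 := by
  have h1 (z : {x : X.X // f x = y.1}) (n : ℕ) :
      stalkEquiv hf y t ∈ (isPlaceFamily_closedPoint hf y).center z ^ n ↔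
        ∃ o ∈ maximalIdeal (X.X.presheaf.stalk z.1) ^ n, algebraMap _ (FunField f) o =
          stalkToField f y.1 t := by
    rw [(isPlaceFamily_closedPoint hf y).mem_center_pow_iff (K := Y.X.functionField),
      ← coe_stalkEquiv hf]
    have h2 := (isPlaceFamily_closedPoint hf y).algebraMap_placeMap z (stalkEquiv hf y t)
    exact ⟨fun h => ⟨_, h, h2⟩, fun ⟨o, ho, ho'⟩ =>
      IsFractionRing.injective (X.X.presheaf.stalk z.1) (FunField f) (ho'.trans h2.symm) ▸ ho⟩
  rw [mem_stalkImage_iff]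
  · simp_rw [h1]
    constructor
    · refine fun h => ⟨?_, fun z hz => ?_⟩
      · simpa only [fiberDivisor, if_pos] using h x.1 x.2
      · simpa only [fiberDivisor, if_neg (fun h => hz (Subtype.ext h) : z.1 ≠ x.1), if_pos z.2]
          using h z.1 z.2
    · rintro ⟨h, h'⟩ z hz
      by_cases hzx : z = x.1
      · subst hzx
        simpa only [fiberDivisor, if_pos] using h
      · simpa only [fiberDivisor, if_neg hzx, if_pos hz] using
          h' ⟨z, hz⟩ fun h => hzx (congrArg Subtype.val h)
  · intro z hz
    rw [fiberDivisor, if_neg (fun h : z = x.1 => hz (h.symm ▸ x.2)), if_neg hz]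

variable [IsAlgClosed k]

/-- A basis of the stalk of `f_* 𝒪_X` adapted to the parabolic structure. -/
theorem exists_basis_fiberSubspace (hf : f ≫ Y.str = X.str) (y : closedPoints Y.X) :
    ∃ b : Module.Basis (Σ x : {x : X.X // f x = y.1}, Fin (mult f x.1)) (Y.X.presheaf.stalk y.1)
        (Stalk (directImage f) y.1),
      ∀ (x : {x : X.X // f x = y.1}) (j : ℕ), j ≤ mult f x.1 → fiberSubspace f y.1 x.1 j =
        Submodule.span (Kappa Y.X y.1)
          (b.baseChange (Kappa Y.X y.1) '' {p | p.1 = x ∧ j ≤ p.2}) := by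
  have := finite_fiber hf y
  have : Fintype {x : X.X // f x = y.1} := Fintype.ofFinite _
  let h := isPlaceFamily_closedPoint hf y
  have hs : IsSplitFactorization (Y.X.presheaf.stalk y.1) h.center fun x => mult f x.1 := by
    have := h.isSplitFactorization (K := Y.X.functionField)
    simp_rw [← fun x : {x : X.X // f x = y.1} => mult_eq_ramIdx x.2] at this
    exact this
  obtain ⟨b, hb⟩ := hs.exists_adaptedSystem
  refine ⟨(hs.basis hb).map (stalkEquiv hf y).symm, fun x j hj => ?_⟩
  have h1 : stalkImage f (fiberDivisor f y.1 x.1 j) y.1 =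
      Submodule.span _ ((hs.basis hb).map (stalkEquiv hf y).symm '' {p | p.1 = x ∧ j ≤ p.2}) ⊔
        maximalIdeal (Y.X.presheaf.stalk y.1) • ⊤ := by
    ext t
    rw [mem_stalkImage_iff_center hf, hs.mem_iff_mem_span_sup hb x j hj]
    have h2 : Submodule.span _
        ((hs.basis hb).map (stalkEquiv hf y).symm '' {p | p.1 = x ∧ j ≤ p.2}) ⊔
        maximalIdeal (Y.X.presheaf.stalk y.1) • ⊤ =
        (Submodule.span _ (hs.basis hb '' {p | p.1 = x ∧ j ≤ p.2}) ⊔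
        maximalIdeal (Y.X.presheaf.stalk y.1) • ⊤).map (stalkEquiv hf y).symm.toLinearMap := by
      rw [Submodule.map_sup, Submodule.map_span, Submodule.map_smul'', Submodule.map_top,
        LinearEquiv.range, Set.image_image]
      rfl
    rw [h2]
    exact (Submodule.mem_map_equiv (e := (stalkEquiv hf y).symm) _).symm
  rw [fiberSubspace, h1, baseChange_span_sup_smul_top, Set.image_image]
  congr 2
  ext p
  exact (Module.Basis.baseChange_apply ..).symm

omit [FiniteDimensional Y.X.functionField (FunField f)]
  [Algebra.IsSeparable Y.X.functionField (FunField f)] [IsDominant f] [IsAlgClosed k] in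
theorem mem_weightSet_iff (y : Y.X) (a : ℚ) : a ∈ weightSet f y ↔
    ∃ p : Σ x : {x : X.X // f x = y}, Fin (mult f x.1), (p.2 : ℚ) / mult f p.1.1 = a :=
  ⟨fun ⟨x, j, hx, hj, h⟩ => ⟨⟨⟨x, hx⟩, ⟨j, hj⟩⟩, h.symm⟩, fun ⟨p, hp⟩ =>
    ⟨p.1.1, p.2, p.1.2, p.2.2, hp.symm⟩⟩

omit [IsAlgClosed k] in
theorem mem_weightFinset_iff (hf : f ≫ Y.str = X.str) (y : closedPoints Y.X) (a : ℚ) :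
    a ∈ weightFinset f y.1 ↔
      ∃ p : Σ x : {x : X.X // f x = y.1}, Fin (mult f x.1), (p.2 : ℚ) / mult f p.1.1 = a := by
  have := finite_fiber hf y
  have h1 : weightSet f y.1 = Set.range fun p : Σ x : {x : X.X // f x = y.1}, Fin (mult f x.1) =>
      (p.2 : ℚ) / mult f p.1.1 := by
    ext a
    exact mem_weightSet_iff y.1 a
  have h : (weightSet f y.1).Finite := h1 ▸ Set.finite_range _
  rw [weightFinset, dif_pos h, Set.Finite.mem_toFinset]
  exact mem_weightSet_iff y.1 a

/-- The parabolic filtration comes from a basis of the fibre with weights. -/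
theorem exists_basis_flag (hf : f ≫ Y.str = X.str) (y : closedPoints Y.X) :
    ∃ b : Module.Basis (Σ x : {x : X.X // f x = y.1}, Fin (mult f x.1)) (Kappa Y.X y.1)
        (Fiber (directImage f) y.1),
      (directImageParabolic f).flag y.1 =
        weightFlag b (fun p => (p.2 : ℚ) / mult f p.1.1) (weightFinset f y.1) := by
  obtain ⟨b, hb⟩ := exists_basis_fiberSubspace hf y
  refine ⟨b.baseChange _, ?_⟩
  -- If j / m_x ≥ a, the basis vectors spanning 𝐅(x, j) have weights j' / m_x ≥ a; conversely the
  -- basis vector with index (x, j) lies in 𝐅(x, j).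
  have h1 (a : ℚ) : weightSubspace f y.1 a = Submodule.span (Kappa Y.X y.1)
      (b.baseChange (Kappa Y.X y.1) '' {p | a ≤ (p.2 : ℚ) / mult f p.1.1}) := by
    refine le_antisymm ?_ (Submodule.span_le.mpr ?_)
    · refine iSup₂_le fun x hx => iSup₂_le fun j hj => iSup_le fun ha => ?_
      rw [hb ⟨x, hx⟩ j hj.le]
      refine Submodule.span_mono (Set.image_mono fun p hp => ?_)
      obtain ⟨p, l⟩ := p
      obtain ⟨rfl, h2⟩ := hp
      exact ha.trans (div_le_div_of_nonneg_right (by exact_mod_cast h2) (Nat.cast_nonneg _))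
    · rintro _ ⟨p, hp, rfl⟩
      have h2 : b.baseChange (Kappa Y.X y.1) p ∈ fiberSubspace f y.1 p.1.1 p.2 := by
        rw [hb p.1 p.2 p.2.2.le]
        exact Submodule.subset_span ⟨p, ⟨rfl, le_rfl⟩, rfl⟩
      exact Submodule.mem_iSup_of_mem p.1.1 (Submodule.mem_iSup_of_mem p.1.2
        (Submodule.mem_iSup_of_mem p.2.1 (Submodule.mem_iSup_of_mem p.2.2
          (Submodule.mem_iSup_of_mem hp h2))))
  exact congrArg (Fin.lastCases (motive := fun _ => Submodule (Kappa Y.X y.1) _) ⊥)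
    (funext fun j => h1 _)

/-- The weights of the basis vectors belonging to x are j / m_x for 0 ≤ j < m_x, with sum (m_x - 1)
/ 2. -/
theorem sum_weight_mul_multiplicity (hf : f ≫ Y.str = X.str) (y : closedPoints Y.X)
    [Fintype {x : X.X // f x = y.1}] :
    ∑ j, (directImageParabolic f).weight y.1 j * ((directImageParabolic f).multiplicity y.1 j : ℚ) =
      (∑ x : {x : X.X // f x = y.1}, ((mult f x.1 - 1 : ℕ) : ℚ)) / 2 := by
  obtain ⟨b, hb⟩ := exists_basis_flag hf y
  have h1 := sum_weight_mul_quotientDim b (mem_weightFinset_iff hf y)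
  rw [← hb] at h1
  refine h1.trans ?_
  rw [Fintype.sum_sigma, Finset.sum_div]
  refine Finset.sum_congr rfl fun x _ => ?_
  exact sum_fin_div _

end SmoothProjectiveCurve

/-! ### Orders on the projective line -/

section PlaceRing

open Polynomial

variable {k : Type u} [Field k]

/-- A uniformizer at a point of the projective line. -/
noncomputable def placeUniformizer : Option k → RatFunc k
  | none => RatFunc.X⁻¹
  | some a => RatFunc.X - RatFunc.C a

theorem transcendental_placeUniformizer (P : Option k) : Transcendental k (placeUniformizer P) := by
  intro h
  refine RatFunc.transcendental_X (K := k) ?_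
  cases P with
  | none => simpa [placeUniformizer] using h.inv
  | some a =>
    have := h.add (isAlgebraic_algebraMap (R := k) (A := RatFunc k) a)
    simpa [placeUniformizer, RatFunc.algebraMap_eq_C] using this

/-- The uniformizer is a Möbius transform of X, so it generates k(X) over k. -/
theorem exists_aeval_div_eq (P : Option k) (g : RatFunc k) :
    ∃ p q : k[X], aeval (placeUniformizer P) p / aeval (placeUniformizer P) q = g := by
  let ψ : RatFunc k →+* RatFunc k := IsFractionRing.lift (A := k[X])
    (g := (aeval (placeUniformizer P)).toRingHom)
    (transcendental_iff_injective.mp (transcendental_placeUniformizer P))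
  have hψ (p : k[X]) : ψ (algebraMap _ _ p) = aeval (placeUniformizer P) p :=
    IsFractionRing.lift_algebraMap _ p
  have hψC (a : k) : ψ (RatFunc.C a) = RatFunc.C a := by
    rw [← RatFunc.algebraMap_C, hψ, aeval_C]
    rfl
  have hψX : ψ RatFunc.X = placeUniformizer P := by
    rw [← RatFunc.algebraMap_X, hψ, aeval_X]
  have hX : RatFunc.X ∈ ψ.fieldRange := by
    cases P with
    | none => exact ⟨RatFunc.X⁻¹, by rw [map_inv₀, hψX, placeUniformizer, inv_inv]⟩
    | some a => exact ⟨RatFunc.X + RatFunc.C a, by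
        rw [map_add, hψX, hψC, placeUniformizer, sub_add_cancel]⟩
  have hpoly (p : k[X]) : algebraMap k[X] (RatFunc k) p ∈ ψ.fieldRange := by
    induction p using Polynomial.induction_on' with
    | add p q hp hq => rw [map_add]; exact add_mem hp hq
    | monomial n a =>
      rw [← C_mul_X_pow_eq_monomial, map_mul, map_pow, RatFunc.algebraMap_C, RatFunc.algebraMap_X]
      exact mul_mem ⟨_, hψC a⟩ (pow_mem hX n)
  obtain ⟨p, q, -, rfl⟩ := IsFractionRing.div_surjective (A := k[X]) g
  obtain ⟨g', hg'⟩ := div_mem (hpoly p) (hpoly q)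
  obtain ⟨p', q', -, rfl⟩ := IsFractionRing.div_surjective (A := k[X]) g'
  exact ⟨p', q', by rw [← hψ, ← hψ, ← map_div₀, hg']⟩

/-- The local ring of the projective line at a point, as an abstract ring: it is isomorphic to the
localization of `k[X]` at `X`, where `X` corresponds to the uniformizer `placeUniformizer P`. -/
def PlaceRing (_P : Option k) : Type u := Localization.AtPrime (Polynomial.idealX k).asIdeal

variable (P : Option k)

noncomputable instance : CommRing (PlaceRing P) :=
  inferInstanceAs (CommRing (Localization.AtPrime (Polynomial.idealX k).asIdeal))

noncomputable instance : Algebra k[X] (PlaceRing P) :=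
  inferInstanceAs (Algebra k[X] (Localization.AtPrime (Polynomial.idealX k).asIdeal))

instance : IsLocalization.AtPrime (PlaceRing P) (Polynomial.idealX k).asIdeal :=
  inferInstanceAs (IsLocalization.AtPrime (Localization.AtPrime (Polynomial.idealX k).asIdeal)
    (Polynomial.idealX k).asIdeal)

instance : IsDomain (PlaceRing P) :=
  inferInstanceAs (IsDomain (Localization.AtPrime (Polynomial.idealX k).asIdeal))

instance : IsDiscreteValuationRing (PlaceRing P) :=
  IsLocalization.AtPrime.isDiscreteValuationRing_of_dedekind_domain k[X]
    (Polynomial.idealX k).ne_bot _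

theorem mem_primeCompl_idealX (p : k[X]) :
    p ∈ (Polynomial.idealX k).asIdeal.primeCompl ↔ p.coeff 0 ≠ 0 := by
  rw [Ideal.mem_primeCompl_iff, idealX_span, Ideal.mem_span_singleton, X_dvd_iff]

theorem aeval_placeUniformizer_ne_zero {p : k[X]} (hp : p ≠ 0) :
    aeval (placeUniformizer P) p ≠ 0 := fun h =>
  hp (transcendental_iff.mp (transcendental_placeUniformizer P) p h)

noncomputable instance : Algebra (PlaceRing P) (RatFunc k) :=
  (IsLocalization.lift (M := (Polynomial.idealX k).asIdeal.primeCompl)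
    (g := (aeval (placeUniformizer P) : k[X] →ₐ[k] RatFunc k).toRingHom) fun q =>
      (aeval_placeUniformizer_ne_zero P (nonZeroDivisors.ne_zero
        (Ideal.primeCompl_le_nonZeroDivisors _ q.2))).isUnit).toAlgebra

theorem algebraMap_placeRing (p : k[X]) :
    algebraMap (PlaceRing P) (RatFunc k) (algebraMap k[X] _ p) = aeval (placeUniformizer P) p :=
  IsLocalization.lift_eq _ p

instance : IsFractionRing (PlaceRing P) (RatFunc k) := by
  have hinj : Function.Injective (algebraMap (PlaceRing P) (RatFunc k)) := by
    refine (IsLocalization.lift_injective_iff _).mpr fun p q => ?_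
    change _ ↔ aeval (placeUniformizer P) p = aeval (placeUniformizer P) q
    rw [(transcendental_iff_injective.mp (transcendental_placeUniformizer P)).eq_iff,
      (IsLocalization.injective (PlaceRing P)
        (Ideal.primeCompl_le_nonZeroDivisors (Polynomial.idealX k).asIdeal)).eq_iff]
  have : FaithfulSMul (PlaceRing P) (RatFunc k) := (faithfulSMul_iff_algebraMap_injective _ _).mpr hinj
  refine IsFractionRing.of_field _ _ fun g => ?_
  obtain ⟨p, q, rfl⟩ := exists_aeval_div_eq P g
  exact ⟨algebraMap _ _ p, algebraMap _ _ q, by rw [algebraMap_placeRing, algebraMap_placeRing]⟩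

theorem maximalIdeal_placeRing :
    maximalIdeal (PlaceRing P) = Ideal.span {algebraMap k[X] (PlaceRing P) X} := by
  rw [← IsLocalization.AtPrime.map_eq_maximalIdeal (Polynomial.idealX k).asIdeal (PlaceRing P),
    idealX_span, Ideal.map_span, Set.image_singleton]

theorem isUnit_placeRing {p : k[X]} (hp : p.coeff 0 ≠ 0) : IsUnit (algebraMap k[X] (PlaceRing P) p) :=
  IsLocalization.map_units (PlaceRing P)
    (⟨p, (mem_primeCompl_idealX p).mpr hp⟩ : (Polynomial.idealX k).asIdeal.primeCompl)

theorem ordZ_aeval {p : k[X]} (hp : p.coeff 0 ≠ 0) :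
    ordZ (PlaceRing P) (aeval (placeUniformizer P) p) = 0 := by
  rw [← algebraMap_placeRing, ordZ_unit (isUnit_placeRing P hp)]

theorem ordZ_placeUniformizer : ordZ (PlaceRing P) (placeUniformizer P) = 1 := by
  rw [← aeval_X (R := k) (placeUniformizer P), ← algebraMap_placeRing]
  exact ordZ_irreducible ((IsDiscreteValuationRing.irreducible_iff_uniformizer _).mpr
    (maximalIdeal_placeRing P))

instance [IsAlgClosed k] : IsAlgClosed (ResidueField (PlaceRing P)) := by
  let φ : k →+* ResidueField (PlaceRing P) :=
    ((residue _).comp (algebraMap k[X] (PlaceRing P))).comp C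
  have hX : residue _ (algebraMap k[X] (PlaceRing P) X) = 0 := by
    rw [residue_eq_zero_iff, maximalIdeal_placeRing]
    exact Ideal.mem_span_singleton_self _
  have hφ (p : k[X]) : residue _ (algebraMap k[X] (PlaceRing P) p) = φ (p.coeff 0) := by
    conv_lhs => rw [← p.divX_mul_X_add]
    rw [map_add, map_add, map_mul, map_mul, hX, mul_zero, zero_add]
    rfl
  have hsurj : Function.Surjective φ := fun r => by
    obtain ⟨r, rfl⟩ := residue_surjective r
    obtain ⟨p, q, rfl⟩ := IsLocalization.exists_mk'_eq
      (Polynomial.idealX k).asIdeal.primeCompl r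
    have hq := (mem_primeCompl_idealX q.1).mp q.2
    refine ⟨p.coeff 0 / q.1.coeff 0, ?_⟩
    rw [map_div₀, div_eq_iff (by simpa using hq), ← hφ, ← hφ, ← map_mul, IsLocalization.mk'_spec]
  exact IsAlgClosed.of_ringEquiv k _ (RingEquiv.ofBijective φ ⟨φ.injective, hsurj⟩)

theorem ordZ_C {a : k} (ha : a ≠ 0) : ordZ (PlaceRing P) (RatFunc.C a) = 0 := by
  have h := ordZ_aeval P (p := C a) (by simpa using ha)
  rwa [aeval_C] at h

/-- At a ≠ b the function is u + (a - b) with u = X - a, a unit; at infinity it is u⁻¹ (1 - b u)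
with u = X⁻¹. -/
theorem ordZ_X_sub_C [DecidableEq k] (b : k) : ordZ (PlaceRing P) (RatFunc.X - RatFunc.C b) =
    if P = some b then 1 else if P = none then -1 else 0 := by
  cases P with
  | some a =>
    by_cases hab : a = b
    · subst hab
      rw [if_pos rfl]
      exact ordZ_placeUniformizer _
    · rw [if_neg (by simpa using hab), if_neg (by simp)]
      have h : (RatFunc.X - RatFunc.C b : RatFunc k) =
          aeval (placeUniformizer (some a)) (X + C (a - b)) := by
        rw [map_add, aeval_X, aeval_C, placeUniformizer, map_sub]
        simp only [RatFunc.algebraMap_eq_C]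
        ring
      rw [h]
      exact ordZ_aeval _ (by simpa [sub_eq_zero] using hab)
  | none =>
    rw [if_neg (by simp), if_pos rfl]
    have h : (RatFunc.X - RatFunc.C b : RatFunc k) =
        (placeUniformizer none)⁻¹ * aeval (placeUniformizer none) (1 - C b * X) := by
      rw [map_sub, map_one, map_mul, aeval_X, aeval_C, placeUniformizer, inv_inv]
      have : (RatFunc.X : RatFunc k) ≠ 0 := RatFunc.X_ne_zero
      simp only [RatFunc.algebraMap_eq_C]
      field_simp
    have h1 : (1 - C b * X : k[X]).coeff 0 ≠ 0 := by simp
    have h2 : placeUniformizer (none : Option k) ≠ 0 := inv_ne_zero (RatFunc.X_ne_zero (K := k))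
    rw [h, ordZ_mul (inv_ne_zero h2) (aeval_placeUniformizer_ne_zero _ fun h => by simp [h] at h1),
      ordZ_inv h2, ordZ_placeUniformizer, ordZ_aeval _ h1]
    rfl

/-- The divisor of a nonzero rational function on the projective line has degree zero. -/
theorem finsum_ordZ_ratFunc [IsAlgClosed k] {g : RatFunc k} (hg : g ≠ 0) :
    (Function.support fun P : Option k => ordZ (PlaceRing P) g).Finite ∧ ∑ᶠ P : Option k, ordZ (PlaceRing P) g = 0 := by
  classical
  have hmul {g h : RatFunc k} (hg0 : g ≠ 0) (hh0 : h ≠ 0)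
      (hg : (Function.support fun P : Option k => ordZ (PlaceRing P) g).Finite ∧
        ∑ᶠ P : Option k, ordZ (PlaceRing P) g = 0)
      (hh : (Function.support fun P : Option k => ordZ (PlaceRing P) h).Finite ∧
        ∑ᶠ P : Option k, ordZ (PlaceRing P) h = 0) :
      (Function.support fun P : Option k => ordZ (PlaceRing P) (g * h)).Finite ∧
        ∑ᶠ P : Option k, ordZ (PlaceRing P) (g * h) = 0 := by
    simp_rw [ordZ_mul hg0 hh0]
    refine ⟨(hg.1.union hh.1).subset (Function.support_add _ _), ?_⟩
    rw [finsum_add_distrib hg.1 hh.1, hg.2, hh.2, add_zero]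
  have hinv {g : RatFunc k} (hg0 : g ≠ 0)
      (hg : (Function.support fun P : Option k => ordZ (PlaceRing P) g).Finite ∧
        ∑ᶠ P : Option k, ordZ (PlaceRing P) g = 0) :
      (Function.support fun P : Option k => ordZ (PlaceRing P) g⁻¹).Finite ∧
        ∑ᶠ P : Option k, ordZ (PlaceRing P) g⁻¹ = 0 := by
    simp_rw [ordZ_inv hg0]
    refine ⟨hg.1.subset fun P hP => neg_ne_zero.mp hP, ?_⟩
    rw [finsum_neg_distrib, hg.2, neg_zero]
  have hC {a : k} (ha : a ≠ 0) : (Function.support fun P : Option k => ordZ (PlaceRing P)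
      (RatFunc.C a)).Finite ∧ ∑ᶠ P : Option k, ordZ (PlaceRing P) (RatFunc.C a) = 0 := by
    simp [ordZ_C _ ha]
  have hX (b : k) : (Function.support fun P : Option k => ordZ (PlaceRing P)
      (RatFunc.X - RatFunc.C b)).Finite ∧
        ∑ᶠ P : Option k, ordZ (PlaceRing P) (RatFunc.X - RatFunc.C b) = 0 := by
    simp_rw [ordZ_X_sub_C]
    have hsub : (Function.support fun P : Option k =>
        if P = some b then (1 : ℤ) else if P = none then -1 else 0) ⊆
          ({some b, none} : Finset (Option k)) := by
      intro P hP
      by_contra h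
      simp only [Finset.coe_insert, Finset.coe_singleton, Set.mem_insert_iff,
        Set.mem_singleton_iff, not_or] at h
      exact hP (by simp [h.1, h.2])
    exact ⟨(Finset.finite_toSet _).subset hsub, by
      rw [finsum_eq_sum_of_support_subset _ hsub]; simp⟩
  have hpoly {p : k[X]} (hp : p ≠ 0) :
      (Function.support fun P : Option k => ordZ (PlaceRing P) (algebraMap k[X] (RatFunc k) p)).Finite ∧
        ∑ᶠ P : Option k, ordZ (PlaceRing P) (algebraMap k[X] (RatFunc k) p) = 0 := by
    -- Over an algebraically closed field only constants and the functions X - b need checking.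
    rw [(IsAlgClosed.splits p).eq_prod_roots]
    rw [map_mul, map_multiset_prod, RatFunc.algebraMap_C, Multiset.map_map]
    have hne (b : k) : (RatFunc.X - RatFunc.C b : RatFunc k) ≠ 0 := by
      have := (RatFunc.algebraMap_ne_zero (K := k) (X_sub_C_ne_zero b))
      simpa using this
    have hprod (s : Multiset k) :
        (s.map (algebraMap k[X] (RatFunc k) ∘ fun a => X - C a)).prod ≠ 0 ∧
        ((Function.support fun P : Option k => ordZ (PlaceRing P)
          (s.map (algebraMap k[X] (RatFunc k) ∘ fun a => X - C a)).prod).Finite ∧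
        ∑ᶠ P : Option k, ordZ (PlaceRing P)
          (s.map (algebraMap k[X] (RatFunc k) ∘ fun a => X - C a)).prod = 0) := by
      induction s using Multiset.induction_on with
      | empty =>
        rw [Multiset.map_zero, Multiset.prod_zero, ← map_one RatFunc.C]
        exact ⟨by simp, hC one_ne_zero⟩
      | cons b s ih =>
        rw [Multiset.map_cons, Multiset.prod_cons, Function.comp_apply, map_sub,
          RatFunc.algebraMap_C, RatFunc.algebraMap_X]
        exact ⟨mul_ne_zero (hne b) ih.1, hmul (hne b) ih.1 (hX b) ih.2⟩
    have hlc : p.leadingCoeff ≠ 0 := leadingCoeff_ne_zero.mpr hp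
    exact hmul (by simpa using hlc) (hprod _).1 (hC hlc) (hprod _).2
  obtain ⟨p, q, hq, rfl⟩ := IsFractionRing.div_surjective (A := k[X]) g
  have hq0 : q ≠ 0 := nonZeroDivisors.ne_zero hq
  have hp0 : p ≠ 0 := by rintro rfl; simp at hg
  have hq' : algebraMap k[X] (RatFunc k) q ≠ 0 := RatFunc.algebraMap_ne_zero hq0
  rw [div_eq_mul_inv]
  exact hmul (RatFunc.algebraMap_ne_zero hp0) (inv_ne_zero hq') (hpoly hp0) (hinv hq' (hpoly hq0))

end PlaceRing

/-! ### Principal divisors on a curve -/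

namespace SmoothProjectiveCurve

variable {k : Type u} [Field k] (C : SmoothProjectiveCurve k)

instance : AlgebraicGeometry.IsNoetherian C.X :=
  { toCompactSpace := QuasiCompact.compactSpace_of_compactSpace C.str }

/-- A closed subset of a curve not containing the generic point is finite. -/
theorem finite_of_isClosed {Z : Set C.X} (hZ : IsClosed Z) (hη : genericPoint C.X ∉ Z) :
    Z.Finite := by
  obtain ⟨S, hS, hirr, h⟩ :=
    TopologicalSpace.NoetherianSpace.exists_finite_set_closeds_irreducible
      (⟨Z, hZ⟩ : TopologicalSpace.Closeds C.X)
  have hle : ∀ t ∈ S, (t : Set C.X) ⊆ Z := fun t ht => by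
    have : t ≤ ⟨Z, hZ⟩ := h ▸ le_sSup ht
    exact this
  have hfin : (⋃ t ∈ S, (t : Set C.X)).Finite := by
    refine hS.biUnion fun t ht => ?_
    obtain ⟨x, hx⟩ := QuasiSober.sober (hirr t ht) t.isClosed
    have hxt : x ∈ (t : Set C.X) := hx ▸ subset_closure (Set.mem_singleton x)
    have hxη : x ≠ genericPoint C.X := fun h => hη (h ▸ hle t ht hxt)
    have h2 : (t : Set C.X) = {x} :=
      hx.symm.trans (C.isClosed_singleton_of_ne hxη).closure_eq
    rw [h2]
    exact Set.finite_singleton x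
  have hcl : IsClosed (⋃ t ∈ S, (t : Set C.X)) := hS.isClosed_biUnion fun t _ => t.isClosed
  refine hfin.subset ?_
  have h3 : (⟨Z, hZ⟩ : TopologicalSpace.Closeds C.X) ≤ ⟨_, hcl⟩ := by
    rw [h]
    refine sSup_le fun t ht => ?_
    change (t : Set C.X) ⊆ ⋃ t ∈ S, (t : Set C.X)
    exact Set.subset_biUnion_of_mem (u := fun t : TopologicalSpace.Closeds C.X => (t : Set C.X)) ht
  exact h3

/-- A nonzero rational function on a curve is a unit at almost all points. -/
theorem finite_not_isUnit {g : C.X.functionField} (hg : g ≠ 0) :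
    {x : C.X | ¬ ∃ o : C.X.presheaf.stalk x, IsUnit o ∧ algebraMap _ C.X.functionField o = g}.Finite := by
  obtain ⟨U, -, s, ⟨x, hx⟩, hs, hu⟩ := exists_isUnit_germ_eq C.X g hg
  refine (C.finite_of_isClosed (Z := (U : Set C.X)ᶜ) U.isOpen.isClosed_compl fun h => h
    (((genericPoint_spec C.X).specializes trivial).mem_open U.isOpen hx)).subset fun z hz hzU => ?_
  exact hz ⟨C.X.presheaf.germ U z hzU s, hu.map _, (algebraMap_germ hzU s).trans hs⟩

theorem finite_ord_ne_zero {g : C.X.functionField} (hg : g ≠ 0) :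
    {x ∈ closedPoints C.X | Scheme.ord g x ≠ 0}.Finite := by
  refine (C.finite_not_isUnit hg).subset fun x ⟨hx, hx'⟩ h => hx' ?_
  rw [mem_closedPoints_iff] at hx
  have := C.isDiscreteValuationRing_stalk_of_ne hx
  rw [C.ord_eq_ordZ hx]
  exact (ordZ_eq_zero_iff hg).mpr h

section LiesOver

variable [IsAlgClosed k]

/-- The residue field at a closed point is k. -/
theorem exists_sub_stalkHom_mem (x : closedPoints C.X) (o : C.X.presheaf.stalk x.1) :
    ∃ a, o - C.stalkHom x.1 a ∈ maximalIdeal (C.X.presheaf.stalk x.1) := by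
  have h1 : (residueFieldIsoBase C.str x.1 x.2).inv =
      CommRingCat.ofHom (C.stalkHom x.1) ≫ C.X.residue x.1 := by
    apply Spec.map_injective
    refine (SpecMap_residueFieldIsoBase_inv C.str x.1 x.2).trans ?_
    rw [Spec.map_comp, ← fromSpecStalk_str]
    rfl
  obtain ⟨a, ha⟩ := (residueFieldIsoBase C.str x.1 x.2).symm.commRingCatIsoToRingEquiv.surjective
    (C.X.residue x.1 o)
  refine ⟨a, ?_⟩
  rw [← residue_eq_zero_iff, map_sub, sub_eq_zero]
  exact ha.symm.trans congr($(h1).hom a)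

variable [Algebra (RatFunc k) C.X.functionField]

/-- The point `x` of a curve over the projective line lies over the point `P`. -/
def LiesOver (P : Option k) (x : C.X) : Prop :=
  ∃ o ∈ maximalIdeal (C.X.presheaf.stalk x), algebraMap _ C.X.functionField o =
    algebraMap (RatFunc k) _ (placeUniformizer P)

variable {C}

omit [IsAlgClosed k] in
theorem LiesOver.ne_genericPoint {P : Option k} {x : C.X} (h : C.LiesOver P x) :
    x ≠ genericPoint C.X := by
  rintro rfl
  obtain ⟨o, ho, ho'⟩ := h
  have : o = 0 := by
    by_contra h0
    have hu : IsUnit (show C.X.functionField from o) := IsUnit.mk0 _ h0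
    exact (mem_maximalIdeal o).mp ho hu
  rw [this, map_zero, eq_comm, map_eq_zero] at ho'
  exact (transcendental_placeUniformizer P) (ho' ▸ isAlgebraic_zero)

omit [IsAlgClosed k] in
theorem LiesOver.mem_closedPoints {P : Option k} {x : C.X} (h : C.LiesOver P x) :
    x ∈ closedPoints C.X :=
  C.mem_closedPoints_iff.mpr h.ne_genericPoint

variable (hC : ∀ a, algebraMap (RatFunc k) C.X.functionField (RatFunc.C a) = C.constHom a)

include hC

/-- If X is regular at x, its value there is the point of the affine line; otherwise X⁻¹ is regular
and vanishes at x, which lies over infinity. -/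
theorem exists_liesOver (x : closedPoints C.X) : ∃ P, C.LiesOver P x.1 := by
  have := C.isDiscreteValuationRing_stalk_of_ne (C.mem_closedPoints_iff.mp x.2)
  have key (o : C.X.presheaf.stalk x.1) (ho : algebraMap _ C.X.functionField o =
      algebraMap (RatFunc k) _ RatFunc.X) : ∃ P, C.LiesOver P x.1 := by
    obtain ⟨a, ha⟩ := C.exists_sub_stalkHom_mem x o
    refine ⟨some a, _, ha, ?_⟩
    rw [map_sub, ho, algebraMap_stalkHom, ← hC, placeUniformizer, map_sub]
  rcases ValuationRing.isInteger_or_isInteger (C.X.presheaf.stalk x.1)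
    (algebraMap (RatFunc k) C.X.functionField RatFunc.X) with ⟨o, ho⟩ | ⟨o, ho⟩
  · exact key o ho
  · by_cases hu : IsUnit o
    · obtain ⟨u, rfl⟩ := hu
      refine key (u⁻¹ : _ˣ) ?_
      rw [← inv_inv (algebraMap (RatFunc k) C.X.functionField RatFunc.X), ← ho]
      exact eq_inv_of_mul_eq_one_left (by rw [← map_mul, Units.inv_mul, map_one])
    · exact ⟨none, o, hu, by rw [ho, placeUniformizer, map_inv₀]⟩

-- If two different uniformizers vanished at x, then 𝔪_x would contain the unit b - a, or 1 = X⁻¹ (X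
-- - a) + a X⁻¹ when one point is infinity.
omit [IsAlgClosed k] in
theorem LiesOver.unique {P Q : Option k} {x : C.X} (hP : C.LiesOver P x) (hQ : C.LiesOver Q x) :
    P = Q := by
  have hinj := IsFractionRing.injective (C.X.presheaf.stalk x) C.X.functionField
  have h1 (a : k) (h : C.LiesOver (some a) x) (h' : C.LiesOver none x) : False := by
    obtain ⟨o, ho, ho'⟩ := h
    obtain ⟨p, hp, hp'⟩ := h'
    have : p * o + C.stalkHom x a * p = 1 := hinj (by
      rw [map_add, map_mul, map_mul, ho', hp', algebraMap_stalkHom, ← hC, ← map_mul, ← map_mul,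
        ← map_add, map_one, ← map_one (algebraMap (RatFunc k) C.X.functionField)]
      congr 1
      have := RatFunc.X_ne_zero (K := k)
      simp only [placeUniformizer]
      field_simp
      ring)
    exact (Ideal.ne_top_iff_one _).mp (maximalIdeal.isMaximal _).ne_top
      (this ▸ add_mem (Ideal.mul_mem_right _ _ hp) (Ideal.mul_mem_left _ _ hp))
  match P, Q, hP, hQ with
  | none, none, _, _ => rfl
  | some a, none, h, h' => exact (h1 a h h').elim
  | none, some a, h', h => exact (h1 a h h').elim
  | some a, some b, ⟨o, ho, ho'⟩, ⟨p, hp, hp'⟩ =>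
    by_contra hab
    have h2 : o - p = C.stalkHom x (b - a) := hinj (by
      rw [map_sub, ho', hp', algebraMap_stalkHom, ← hC, ← map_sub]
      simp only [placeUniformizer, map_sub]
      ring)
    have h3 : IsUnit (C.stalkHom x (b - a)) :=
      (IsUnit.mk0 _ (sub_ne_zero.mpr fun h => hab (congrArg some h.symm))).map _
    exact (mem_maximalIdeal _).mp (h2 ▸ sub_mem ho hp) h3

omit hC in
variable (C) in
/-- The function field of a curve over the projective line, as an algebra over a local ring of the
projective line. -/
noncomputable instance placeAlgebra (P : Option k) : Algebra (PlaceRing P) C.X.functionField :=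
  ((algebraMap (RatFunc k) C.X.functionField).comp
    (algebraMap (PlaceRing P) (RatFunc k))).toAlgebra

omit hC in
instance (P : Option k) : IsScalarTower (PlaceRing P) (RatFunc k) C.X.functionField :=
  .of_algebraMap_eq fun _ => rfl

open Polynomial in
omit [IsAlgClosed k] in
theorem LiesOver.dominates {P : Option k} {x : C.X} (h : C.LiesOver P x) :
    ∃ g : PlaceRing P →+* C.X.presheaf.stalk x, IsLocalHom g ∧
      ∀ a, algebraMap _ C.X.functionField (g a) = algebraMap (PlaceRing P) _ a := by
  obtain ⟨t, ht, ht'⟩ := h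
  -- Sending X to t makes polynomials with nonzero constant coefficient units, so the map extends to
  -- the local ring at P.
  let e : k[X] →+* C.X.presheaf.stalk x := eval₂RingHom (C.stalkHom x) t
  have he (p : k[X]) (hp : p.coeff 0 ≠ 0) : IsUnit (e p) := by
    have h1 : e p = e p.divX * t + C.stalkHom x (p.coeff 0) := by
      conv_lhs => rw [← p.divX_mul_X_add]
      rw [map_add, map_mul]
      simp [e]
    by_contra hu
    have h2 : C.stalkHom x (p.coeff 0) ∈ maximalIdeal (C.X.presheaf.stalk x) := by
      rw [← sub_eq_iff_eq_add'.mpr h1]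
      exact sub_mem hu (Ideal.mul_mem_left _ _ ht)
    exact (mem_maximalIdeal _).mp h2 ((IsUnit.mk0 _ hp).map _)
  let g : PlaceRing P →+* C.X.presheaf.stalk x :=
    IsLocalization.lift (M := (Polynomial.idealX k).asIdeal.primeCompl) (g := e) fun q =>
      he q.1 ((mem_primeCompl_idealX q.1).mp q.2)
  have hg (p : k[X]) : g (algebraMap _ _ p) = e p := IsLocalization.lift_eq _ p
  refine ⟨g, ⟨fun r hr => ?_⟩, fun a => ?_⟩
  · by_contra hu
    have h1 : r ∈ maximalIdeal (PlaceRing P) := hu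
    rw [maximalIdeal_placeRing, Ideal.mem_span_singleton] at h1
    obtain ⟨s, rfl⟩ := h1
    rw [map_mul, hg] at hr
    have h2 : e Polynomial.X = t := Polynomial.eval₂_X (C.stalkHom x) t
    exact (mem_maximalIdeal _).mp (Ideal.mul_mem_right _ _ ht) (h2 ▸ hr)
  · have h1 : (algebraMap _ C.X.functionField).comp g = algebraMap (PlaceRing P) _ := by
      refine IsLocalization.ringHom_ext (Polynomial.idealX k).asIdeal.primeCompl ?_
      refine Polynomial.ringHom_ext (fun a => ?_) ?_
      · simp only [RingHom.comp_apply]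
        rw [hg, IsScalarTower.algebraMap_apply (PlaceRing P) (RatFunc k), algebraMap_placeRing,
          aeval_C, RatFunc.algebraMap_eq_C, hC]
        simp [e, algebraMap_stalkHom]
      · simp only [RingHom.comp_apply]
        rw [hg, IsScalarTower.algebraMap_apply (PlaceRing P) (RatFunc k), algebraMap_placeRing,
          aeval_X, ← ht']
        simp [e]
    exact congr($(h1) a)

instance (P : Option k) (x : {x : C.X // C.LiesOver P x}) :
    IsDiscreteValuationRing (C.X.presheaf.stalk x.1) :=
  C.isDiscreteValuationRing_stalk_of_ne x.2.ne_genericPoint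

omit [IsAlgClosed k] in
theorem isPlaceFamily_liesOver (P : Option k) : IsPlaceFamily (PlaceRing P) C.X.functionField
    fun x : {x : C.X // C.LiesOver P x} => C.X.presheaf.stalk x.1 where
  dominates x := x.2.dominates hC
  injective x y h := Subtype.ext (C.eq_of_range_eq h)
  exhaustive R hR hR' := by
    have hk (a : k) : C.constHom a ∈ R := by
      rw [← hC, ← RatFunc.algebraMap_eq_C, ← Polynomial.aeval_C (placeUniformizer P),
        ← algebraMap_placeRing, ← IsScalarTower.algebraMap_apply]
      exact hR _
    have ht : algebraMap (PlaceRing P) C.X.functionField (algebraMap _ _ (Polynomial.X : Polynomial k)) =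
        algebraMap (RatFunc k) _ (placeUniformizer P) := by
      rw [IsScalarTower.algebraMap_apply (PlaceRing P) (RatFunc k), algebraMap_placeRing,
        Polynomial.aeval_X]
    have htR := hR (algebraMap _ _ (Polynomial.X : Polynomial k))
    have htR' := hR' (algebraMap _ _ (Polynomial.X : Polynomial k))
      (by rw [maximalIdeal_placeRing]; exact Ideal.mem_span_singleton_self _) (by
        intro h0
        rw [h0, map_zero, eq_comm, map_eq_zero] at ht
        exact (transcendental_placeUniformizer P) (ht ▸ isAlgebraic_zero))
    rw [ht] at htR htR'
    obtain ⟨x, g, hg, hgx⟩ := C.exists_center R hk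
    -- At the generic point the local ring is the whole function field, but R omits the inverse of
    -- the uniformizer.
    have hx : x ≠ genericPoint C.X := by
      intro hx
      have hfield : IsField (C.X.presheaf.stalk x) := by
        subst hx
        exact Field.toIsField C.X.functionField
      obtain ⟨o, ho⟩ := (IsField.localization_map_bijective
        (Rₘ := C.X.functionField) (zero_notMem_nonZeroDivisors) hfield).2
        (algebraMap (RatFunc k) _ (placeUniformizer P))⁻¹
      rw [← ho, ← hgx] at htR'
      exact htR' (g o).2
    have := C.isDiscreteValuationRing_stalk_of_ne hx
    have hmem := mem_valuationSubring_iff_of_isLocalHom g hgx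
    obtain ⟨o, ho⟩ := (hmem _).mp htR
    refine ⟨⟨x, o, fun hu => ?_, ho⟩, hmem⟩
    obtain ⟨u, rfl⟩ := hu
    refine htR' ((hmem _).mpr ⟨(u⁻¹ : _ˣ), ?_⟩)
    rw [← ho]
    exact eq_inv_of_mul_eq_one_left (by rw [← map_mul, Units.inv_mul, map_one])

end LiesOver
end SmoothProjectiveCurve

namespace SmoothProjectiveCurve

variable {k : Type u} [Field k] [IsAlgClosed k] (C : SmoothProjectiveCurve k)

/-- The divisor of a nonzero rational function on a curve has degree zero. -/
theorem finsum_ord_eq_zero {g : C.X.functionField} (hg : g ≠ 0) :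
    ∑ᶠ x ∈ closedPoints C.X, Scheme.ord g x = 0 := by
  classical
  obtain ⟨_, hC, _, _⟩ := C.exists_ratFunc
  choose! π hπ using fun x (hx : x ∈ closedPoints C.X) => exists_liesOver hC ⟨x, hx⟩
  have hfin := C.finite_ord_ne_zero hg
  obtain ⟨hN, hN'⟩ := finsum_ordZ_ratFunc
    (Algebra.norm_ne_zero_iff.mpr hg : Algebra.norm (RatFunc k) g ≠ 0)
  -- The points over P are the places above the local ring at P, so the order of the norm at P is
  -- the sum of the orders above P.
  have key (P : Option k) : ∑ x ∈ hfin.toFinset with π x = P, Scheme.ord g x =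
      ordZ (PlaceRing P) (Algebra.norm (RatFunc k) g) := by
    have h := isPlaceFamily_liesOver hC P
    have := integralClosure.isDedekindDomain (PlaceRing P) (RatFunc k) C.X.functionField
    have := integralClosure.isFractionRing_of_finite_extension (A := PlaceRing P) (RatFunc k)
      C.X.functionField
    have := h.finite (K := RatFunc k)
    have : Fintype {x : C.X // C.LiesOver P x} := Fintype.ofFinite _
    rw [← h.sum_ordZ_eq_ordZ_norm hg]
    trans ∑ x ∈ (Finset.univ : Finset {x : C.X // C.LiesOver P x}).map (Function.Embedding.subtype _),
      Scheme.ord g x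
    · refine Finset.sum_subset (fun x hx => ?_) fun x hx hx' => ?_
      · obtain ⟨h1, rfl⟩ := Finset.mem_filter.mp hx
        exact Finset.mem_map.mpr
          ⟨⟨x, hπ x ((Set.Finite.mem_toFinset _).mp h1).1⟩, Finset.mem_univ _, rfl⟩
      · obtain ⟨⟨x, hxP⟩, -, rfl⟩ := Finset.mem_map.mp hx
        by_contra h0
        exact hx' (Finset.mem_filter.mpr ⟨(Set.Finite.mem_toFinset _).mpr ⟨hxP.mem_closedPoints, h0⟩,
          (hπ _ hxP.mem_closedPoints).unique hC hxP⟩)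
    · rw [Finset.sum_map]
      exact Finset.sum_congr rfl fun x _ => C.ord_eq_ordZ x.2.ne_genericPoint g
  rw [finsum_mem_eq_sum_of_inter_support_eq (t := hfin.toFinset) _ (by
      ext x
      simp only [Set.mem_inter_iff, Function.mem_support, Set.Finite.coe_toFinset,
        Set.mem_ofPred_eq]
      tauto),
    ← Finset.sum_fiberwise_of_maps_to (t := hfin.toFinset.image π ∪ hN.toFinset) (g := π)
      fun x hx => Finset.mem_union_left _ (Finset.mem_image_of_mem _ hx)]
  simp_rw [key]
  refine Eq.trans ?_ hN'
  refine (finsum_eq_sum_of_support_subset _ fun P hP => ?_).symm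
  exact Finset.mem_union_right _ ((Set.Finite.mem_toFinset _).mpr hP)

end SmoothProjectiveCurve

/-! ### Discriminants and bases of the stalks -/

/-- The discriminant of the images of elements of a free module in an algebra. -/
theorem discr_comp_eq_det_sq_mul {A K L M κ : Type*} [CommRing A] [CommRing K] [CommRing L]
    [Algebra A K] [Algebra K L] [Algebra A L] [IsScalarTower A K L] [AddCommGroup M] [Module A M]
    [Fintype κ] [DecidableEq κ] (e : Module.Basis κ A M) (φ : M →ₗ[A] L) (s : κ → M) :
    Algebra.discr K (φ ∘ s) = algebraMap A K (e.det s) ^ 2 * Algebra.discr K (φ ∘ e) := by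
  rw [e.det_apply, RingHom.map_det, ← Algebra.discr_of_matrix_vecMul]
  congr 1
  ext j
  rw [Function.comp_apply, ← e.sum_toMatrix_smul_self s j, map_sum]
  refine Finset.sum_congr rfl fun i _ => ?_
  rw [map_smul, Algebra.smul_def, mul_comm, Function.comp_apply,
    IsScalarTower.algebraMap_apply A K L]
  rfl

namespace CurveBundle

/-- The sum of the numbers `m_x - 1` over the points `x` of the fibre at `y`. -/
noncomputable def branchDegree {X Y : Scheme.{u}} (f : X ⟶ Y) (y : Y) : ℤ :=
  ∑ᶠ x : {x : X // f x = y}, ((mult f x.1 - 1 : ℕ) : ℤ)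

theorem branchDegree_nonneg {X Y : Scheme.{u}} (f : X ⟶ Y) (y : Y) : 0 ≤ branchDegree f y :=
  finsum_nonneg fun _ => Nat.cast_nonneg _

end CurveBundle

namespace SmoothProjectiveCurve

open CurveBundle

variable {k : Type u} [Field k] {X Y : SmoothProjectiveCurve k} {f : X.X ⟶ Y.X} [IsDominant f]

/-- Closed points have closed images, so only the generic point of X lies over that of Y, and every
rational function is regular there. -/
theorem range_stalkToField_genericPoint (hf : f ≫ Y.str = X.str) :
    LinearMap.range (stalkToField f (genericPoint Y.X)) = ⊤ := by
  rw [eq_top_iff]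
  rintro g -
  rw [mem_range_stalkToField_iff f (isClosedMap hf)]
  intro x hx
  have hx : x = genericPoint X.X := by
    by_contra h
    have h1 := isClosedMap hf _ (X.isClosed_singleton_of_ne h)
    rw [Set.image_singleton, hx] at h1
    exact Y.not_isClosed_genericPoint h1
  have hfield : IsField (X.X.presheaf.stalk x) := by
    subst hx
    exact Field.toIsField X.X.functionField
  exact (IsField.localization_map_bijective (Rₘ := FunField f)
    zero_notMem_nonZeroDivisors hfield).2 g

/-- The generic stalk of `f_* 𝒪_X` is the function field of `X`. -/
noncomputable def genericStalkEquiv (hf : f ≫ Y.str = X.str) :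
    Stalk (directImage f) (genericPoint Y.X) ≃ₗ[Y.X.functionField] FunField f :=
  LinearEquiv.ofInjective _ (stalkToField_injective f _) ≪≫ₗ
    LinearEquiv.ofTop _ (range_stalkToField_genericPoint hf)

theorem linearIndependent_stalkToField {y : Y.X} {κ : Type*} {s : κ → Stalk (directImage f) y}
    (hs : LinearIndependent (Y.X.presheaf.stalk y) s) :
    LinearIndependent Y.X.functionField (stalkToField f y ∘ s) :=
  (LinearIndependent.iff_fractionRing (Y.X.presheaf.stalk y) Y.X.functionField).mp
    (hs.map' _ (LinearMap.ker_eq_bot.mpr (stalkToField_injective f y)))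

variable [FiniteDimensional Y.X.functionField (FunField f)]
  [Algebra.IsSeparable Y.X.functionField (FunField f)]

/-- The trace form of a finite separable extension is nondegenerate. -/
theorem discr_stalkToField_ne_zero {y : Y.X}
    {s : Fin (mapDegree f) → Stalk (directImage f) y}
    (hs : LinearIndependent (Y.X.presheaf.stalk y) s) :
    Algebra.discr Y.X.functionField (stalkToField f y ∘ s) ≠ 0 := by
  obtain hn | hn := (mapDegree f).eq_zero_or_pos
  · have : IsEmpty (Fin (mapDegree f)) := by rw [hn]; infer_instance
    rw [Algebra.discr_def, Matrix.det_isEmpty]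
    exact one_ne_zero
  · have : Nonempty (Fin (mapDegree f)) := ⟨⟨0, hn⟩⟩
    have h := linearIndependent_stalkToField hs
    have hcard : Fintype.card (Fin (mapDegree f)) =
        Module.finrank Y.X.functionField (FunField f) := by
      rw [finrank_funField, Fintype.card_fin]
    have := Algebra.discr_not_zero_of_basis Y.X.functionField
      (basisOfLinearIndependentOfCardEqFinrank h hcard)
    rwa [coe_basisOfLinearIndependentOfCardEqFinrank] at this

omit [FiniteDimensional Y.X.functionField (FunField f)]
  [Algebra.IsSeparable Y.X.functionField (FunField f)] [IsDominant f] in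
theorem isUnit_natCast_stalk (hchar : ringChar k ≠ 0 → mapDegree f < ringChar k) (y : Y.X) {m : ℕ}
    (hm : 0 < m) (hm' : m ≤ mapDegree f) : IsUnit (m : Y.X.presheaf.stalk y) := by
  have h : (m : k) ≠ 0 := by
    rw [Ne, ringChar.spec]
    intro h
    by_cases h0 : ringChar k = 0
    · rw [h0, zero_dvd_iff] at h
      exact hm.ne' h
    · exact (hm'.trans_lt (hchar h0)).not_ge (Nat.le_of_dvd hm h)
  rw [← map_natCast (Y.stalkHom y)]
  exact (IsUnit.mk0 _ h).map _

variable [IsAlgClosed k]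

theorem sum_mult_eq_mapDegree (hf : f ≫ Y.str = X.str) (y : closedPoints Y.X)
    [Fintype {x : X.X // f x = y.1}] :
    ∑ x : {x : X.X // f x = y.1}, mult f x.1 = mapDegree f := by
  rw [← finrank_funField, (isPlaceFamily_closedPoint hf y).finrank_eq_sum (K := Y.X.functionField)]
  exact Finset.sum_congr rfl fun x _ => mult_eq_ramIdx x.2

theorem mult_pos (hf : f ≫ Y.str = X.str) (y : closedPoints Y.X) (x : {x : X.X // f x = y.1}) :
    0 < mult f x.1 := by
  have := finite_fiber hf y
  have : Fintype {x : X.X // f x = y.1} := Fintype.ofFinite _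
  rw [mult_eq_ramIdx x.2]
  exact ((isPlaceFamily_closedPoint hf y).isSplitFactorization (K := Y.X.functionField)).pos x

theorem mult_le_mapDegree (hf : f ≫ Y.str = X.str) (y : closedPoints Y.X)
    (x : {x : X.X // f x = y.1}) : mult f x.1 ≤ mapDegree f := by
  have := finite_fiber hf y
  have : Fintype {x : X.X // f x = y.1} := Fintype.ofFinite _
  rw [← sum_mult_eq_mapDegree hf y]
  exact Finset.single_le_sum (f := fun x : {x : X.X // f x = y.1} => mult f x.1)
    (fun _ _ => Nat.zero_le _) (Finset.mem_univ x)

/-- At the generic point the stalk is L; at a closed point the adapted basis has ∑ m_x = r elements.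
-/
theorem exists_basis_stalk (hf : f ≫ Y.str = X.str) (y : Y.X) :
    Nonempty (Module.Basis (Fin (mapDegree f)) (Y.X.presheaf.stalk y) (Stalk (directImage f) y)) := by
  by_cases hy : y = genericPoint Y.X
  · subst hy
    exact ⟨(Module.finBasisOfFinrankEq Y.X.functionField (FunField f) (finrank_funField f)).map
      (genericStalkEquiv hf).symm⟩
  · let y' : closedPoints Y.X := ⟨y, Y.mem_closedPoints_iff.mpr hy⟩
    have := finite_fiber hf y'
    have : Fintype {x : X.X // f x = y} := Fintype.ofFinite _
    obtain ⟨b, -⟩ := exists_basis_fiberSubspace hf y'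
    refine ⟨b.reindex (Fintype.equivFinOfCardEq ?_)⟩
    rw [Fintype.card_sigma]
    simp_rw [Fintype.card_fin]
    exact sum_mult_eq_mapDegree hf y'

theorem ordZ_discr_basis (hf : f ≫ Y.str = X.str)
    (hchar : ringChar k ≠ 0 → mapDegree f < ringChar k) (y : closedPoints Y.X)
    {κ : Type*} [Fintype κ] [DecidableEq κ]
    (e : Module.Basis κ (Y.X.presheaf.stalk y.1) (Stalk (directImage f) y.1)) :
    ordZ (Y.X.presheaf.stalk y.1) (Algebra.discr Y.X.functionField (stalkToField f y.1 ∘ e)) =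
      branchDegree f y.1 := by
  have := finite_fiber hf y
  have : Fintype {x : X.X // f x = y.1} := Fintype.ofFinite _
  rw [branchDegree, finsum_eq_sum_of_fintype]
  have h := (isPlaceFamily_closedPoint hf y).ordZ_discr (K := Y.X.functionField) (fun x => by
    rw [← mult_eq_ramIdx x.2]
    exact isUnit_natCast_stalk hchar y.1 (mult_pos hf y x) (mult_le_mapDegree hf y x))
    (e.map (stalkEquiv hf y))
  refine Eq.trans (congrArg _ ?_) (h.trans ?_)
  · congr 1
  · exact Finset.sum_congr rfl fun x _ => by rw [mult_eq_ramIdx x.2]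

/-- With a basis e of the stalk, the order of disc(s) is 2 ord(det_e(s)) plus `branchDegree`. Both
terms are nonnegative, so both vanish and det_e(s) is a unit. -/
theorem isBasis_of_ordZ_discr_eq_zero (hf : f ≫ Y.str = X.str)
    (hchar : ringChar k ≠ 0 → mapDegree f < ringChar k) (y : closedPoints Y.X)
    (s : Fin (mapDegree f) → Stalk (directImage f) y.1)
    (h0 : Algebra.discr Y.X.functionField (stalkToField f y.1 ∘ s) ≠ 0)
    (h : ordZ (Y.X.presheaf.stalk y.1)
      (Algebra.discr Y.X.functionField (stalkToField f y.1 ∘ s)) = 0) :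
    (LinearIndependent (Y.X.presheaf.stalk y.1) s ∧
      Submodule.span (Y.X.presheaf.stalk y.1) (Set.range s) = ⊤) ∧ branchDegree f y.1 = 0 := by
  obtain ⟨e⟩ := exists_basis_stalk hf y.1
  have he := discr_comp_eq_det_sq_mul (K := Y.X.functionField) e (stalkToField f y.1) s
  rw [he] at h0 h
  obtain ⟨h1, h2⟩ := mul_ne_zero_iff.mp h0
  have h3 : algebraMap (Y.X.presheaf.stalk y.1) Y.X.functionField (e.det s) ≠ 0 :=
    fun h => h1 (by rw [h, zero_pow two_ne_zero])
  rw [ordZ_mul h1 h2, ordZ_pow h3, ordZ_discr_basis hf hchar] at h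
  have h4 : 0 ≤ ordZ (Y.X.presheaf.stalk y.1)
      (algebraMap (Y.X.presheaf.stalk y.1) Y.X.functionField (e.det s)) :=
    (ordZ_nonneg_iff h3).mpr ⟨_, rfl⟩
  have h5 := branchDegree_nonneg f y.1
  push_cast at h
  refine ⟨e.is_basis_iff_det.mpr ?_, by linarith⟩
  obtain ⟨o, ho, ho'⟩ := (ordZ_eq_zero_iff (O := Y.X.presheaf.stalk y.1) h3).mp (by linarith)
  rwa [← IsFractionRing.injective (Y.X.presheaf.stalk y.1) Y.X.functionField ho']

end SmoothProjectiveCurve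

namespace CurveBundle

theorem exists_sections_germ_eq {Y : Scheme.{u}} (M : Y.Modules) {y : Y} {n : ℕ}
    (t : Fin n → Stalk M y) :
    ∃ (V : Y.Opens) (hy : y ∈ V) (s : Fin n → Γ(M, V)), ∀ i, germ M y hy (s i) = t i := by
  choose W hW s hs using fun i => exists_germ_eq M (t i)
  let V : Y.Opens := ⟨⋂ i, W i, isOpen_iInter_of_finite fun i => (W i).isOpen⟩
  have hV (i : Fin n) : V ≤ W i := Set.iInter_subset (fun i => (W i : Set Y)) i
  have hy : y ∈ V := Set.mem_iInter.mpr hW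
  exact ⟨V, hy, fun i => M.presheaf.map (homOfLE (hV i)).op (s i), fun i =>
    (germ_res M (homOfLE (hV i)) hy (s i)).trans (hs i)⟩

end CurveBundle

/-! ### Local freeness, the degree, and the conclusion -/

namespace SmoothProjectiveCurve

open CurveBundle

variable {k : Type u} [Field k] [IsAlgClosed k] {X Y : SmoothProjectiveCurve k} {f : X.X ⟶ Y.X}
  [IsDominant f] [FiniteDimensional Y.X.functionField (FunField f)]
  [Algebra.IsSeparable Y.X.functionField (FunField f)]

theorem isBasis_genericStalk (hf : f ≫ Y.str = X.str)
    (s : Fin (mapDegree f) → Stalk (directImage f) (genericPoint Y.X))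
    (h0 : Algebra.discr Y.X.functionField (stalkToField f (genericPoint Y.X) ∘ s) ≠ 0) :
    LinearIndependent (Y.X.presheaf.stalk (genericPoint Y.X)) s ∧
      Submodule.span (Y.X.presheaf.stalk (genericPoint Y.X)) (Set.range s) = ⊤ := by
  obtain ⟨e⟩ := exists_basis_stalk hf (genericPoint Y.X)
  rw [discr_comp_eq_det_sq_mul (K := Y.X.functionField) e (stalkToField f (genericPoint Y.X)) s]
    at h0
  refine e.is_basis_iff_det.mpr (IsUnit.mk0 (show Y.X.functionField from e.det s) fun h => ?_)
  refine (mul_ne_zero_iff.mp h0).1 ?_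
  rw [show e.det s = 0 from h, map_zero, zero_pow two_ne_zero]

/-- The discriminant is taken in the function field, where the germs of a section at all points have
the same image; hence a single D serves for all z. -/
theorem exists_discr_ne_zero (hf : f ≫ Y.str = X.str) (y : Y.X) :
    ∃ (V : Y.X.Opens) (hy : y ∈ V) (s : Fin (mapDegree f) → Γ(directImage f, V))
      (D : Y.X.functionField), D ≠ 0 ∧
      (∀ z hz, Algebra.discr Y.X.functionField
        (stalkToField f z ∘ fun i => germ (directImage f) z hz (s i)) = D) ∧
      LinearIndependent (Y.X.presheaf.stalk y) (fun i => germ (directImage f) y hy (s i)) ∧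
      Submodule.span (Y.X.presheaf.stalk y)
        (Set.range fun i => germ (directImage f) y hy (s i)) = ⊤ := by
  obtain ⟨e⟩ := exists_basis_stalk hf y
  obtain ⟨V, hy, s, hs⟩ := exists_sections_germ_eq (directImage f) e
  have hs' : (fun i => germ (directImage f) y hy (s i)) = e := funext hs
  refine ⟨V, hy, s, _, ?_, fun z hz => congrArg _ (funext fun i =>
    (stalkToField_germ f hz (s i)).trans (stalkToField_germ f hy (s i)).symm), ?_, ?_⟩
  · refine discr_stalkToField_ne_zero (s := fun i => germ (directImage f) y hy (s i)) ?_
    rw [hs']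
    exact e.linearIndependent
  · rw [hs']
    exact e.linearIndependent
  · rw [hs']
    exact e.span_eq

theorem isVectorBundle_directImage (hf : f ≫ Y.str = X.str)
    (hchar : ringChar k ≠ 0 → mapDegree f < ringChar k) :
    IsVectorBundle (directImage f) (mapDegree f) := by
  intro y
  obtain ⟨V, hy, s, D, hD, hsD, hbasis⟩ := exists_discr_ne_zero hf y
  -- The point y is kept even if D vanishes there, as at a branch point: the sections form a basis
  -- at y by construction.
  let B : Set Y.X := {z ∈ closedPoints Y.X | Scheme.ord D z ≠ 0} \ {y}
  have hBfin : B.Finite := (Y.finite_ord_ne_zero hD).subset Set.sdiff_subset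
  have hBclosed : IsClosed B := by
    rw [← Set.biUnion_of_singleton B]
    exact hBfin.isClosed_biUnion fun z hz => hz.1.1
  let W : Y.X.Opens := V ⊓ ⟨Bᶜ, hBclosed.isOpen_compl⟩
  have hWV : W ≤ V := inf_le_left
  refine ⟨W, ⟨hy, fun h => h.2 rfl⟩, fun i => (directImage f).presheaf.map (homOfLE hWV).op (s i),
    fun z hz => ?_⟩
  have hres : (fun i => germ (directImage f) z hz
      ((directImage f).presheaf.map (homOfLE hWV).op (s i))) =
        fun i => germ (directImage f) z (hWV hz) (s i) :=
    funext fun i => germ_res (directImage f) (homOfLE hWV) hz (s i)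
  rw [hres]
  by_cases hzy : z = y
  · subst hzy
    exact hbasis
  by_cases hzη : z = genericPoint Y.X
  · subst hzη
    exact isBasis_genericStalk hf _ ((hsD _ (hWV hz)).trans_ne hD)
  · have hzc := Y.mem_closedPoints_iff.mpr hzη
    have := Y.isDiscreteValuationRing_stalk_of_ne hzη
    refine (isBasis_of_ordZ_discr_eq_zero hf hchar ⟨z, hzc⟩ _
      ((hsD _ (hWV hz)).trans_ne hD) ?_).1
    rw [hsD _ (hWV hz), ← Y.ord_eq_ordZ hzη]
    by_contra h
    exact hz.2 ⟨⟨hzc, h⟩, hzy⟩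

/-- Branching is confined to the closed points where the discriminant of a generic basis has nonzero
order, and to those outside the domain of its sections. -/
theorem finite_branchDegree_ne_zero (hf : f ≫ Y.str = X.str)
    (hchar : ringChar k ≠ 0 → mapDegree f < ringChar k) :
    {y ∈ closedPoints Y.X | branchDegree f y ≠ 0}.Finite := by
  obtain ⟨V, hy, s, D, hD, hsD, -⟩ := exists_discr_ne_zero hf (genericPoint Y.X)
  refine ((Y.finite_ord_ne_zero hD).union (Y.finite_of_isClosed (Z := (V : Set Y.X)ᶜ)
    V.isOpen.isClosed_compl fun h => h hy)).subset fun z ⟨hzc, hz⟩ => ?_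
  by_contra h
  simp only [Set.mem_union, Set.mem_ofPred_eq, not_or, not_and, not_not, Set.mem_compl_iff] at h
  have hzη := Y.mem_closedPoints_iff.mp hzc
  have := Y.isDiscreteValuationRing_stalk_of_ne hzη
  refine hz (isBasis_of_ordZ_discr_eq_zero hf hchar ⟨z, hzc⟩ _ ((hsD _ h.2).trans_ne hD) ?_).2
  rw [hsD _ h.2, ← Y.ord_eq_ordZ hzη]
  exact h.1 hzc

omit [IsAlgClosed k] in
theorem mem_branchLocus_iff (hf : f ≫ Y.str = X.str) (y : Y.X) :
    y ∈ branchLocus f ↔ y ∈ closedPoints Y.X ∧ branchDegree f y ≠ 0 := by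
  constructor
  · rintro ⟨x, ⟨hx, hx2⟩, rfl⟩
    have hc : f x ∈ closedPoints Y.X := by
      have h1 := isClosedMap hf _ hx
      rwa [Set.image_singleton] at h1
    refine ⟨hc, fun h => ?_⟩
    have := finite_fiber hf ⟨f x, hc⟩
    have : Fintype {z : X.X // f z = f x} := Fintype.ofFinite _
    rw [branchDegree, finsum_eq_sum_of_fintype,
      Finset.sum_eq_zero_iff_of_nonneg fun _ _ => Nat.cast_nonneg _] at h
    have h1 := h ⟨x, rfl⟩ (Finset.mem_univ _)
    rw [Nat.cast_eq_zero] at h1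
    simp only at h1
    omega
  · rintro ⟨hc, h⟩
    obtain ⟨x, hx⟩ : ∃ x : {x : X.X // f x = y}, ((mult f x.1 - 1 : ℕ) : ℤ) ≠ 0 := by
      by_contra! h'
      exact h (by rw [branchDegree, finsum_congr h', finsum_zero])
    refine ⟨x.1, ⟨X.mem_closedPoints_iff.mpr
      (ne_genericPoint_of_map (Y.mem_closedPoints_iff.mp hc) x), ?_⟩, x.2⟩
    rw [Nat.cast_ne_zero] at hx
    omega

/-- Take orders in disc(e) = det_b(e)² disc(b) for a basis e of the stalk at y: disc(e) has order
`branchDegree`, and `detOrder` is minus the order of det_b(e). -/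
theorem two_mul_detOrder (hf : f ≫ Y.str = X.str)
    (hchar : ringChar k ≠ 0 → mapDegree f < ringChar k) {n : ℕ} (hn : n = mapDegree f)
    (b : Module.Basis (Fin n) Y.X.functionField (Stalk (directImage f) (genericPoint Y.X)))
    {y : Y.X} (hy : y ∈ closedPoints Y.X) :
    2 * detOrder (directImage f) b y =
      Scheme.ord (Algebra.discr Y.X.functionField (genericStalkEquiv hf ∘ b)) y -
        branchDegree f y := by
  subst hn
  have hyη := Y.mem_closedPoints_iff.mp hy
  have := Y.isDiscreteValuationRing_stalk_of_ne hyη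
  rw [detOrder, dif_pos (exists_basis_stalk hf y)]
  generalize (exists_basis_stalk hf y).some = e
  have h1 := discr_comp_eq_det_sq_mul (K := Y.X.functionField) b (genericStalkEquiv hf).toLinearMap
    (toGeneric (directImage f) y ∘ e)
  have h2 : (genericStalkEquiv hf).toLinearMap ∘ toGeneric (directImage f) y ∘ e =
      stalkToField f y ∘ e := funext fun i => stalkToField_toGeneric f (e i)
  rw [h2, Algebra.algebraMap_self, RingHom.id_apply] at h1
  have h3 := discr_stalkToField_ne_zero (f := f) e.linearIndependent
  have h4 := ordZ_discr_basis hf hchar ⟨y, hy⟩ e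
  rw [h1] at h3 h4
  obtain ⟨h5, h6⟩ := mul_ne_zero_iff.mp h3
  have h7 : b.det (toGeneric (directImage f) y ∘ e) ≠ 0 :=
    fun h => h5 (by rw [h, zero_pow two_ne_zero])
  rw [ordZ_mul h5 h6, ordZ_pow h7] at h4
  rw [Y.ord_eq_ordZ hyη, Y.ord_eq_ordZ hyη]
  change 2 * -ordZ (Y.X.presheaf.stalk y) (b.det (toGeneric (directImage f) y ∘ e)) =
    ordZ (Y.X.presheaf.stalk y) (Algebra.discr Y.X.functionField
      ((genericStalkEquiv hf).toLinearMap ∘ b)) - _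
  rw [← h4]
  push_cast
  ring

/-- The degree of `f_* 𝒪_X` in terms of the ramification of `f`. -/
theorem two_mul_degree_directImage (hf : f ≫ Y.str = X.str)
    (hchar : ringChar k ≠ 0 → mapDegree f < ringChar k) :
    2 * degree (directImage f) =
      -∑ y ∈ (finite_branchDegree_ne_zero hf hchar).toFinset, branchDegree f y := by
  classical
  have hrank : Module.finrank Y.X.functionField (Stalk (directImage f) (genericPoint Y.X)) =
      mapDegree f := by
    rw [← finrank_funField, (genericStalkEquiv hf).finrank_eq]
  have : Module.Finite Y.X.functionField (Stalk (directImage f) (genericPoint Y.X)) :=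
    .equiv (genericStalkEquiv hf).symm
  have hne : Nonempty (Module.Basis (Fin (Module.finrank Y.X.functionField
      (Stalk (directImage f) (genericPoint Y.X)))) Y.X.functionField
        (Stalk (directImage f) (genericPoint Y.X))) := ⟨Module.finBasis _ _⟩
  rw [degree, dif_pos hne]
  generalize hne.some = b
  have hD : Algebra.discr Y.X.functionField (genericStalkEquiv hf ∘ b) ≠ 0 := by
    exact Algebra.discr_not_zero_of_basis _ (b.map (genericStalkEquiv hf))
  have h2 (y : Y.X) (hy : y ∈ closedPoints Y.X) := two_mul_detOrder hf hchar hrank b hy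
  generalize Algebra.discr Y.X.functionField (genericStalkEquiv hf ∘ b) = D at hD h2
  have hb := finite_branchDegree_ne_zero hf hchar
  have hfinD := Y.finite_ord_ne_zero hD
  -- One finite set containing both supports turns the sums over closed points into finite sums that
  -- can be added.
  have conv (F : Y.X → ℤ) (hF : ∀ y ∈ closedPoints Y.X, F y ≠ 0 →
      Scheme.ord D y ≠ 0 ∨ branchDegree f y ≠ 0) :
      ∑ᶠ y ∈ closedPoints Y.X, F y = ∑ y ∈ hfinD.toFinset ∪ hb.toFinset, F y := by
    refine finsum_mem_eq_sum_of_inter_support_eq _ ?_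
    ext y
    have := hF y
    simp only [Set.mem_inter_iff, Function.mem_support, Finset.coe_union, Set.Finite.coe_toFinset,
      Set.mem_union, Set.mem_ofPred_eq]
    tauto
  have h0 := Y.finsum_ord_eq_zero hD
  rw [conv _ fun y _ => Or.inl] at h0
  rw [conv _ fun y hy h => by
    have := h2 y hy
    by_contra! h'
    rw [h'.1, h'.2] at this
    exact h (by linarith), Finset.mul_sum]
  have hsub : ∑ y ∈ hb.toFinset, branchDegree f y =
      ∑ y ∈ hfinD.toFinset ∪ hb.toFinset, branchDegree f y := by
    refine Finset.sum_subset Finset.subset_union_right fun y hy hy' => ?_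
    by_contra h
    refine hy' ((Set.Finite.mem_toFinset _).mpr ⟨?_, h⟩)
    simp only [Finset.mem_union, Set.Finite.mem_toFinset, Set.mem_ofPred_eq] at hy
    tauto
  rw [hsub, Finset.sum_congr rfl fun y hy => h2 y (by
    simp only [Finset.mem_union, Set.Finite.mem_toFinset, Set.mem_ofPred_eq] at hy
    tauto), Finset.sum_sub_distrib, h0, zero_sub]

theorem isParabolicBundle_directImageParabolic (hf : f ≫ Y.str = X.str)
    (hchar : ringChar k ≠ 0 → mapDegree f < ringChar k) :
    (directImageParabolic f).IsParabolicBundle (mapDegree f) := by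
  have hcl (y : Y.X) (hy : y ∈ branchLocus f) : y ∈ closedPoints Y.X :=
    ((mem_branchLocus_iff hf y).mp hy).1
  have hw (y : Y.X) (hy : y ∈ branchLocus f) (j : Fin (weightFinset f y).card) :=
    (mem_weightFinset_iff hf ⟨y, hcl y hy⟩ _).mp ((weightFinset f y).orderEmbOfFin_mem rfl j)
  refine
    { isVectorBundle := isVectorBundle_directImage hf hchar
      finite_divisor := (finite_branchDegree_ne_zero hf hchar).subset
        fun y hy => (mem_branchLocus_iff hf y).mp hy
      closed_points := hcl
      flag_first := fun y hy => ?_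
      flag_last := fun y hy => ?_
      flag_strictAnti := fun y hy => ?_
      weight_nonneg := fun y hy j => ?_
      weight_lt_one := fun y hy j => ?_
      weight_strictMono := fun y hy => ((weightFinset f y).orderEmbOfFin rfl).strictMono }
  · obtain ⟨b, hb⟩ := exists_basis_flag hf ⟨y, hcl y hy⟩
    have h := mem_weightFinset_iff hf ⟨y, hcl y hy⟩
    have hy' := hy
    obtain ⟨x, ⟨-, hx⟩, hxy⟩ := hy'
    have := weightFlag_zero b h ⟨0, (h 0).mpr ⟨⟨⟨x, hxy⟩, ⟨0, two_pos.trans_le hx⟩⟩, by simp⟩⟩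
    rw [← hb] at this
    exact this
  · obtain ⟨b, hb⟩ := exists_basis_flag hf ⟨y, hcl y hy⟩
    have := weightFlag_last b (fun p => (p.2 : ℚ) / mult f p.1.1) (weightFinset f y)
    rw [← hb] at this
    exact this
  · obtain ⟨b, hb⟩ := exists_basis_flag hf ⟨y, hcl y hy⟩
    have := weightFlag_strictAnti b (mem_weightFinset_iff hf ⟨y, hcl y hy⟩)
    rw [← hb] at this
    exact this
  · obtain ⟨p, hp⟩ := hw y hy j
    exact (by positivity : (0 : ℚ) ≤ (p.2 : ℚ) / mult f p.1.1).trans_eq hp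
  · obtain ⟨p, hp⟩ := hw y hy j
    refine hp.symm.trans_lt ?_
    rw [div_lt_one (by exact_mod_cast p.2.pos)]
    exact_mod_cast p.2.2

theorem parDeg_directImageParabolic (hf : f ≫ Y.str = X.str)
    (hchar : ringChar k ≠ 0 → mapDegree f < ringChar k) : (directImageParabolic f).parDeg = 0 := by
  have hb := finite_branchDegree_ne_zero hf hchar
  have h1 : 2 * (degree (directImage f) : ℚ) = -∑ y ∈ hb.toFinset, (branchDegree f y : ℚ) := by
    exact_mod_cast two_mul_degree_directImage hf hchar
  have h2 : ∑ᶠ y ∈ (directImageParabolic f).D, ∑ j, (directImageParabolic f).weight y j *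
      ((directImageParabolic f).multiplicity y j : ℚ) =
        ∑ y ∈ hb.toFinset, (branchDegree f y : ℚ) / 2 := by
    have hD : (directImageParabolic f).D = (hb.toFinset : Set Y.X) := by
      ext y
      rw [Set.Finite.coe_toFinset]
      exact mem_branchLocus_iff hf y
    rw [hD, finsum_mem_coe_finset]
    refine Finset.sum_congr rfl fun y hy => ?_
    have hyc := ((Set.Finite.mem_toFinset _).mp hy).1
    have := finite_fiber hf ⟨y, hyc⟩
    have : Fintype {x : X.X // f x = y} := Fintype.ofFinite _
    refine (sum_weight_mul_multiplicity hf ⟨y, hyc⟩).trans ?_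
    rw [branchDegree, finsum_eq_sum_of_fintype]
    push_cast
    rfl
  rw [ParabolicData.parDeg, h2, ← Finset.sum_div]
  change (degree (directImage f) : ℚ) + _ = 0
  linarith

end SmoothProjectiveCurve

/-- The bound on the characteristic acts twice: it makes k(X) separable over k(Y), and it makes
every multiplicity m_x ≤ r invertible, so that ramification is tame. -/
theorem lemma1 {k : Type u} [Field k] [IsAlgClosed k]
    (X Y : SmoothProjectiveCurve k) (f : X.X ⟶ Y.X) (hf : f ≫ Y.str = X.str)
    (hdom : IsDominant f)
    (hsm : ∃ U : X.X.Opens, (U : Set X.X).Nonempty ∧ Smooth (U.ι ≫ f))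
    (hchar : ringChar k ≠ 0 → CurveBundle.mapDegree f < ringChar k) :
    (CurveBundle.directImageParabolic f).IsParabolicBundle (CurveBundle.mapDegree f) ∧
      (CurveBundle.directImageParabolic f).parDeg = 0 := by
  have := SmoothProjectiveCurve.finiteDimensional_funField hf
  have := SmoothProjectiveCurve.isSeparable_funField hf hchar
  exact ⟨SmoothProjectiveCurve.isParabolicBundle_directImageParabolic hf hchar,
    SmoothProjectiveCurve.parDeg_directImageParabolic hf hchar⟩
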